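/- A planar polygon is a compact set $L\subset\mathbb{R}^2$ that is the closure of its interior and whose boundary is the union of finitely many straight edges joining finitely many vertices, such that every vertex is an endpoint of exactly two edges and distinct edges meet at most in common endpoints (so the boundary is a disjoint union of simple closed polygonal curves). It is in general position if distinct vertices have distinct $y$-coordinates, and it is $n$-connected if $L$ is connected and its boundary has exactly $n$ connected components. The Reeb graph of the height function $h(x,y)=y$ on $L$ is the quotient space of $L$ obtained by collapsing each connected component of each level set $h^{-1}(c)\cap L$ to a point; its vertices are the images of the vertices of $L$. The Reeb graph of $L$ is optimal if no polygon in general position has a Reeb graph that is homotopy equivalent to that of $L$ and has fewer vertices. **Theorem.** Let $n\ge 1$. (1) If $L$ is an $n$-connected polygon in general position whose Reeb graph is optimal, then this Reeb graph has exactly $3n$ vertices. (2) The Reeb graph of every $n$-connected polygon in general position has at least $3n$ vertices. (3) The bound is attained: there is an $n$-connected polygon in general position, namely a triangle with $n-1$ pairwise disjoint triangular holes in its interior (whose vertices are exactly the corners of these triangles), whose Reeb graph is optimal and has exactly $3n$ vertices. -/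

import Mathlib

/-- A (possibly multiply connected) planar polygon: a compact region of the plane that is the
closure of its interior and whose boundary is a finite union of straight edges, forming pairwise
disjoint simple closed polygonal curves.  The vertices and edges of the boundary are recorded
as data. -/
structure PlanarPolygon where
  /-- the region -/
  carrier : Set (ℝ × ℝ)
  /-- the vertices of the polygon -/
  vertices : Finset (ℝ × ℝ)
  /-- the edges of the polygon, as an adjacency relation between vertices -/
  edges : SimpleGraph (ℝ × ℝ)
  mem_vertices_of_adj : ∀ v w, edges.Adj v w → v ∈ vertices
  /-- every vertex is an endpoint of exactly two edges -/
  ncard_neighborSet : ∀ v ∈ vertices, (edges.neighborSet v).ncard = 2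
  /-- distinct edges meet at most in common endpoints -/
  segment_inter_segment : ∀ a b c d, edges.Adj a b → edges.Adj c d → s(a, b) ≠ s(c, d) →
    segment ℝ a b ∩ segment ℝ c d ⊆ {a, b} ∩ {c, d}
  isCompact_carrier : IsCompact carrier
  closure_interior_carrier : closure (interior carrier) = carrier
  /-- the boundary of the region is the union of the edges -/
  frontier_carrier : frontier carrier = {p | ∃ a b, edges.Adj a b ∧ p ∈ segment ℝ a b}

namespace PlanarPolygon

/-- General position with respect to the height function `h (x, y) = y`: distinct vertices have
distinct heights. -/
def InGeneralPosition (P : PlanarPolygon) : Prop :=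
  ∀ v ∈ P.vertices, ∀ w ∈ P.vertices, v ≠ w → v.2 ≠ w.2

/-- `n`-connected: the region is connected and its boundary has `n` connected components. -/
def IsNConnected (P : PlanarPolygon) (n : ℕ) : Prop :=
  IsConnected P.carrier ∧ Nat.card (ConnectedComponents (frontier P.carrier)) = n

/-- The fiber through `x`: the connected component containing `x` of the level set of the height
function on the polygon. -/
def fiber (P : PlanarPolygon) (x : P.carrier) : Set (ℝ × ℝ) :=
  connectedComponentIn {p | p ∈ P.carrier ∧ p.2 = x.1.2} x.1

/-- Two points of the polygon are equivalent when they lie on the same fiber. -/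
def fiberSetoid (P : PlanarPolygon) : Setoid P.carrier := Setoid.ker P.fiber

/-- The Reeb graph of the height function: the quotient space of the polygon by the relation of
lying on the same fiber, with the quotient topology. -/
abbrev ReebGraph (P : PlanarPolygon) : Type := Quotient P.fiberSetoid

/-- The vertices of the Reeb graph: the fibers that pass through a vertex of the polygon. -/
def reebVertices (P : PlanarPolygon) : Set P.ReebGraph :=
  {q | ∃ x : P.carrier, x.1 ∈ P.vertices ∧ Quotient.mk P.fiberSetoid x = q}

/-- The Reeb graph of `P` is optimal: no polygon in general position has a Reeb graph that is
homotopy equivalent to that of `P` and has fewer vertices. -/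
def HasOptimalReebGraph (P : PlanarPolygon) : Prop :=
  ¬ ∃ Q : PlanarPolygon, Q.InGeneralPosition ∧
    Nonempty (ContinuousMap.HomotopyEquiv P.ReebGraph Q.ReebGraph) ∧
    Q.reebVertices.ncard < P.reebVertices.ncard

/-- `P` is a triangle with `m` pairwise disjoint triangular holes in its interior, and its vertices
are exactly the corners of these triangles. -/
def IsTriangleWithTriangularHoles (P : PlanarPolygon) (m : ℕ) : Prop :=
  ∃ (A : Affine.Triangle ℝ (ℝ × ℝ)) (H : Fin m → Affine.Triangle ℝ (ℝ × ℝ)),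
    (∀ i, convexHull ℝ (Set.range (H i).points) ⊆
      interior (convexHull ℝ (Set.range A.points))) ∧
    (∀ i j, i ≠ j → Disjoint (convexHull ℝ (Set.range (H i).points))
      (convexHull ℝ (Set.range (H j).points))) ∧
    P.carrier = convexHull ℝ (Set.range A.points) \
      ⋃ i, interior (convexHull ℝ (Set.range (H i).points)) ∧
    (P.vertices : Set (ℝ × ℝ)) = Set.range A.points ∪ ⋃ i, Set.range (H i).points

end PlanarPolygon

/-!
Both inequalities come from comparing three numbers attached to a polygon `P` in general position:
the number `v` of its vertices, the number `n` of components of its boundary, and the number `b` of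
independent loops of its Reeb graph.

*Vertices and components.* In general position each fiber contains at most one vertex, so the Reeb
graph has exactly `v` vertices (`PlanarPolygon.ncard_reebVertices`). Every component of the boundary
contains a vertex, and with a vertex its two neighbours, so `3 * n ≤ v`
(`PlanarPolygon.three_mul_card_le`). This is part (2).

*Loops and components.* Cut the plane along the horizontal lines through the vertices. Inside each
slab the edges of `P` are disjoint segments, ordered from left to right, and the fibers in that slab
form one open interval for each segment that has the interior of `P` on its right. Hence the Reeb
graph is the realization of a finite graph: its vertices are the fibers at the heights of polygon
vertices, its edges are these left segments (`SweepRegion.nonempty_homeomorph`). Contracting edges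
that are not loops turns a connected finite graph into a bouquet of circles
(`GraphReal.exists_homotopyEquiv_bouquet`), and the claim is that the number `b` of its circles
satisfies `b + 1 ≤ n`. To see this without the Jordan curve theorem, assign to a flow `z` on the
graph and to a boundary segment the total flow through the left segments strictly to its left: this
is the winding number of the flow around that segment. Conservation of the flow at the vertices
makes it locally constant on the boundary, so it is a function on the components of the boundary
(`SweepRegion.winding_eq_of_component`). It vanishes on the component of a leftmost segment, and it
determines the flow, since the difference of the winding numbers at the two ends of a fiber is the
flow through that fiber. The space of flows therefore has dimension at most `n - 1`
(`SweepRegion.card_leftPiece_add_two_le`).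

*The example.* A triangle with `m` triangular holes stacked above each other has `3 * (m + 1)`
vertices and `m + 1` boundary components, so its Reeb graph has at most `m` independent loops. It
has exactly `m`: for each hole there is a map from the Reeb graph to the circle that winds once
around this hole and not around the others, so these maps are independent modulo maps with a real
logarithm, and a bouquet of `b` circles carries at most `b` such maps
(`card_le_of_homotopyEquiv_bouquet`).

*Conclusion.* The Reeb graph of an `n`-connected polygon is homotopy equivalent to that of the
triangle with `b ≤ n - 1` stacked holes, which has `3 * (b + 1) ≤ 3 * n` vertices; so an optimal one
has at most `3 * n` vertices, which is part (1). Conversely, a polygon whose Reeb graph is homotopy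
equivalent to that of the triangle with `m` stacked holes has `b = m`, hence at least `m + 1`
boundary components and at least `3 * (m + 1)` vertices; so the example is optimal.
-/

open Set Topology Filter

/-! ### Geometric realizations of finite multigraphs -/

/-- The geometric realization of the multigraph with vertex set `V`, edge set `E` and endpoint maps
`s`, `t`.  As a set it is the disjoint union of the vertices and of one open interval per edge; the
topology is the one coinduced by the edges (see `GraphReal.edge`). -/
def GraphReal {V E : Type} (_s _t : E → V) : Type := V ⊕ (E × Ioo (0 : ℝ) 1)

namespace GraphReal

variable {V E : Type} {s t : E → V}

/-- The point of the realization given by a vertex. -/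
def vert (s t : E → V) (v : V) : GraphReal s t := Sum.inl v

/-- The point with parameter `r` in the interior of the edge `e`. -/
def inner (s t : E → V) (e : E) (r : Ioo (0 : ℝ) 1) : GraphReal s t := Sum.inr (e, r)

/-- The edge `e` of the realization, as a curve over `ℝ`: it runs from `s e` to `t e` for
parameters in `[0, 1]` and is constant outside this interval. -/
noncomputable def edge (s t : E → V) (e : E) (r : ℝ) : GraphReal s t :=
  if h0 : r ≤ 0 then vert s t (s e) else if h1 : 1 ≤ r then vert s t (t e) else
    inner s t e ⟨r, not_le.1 h0, not_le.1 h1⟩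

noncomputable instance : TopologicalSpace (GraphReal s t) :=
  ⨆ e, TopologicalSpace.coinduced (edge s t e) inferInstance

lemma edge_of_nonpos {e : E} {r : ℝ} (h : r ≤ 0) : edge s t e r = vert s t (s e) := by
  unfold edge
  rw [dif_pos h]

lemma edge_of_one_le {e : E} {r : ℝ} (h : 1 ≤ r) : edge s t e r = vert s t (t e) := by
  have : ¬ r ≤ 0 := by linarith
  unfold edge
  rw [dif_neg this, dif_pos h]

lemma edge_of_mem {e : E} {r : ℝ} (h : r ∈ Ioo (0 : ℝ) 1) :
    edge s t e r = inner s t e ⟨r, h⟩ := by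
  unfold edge
  rw [dif_neg (not_le.2 h.1), dif_neg (not_le.2 h.2)]

@[elab_as_elim]
lemma ind {p : GraphReal s t → Prop} (hv : ∀ v, p (vert s t v))
    (he : ∀ e, ∀ r ∈ Ioo (0 : ℝ) 1, p (edge s t e r)) (x : GraphReal s t) : p x := by
  rcases x with v | ⟨e, r, hr⟩
  · exact hv v
  · have := he e r hr
    rwa [edge_of_mem hr] at this

lemma continuous_edge (e : E) : Continuous (edge s t e) :=
  continuous_iSup_rng (i := e) continuous_coinduced_rng

lemma continuous_of_edge {Y : Type*} [TopologicalSpace Y] {f : GraphReal s t → Y}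
    (h : ∀ e, Continuous fun r => f (edge s t e r)) : Continuous f :=
  continuous_iSup_dom.2 fun e => continuous_coinduced_dom.2 (h e)

/-- The map out of the realization given by `a` on the vertices and by `p e` on the edge `e`. -/
def glue {Y : Type*} (a : V → Y) (p : E → ℝ → Y) : GraphReal s t → Y :=
  Sum.elim a fun x => p x.1 x.2

@[simp] lemma glue_vert {Y : Type*} (a : V → Y) (p : E → ℝ → Y) (v : V) :
    glue a p (vert s t v) = a v := rfl

lemma glue_edge {Y : Type*} (a : V → Y) (p : E → ℝ → Y) {e : E} (h0 : ∀ r ≤ 0, p e r = a (s e))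
    (h1 : ∀ r, 1 ≤ r → p e r = a (t e)) (r : ℝ) : glue a p (edge s t e r) = p e r := by
  by_cases hr0 : r ≤ 0
  · rw [edge_of_nonpos hr0, h0 r hr0, glue_vert]
  by_cases hr1 : 1 ≤ r
  · rw [edge_of_one_le hr1, h1 r hr1, glue_vert]
  · rw [edge_of_mem ⟨not_le.1 hr0, not_le.1 hr1⟩]
    rfl

lemma glue_edge_of_mem {Y : Type*} (a : V → Y) (p : E → ℝ → Y) {e : E} {r : ℝ}
    (hr : r ∈ Ioo (0 : ℝ) 1) : glue a p (edge s t e r) = p e r := by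
  rw [edge_of_mem hr]
  rfl

lemma continuous_glue {Y : Type*} [TopologicalSpace Y] {a : V → Y} {p : E → ℝ → Y}
    (hp : ∀ e, Continuous (p e)) (h0 : ∀ e, ∀ r ≤ 0, p e r = a (s e))
    (h1 : ∀ e r, 1 ≤ r → p e r = a (t e)) : Continuous (glue a p : GraphReal s t → Y) :=
  continuous_of_edge fun e => by
    simpa only [glue_edge a p (h0 e) (h1 e)] using hp e

/-- A homotopy on a realization may be checked for continuity on the vertices and on the edges
separately. -/
lemma continuous_uncurry {Y T : Type*} [TopologicalSpace Y] [TopologicalSpace T]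
    [LocallyCompactSpace T] {F : GraphReal s t → T → Y}
    (hv : ∀ v, Continuous (F (vert s t v)))
    (he : ∀ e, Continuous fun x : ℝ × T => F (edge s t e x.1) x.2) :
    Continuous fun x : GraphReal s t × T => F x.1 x.2 := by
  have hc : ∀ x, Continuous (F x) := fun x => by
    induction x using ind with
    | hv v => exact hv v
    | he e r hr => exact (he e).comp (Continuous.prodMk_right r)
  have : Continuous fun x => (⟨F x, hc x⟩ : C(T, Y)) :=
    continuous_of_edge fun e => ContinuousMap.continuous_of_continuous_uncurry _ (he e)
  exact ContinuousMap.continuous_uncurry_of_continuous ⟨_, this⟩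

instance [Finite V] [Finite E] : CompactSpace (GraphReal s t) := by
  have : (univ : Set (GraphReal s t)) =
      range (vert s t) ∪ ⋃ e, edge s t e '' Icc (0 : ℝ) 1 := by
    refine (eq_univ_of_forall fun x => ?_).symm
    induction x using ind with
    | hv v => exact Or.inl ⟨v, rfl⟩
    | he e r hr => exact Or.inr (mem_iUnion.2 ⟨e, r, ⟨hr.1.le, hr.2.le⟩, rfl⟩)
  refine ⟨this ▸ (finite_range _).isCompact.union (isCompact_iUnion fun e => ?_)⟩
  exact isCompact_Icc.image (continuous_edge e)

/-! ### Homotopy type of a connected graph -/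

/-- A preconnected realization with at least two vertices has an edge that is not a loop. -/
lemma exists_nonloop [PreconnectedSpace (GraphReal s t)] {a b : V} (hab : a ≠ b) :
    ∃ e, s e ≠ t e := by
  by_contra! h
  let : TopologicalSpace V := ⊥
  have : DiscreteTopology V := ⟨rfl⟩
  have hc : Continuous (glue id (fun e _ => s e) : GraphReal s t → V) :=
    continuous_glue (fun e => continuous_const) (fun _ _ _ => rfl) (fun e _ _ => h e)
  exact hab (PreconnectedSpace.constant ‹_› hc (x := vert s t a) (y := vert s t b))

/-- Relabelling vertices and edges does not change the realization. -/
noncomputable def congrHomeo {V' E' : Type} {s' t' : E' → V'} (v : V ≃ V') (ε : E ≃ E')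
    (hs : ∀ e, s' (ε e) = v (s e)) (ht : ∀ e, t' (ε e) = v (t e)) :
    GraphReal s t ≃ₜ GraphReal s' t' where
  toFun := glue (fun a => vert s' t' (v a)) (fun e => edge s' t' (ε e))
  invFun := glue (fun a => vert s t (v.symm a)) (fun e => edge s t (ε.symm e))
  left_inv x := by
    induction x using ind with
    | hv a => simp
    | he e r hr => rw [glue_edge_of_mem _ _ hr, glue_edge_of_mem _ _ hr, Equiv.symm_apply_apply]
  right_inv x := by
    induction x using ind with
    | hv a => simp
    | he e r hr => rw [glue_edge_of_mem _ _ hr, glue_edge_of_mem _ _ hr, Equiv.apply_symm_apply]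
  continuous_toFun := continuous_glue (fun e => continuous_edge _)
    (fun e r hr => by rw [edge_of_nonpos hr, hs]) (fun e r hr => by rw [edge_of_one_le hr, ht])
  continuous_invFun := continuous_glue (fun e => continuous_edge _)
    (fun e r hr => by
      rw [edge_of_nonpos hr, ← v.symm_apply_apply (s _), ← hs, Equiv.apply_symm_apply])
    (fun e r hr => by
      rw [edge_of_one_le hr, ← v.symm_apply_apply (t _), ← ht, Equiv.apply_symm_apply])

section Contraction

variable (s t) (e₀ : E)

open Classical in
/-- The vertex map of the contraction of the non-loop edge `e₀`: `s e₀` is moved to `t e₀`. -/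
noncomputable def contractVert (h : s e₀ ≠ t e₀) (v : V) : {v // v ≠ s e₀} :=
  if hv : v = s e₀ then ⟨t e₀, h.symm⟩ else ⟨v, hv⟩

variable {s t e₀}

lemma contractVert_self (h : s e₀ ≠ t e₀) : contractVert s t e₀ h (s e₀) = ⟨t e₀, h.symm⟩ := by
  simp [contractVert]

lemma contractVert_of_ne (h : s e₀ ≠ t e₀) {v : V} (hv : v ≠ s e₀) :
    contractVert s t e₀ h v = ⟨v, hv⟩ := by
  simp [contractVert, hv]

variable (s t e₀)

/-- The endpoint map of the contracted graph induced by `u = s` or `u = t`. -/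
noncomputable def contractEnd (h : s e₀ ≠ t e₀) (u : E → V) (e : {e // e ≠ e₀}) :
    {v // v ≠ s e₀} := contractVert s t e₀ h (u e)

open Classical in
/-- The curve followed by the vertex `v` while `s e₀` is pushed along `e₀`. -/
noncomputable def pushVert (v : V) (r : ℝ) : GraphReal s t :=
  if v = s e₀ then edge s t e₀ r else vert s t v

variable {s t e₀}

lemma continuous_pushVert (v : V) : Continuous (pushVert s t e₀ v) := by
  unfold pushVert
  split_ifs
  exacts [continuous_edge _, continuous_const]

lemma pushVert_of_nonpos (v : V) {r : ℝ} (hr : r ≤ 0) : pushVert s t e₀ v r = vert s t v := by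
  unfold pushVert
  split_ifs with h
  · rw [edge_of_nonpos hr, h]
  · rfl

lemma pushVert_of_one_le (h : s e₀ ≠ t e₀) (v : V) {r : ℝ} (hr : 1 ≤ r) :
    pushVert s t e₀ v r = vert s t (contractVert s t e₀ h v : V) := by
  by_cases hv : v = s e₀
  · subst hv
    simp [pushVert, edge_of_one_le hr, contractVert_self h]
  · simp [pushVert, hv, contractVert_of_ne h hv]

variable (s t e₀)

/-- The edge `e`, prolonged on both sides by the curves along which its endpoints are pushed; it is
traversed for parameters in `[-1, 2]`. -/
noncomputable def longEdge (e : E) (r : ℝ) : GraphReal s t :=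
  if r ≤ 0 then pushVert s t e₀ (s e) (-r) else
    if r ≤ 1 then edge s t e r else pushVert s t e₀ (t e) (r - 1)

variable {s t e₀}

lemma longEdge_of_nonpos (e : E) {r : ℝ} (hr : r ≤ 0) :
    longEdge s t e₀ e r = pushVert s t e₀ (s e) (-r) := by
  simp [longEdge, hr]

lemma longEdge_of_one_le (e : E) {r : ℝ} (hr : 1 ≤ r) :
    longEdge s t e₀ e r = pushVert s t e₀ (t e) (r - 1) := by
  have h0 : ¬ r ≤ 0 := by linarith
  rcases hr.eq_or_lt with rfl | h1
  · simp [longEdge, edge_of_one_le le_rfl, pushVert_of_nonpos]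
  · simp [longEdge, h0, not_le.2 h1]

lemma longEdge_of_mem (e : E) {r : ℝ} (hr : r ∈ Ioo (0 : ℝ) 1) :
    longEdge s t e₀ e r = edge s t e r := by
  simp [longEdge, not_le.2 hr.1, hr.2.le]

lemma continuous_longEdge (e : E) : Continuous (longEdge s t e₀ e) := by
  unfold longEdge
  refine Continuous.if_le ((continuous_pushVert _).comp continuous_neg) ?_ continuous_id
    continuous_const ?_
  · refine Continuous.if_le (continuous_edge e)
      ((continuous_pushVert _).comp (continuous_id.sub continuous_const)) continuous_id
      continuous_const ?_
    rintro r rfl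
    simp [edge_of_one_le le_rfl, pushVert_of_nonpos]
  · rintro r rfl
    simp [edge_of_nonpos le_rfl, pushVert_of_nonpos]

open Classical in
/-- The quotient map that contracts the edge `e₀`. -/
noncomputable def contractMap (h : s e₀ ≠ t e₀) :
    GraphReal s t → GraphReal (contractEnd s t e₀ h s) (contractEnd s t e₀ h t) :=
  glue (fun v => vert _ _ (contractVert s t e₀ h v)) fun e r =>
    if he : e = e₀ then vert _ _ ⟨t e₀, h.symm⟩ else edge _ _ ⟨e, he⟩ r

lemma contractMap_edge_self (h : s e₀ ≠ t e₀) (r : ℝ) :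
    contractMap h (edge s t e₀ r) = vert _ _ ⟨t e₀, h.symm⟩ := by
  unfold contractMap
  rw [glue_edge _ _ (fun r hr => by simp [contractVert_self])
    (fun r hr => by simp [contractVert_of_ne h h.symm])]
  simp

lemma contractMap_edge (h : s e₀ ≠ t e₀) {e : E} (he : e ≠ e₀) (r : ℝ) :
    contractMap h (edge s t e r) = edge _ _ ⟨e, he⟩ r := by
  unfold contractMap
  rw [glue_edge _ _ (fun r hr => by simp [he, edge_of_nonpos hr, contractEnd])
    (fun r hr => by simp [he, edge_of_one_le hr, contractEnd])]
  simp [he]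

lemma contractMap_vert (h : s e₀ ≠ t e₀) (v : V) :
    contractMap h (vert s t v) = vert _ _ (contractVert s t e₀ h v) := rfl

lemma continuous_contractMap (h : s e₀ ≠ t e₀) : Continuous (contractMap h) :=
  continuous_of_edge fun e => by
    by_cases he : e = e₀
    · subst he
      simpa only [contractMap_edge_self] using continuous_const
    · simpa only [contractMap_edge h he] using continuous_edge _

lemma contractMap_pushVert (h : s e₀ ≠ t e₀) (v : V) (r : ℝ) :
    contractMap h (pushVert s t e₀ v r) = vert _ _ (contractVert s t e₀ h v) := by
  by_cases hv : v = s e₀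
  · subst hv
    simp [pushVert, contractMap_edge_self, contractVert_self]
  · simp [pushVert, hv, contractMap_vert]

/-- The homotopy inverse of the contraction. -/
noncomputable def expandMap (h : s e₀ ≠ t e₀) :
    GraphReal (contractEnd s t e₀ h s) (contractEnd s t e₀ h t) → GraphReal s t :=
  glue (fun v => vert s t v) fun e r => longEdge s t e₀ e (3 * r - 1)

lemma expandMap_edge (h : s e₀ ≠ t e₀) (e : {e // e ≠ e₀}) (r : ℝ) :
    expandMap h (edge _ _ e r) = longEdge s t e₀ e (3 * r - 1) := by
  unfold expandMap
  rw [glue_edge]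
  · intro r hr
    rw [longEdge_of_nonpos _ (by linarith), pushVert_of_one_le h _ (by linarith)]
    rfl
  · intro r hr
    rw [longEdge_of_one_le _ (by linarith), pushVert_of_one_le h _ (by linarith)]
    rfl

lemma continuous_expandMap (h : s e₀ ≠ t e₀) : Continuous (expandMap h) :=
  continuous_of_edge fun e => by
    simp only [expandMap_edge]
    exact (continuous_longEdge _).comp (by fun_prop)

open Classical in
/-- The homotopy on the graph that pushes `s e₀` along `e₀` to `t e₀`. -/
noncomputable def pushHomotopy (s t : E → V) (e₀ : E) (x : GraphReal s t) (τ : ℝ) :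
    GraphReal s t :=
  glue (fun v => pushVert s t e₀ v τ) (fun e r =>
    if e = e₀ then edge s t e₀ ((1 - τ) * max 0 (min r 1) + τ) else
      longEdge s t e₀ e ((1 + 2 * τ) * max 0 (min r 1) - τ)) x

lemma pushHomotopy_edge_self (h : s e₀ ≠ t e₀) (r : ℝ) {τ : ℝ} :
    pushHomotopy s t e₀ (edge s t e₀ r) τ =
      edge s t e₀ ((1 - τ) * max 0 (min r 1) + τ) := by
  unfold pushHomotopy
  rw [glue_edge]
  · simp
  · intro r hr
    simp [pushVert, min_eq_left (hr.trans zero_le_one), max_eq_left hr]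
  · intro r hr
    simp [pushVert, h.symm, min_eq_right hr, edge_of_one_le]

lemma pushHomotopy_edge {e : E} (he : e ≠ e₀) (r : ℝ) {τ : ℝ} (hτ : 0 ≤ τ) :
    pushHomotopy s t e₀ (edge s t e r) τ =
      longEdge s t e₀ e ((1 + 2 * τ) * max 0 (min r 1) - τ) := by
  unfold pushHomotopy
  rw [glue_edge]
  · simp [he]
  · intro r hr
    simp only [he, if_false, min_eq_left (hr.trans zero_le_one), max_eq_left hr]
    rw [longEdge_of_nonpos _ (by linarith)]
    simp
  · intro r hr
    simp only [he, if_false, min_eq_right hr, max_eq_right zero_le_one]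
    rw [longEdge_of_one_le _ (by linarith)]
    congr 1; ring

lemma pushHomotopy_zero (h : s e₀ ≠ t e₀) (x : GraphReal s t) : pushHomotopy s t e₀ x 0 = x := by
  induction x using ind with
  | hv v => exact pushVert_of_nonpos _ le_rfl
  | he e r hr =>
    by_cases he : e = e₀
    · subst he
      rw [pushHomotopy_edge_self h]
      simp [min_eq_left hr.2.le, max_eq_right hr.1.le]
    · rw [pushHomotopy_edge he _ le_rfl, min_eq_left hr.2.le, max_eq_right hr.1.le]
      rw [← longEdge_of_mem (e₀ := e₀) e hr]
      congr 1; ring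

lemma pushHomotopy_one (h : s e₀ ≠ t e₀) (x : GraphReal s t) :
    pushHomotopy s t e₀ x 1 = expandMap h (contractMap h x) := by
  induction x using ind with
  | hv v => exact pushVert_of_one_le h _ le_rfl
  | he e r hr =>
    by_cases he : e = e₀
    · subst he
      rw [pushHomotopy_edge_self h, contractMap_edge_self, edge_of_one_le (by simp)]
      rfl
    · rw [pushHomotopy_edge he _ zero_le_one, min_eq_left hr.2.le, max_eq_right hr.1.le,
        contractMap_edge h he, expandMap_edge]
      congr 1; ring

lemma contractMap_pushHomotopy_expand (h : s e₀ ≠ t e₀) {e : E} (he : e ≠ e₀) (r : ℝ) :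
    contractMap h (longEdge s t e₀ e r) = edge _ _ ⟨e, he⟩ r := by
  by_cases h0 : r ≤ 0
  · rw [longEdge_of_nonpos _ h0, contractMap_pushVert, edge_of_nonpos h0]
    rfl
  by_cases h1 : 1 ≤ r
  · rw [longEdge_of_one_le _ h1, contractMap_pushVert, edge_of_one_le h1]
    rfl
  · rw [longEdge_of_mem _ ⟨not_le.1 h0, not_le.1 h1⟩, contractMap_edge h he]

/-- Contracting an edge that is not a loop is a homotopy equivalence. -/
noncomputable def contractEquiv (h : s e₀ ≠ t e₀) : ContinuousMap.HomotopyEquiv (GraphReal s t)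
    (GraphReal (contractEnd s t e₀ h s) (contractEnd s t e₀ h t)) where
  toFun := ⟨contractMap h, continuous_contractMap h⟩
  invFun := ⟨expandMap h, continuous_expandMap h⟩
  left_inv := by
    refine ContinuousMap.Homotopic.symm ⟨⟨⟨fun x => pushHomotopy s t e₀ x.2 x.1, ?_⟩,
      fun x => pushHomotopy_zero h x, fun x => pushHomotopy_one h x⟩⟩
    refine (continuous_uncurry (F := fun x (τ : unitInterval) => pushHomotopy s t e₀ x τ)
      (fun v => (continuous_pushVert v).comp continuous_subtype_val) fun e => ?_).comp
      continuous_swap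
    by_cases he : e = e₀
    · subst he
      simp only [pushHomotopy_edge_self h]
      exact (continuous_edge _).comp (by fun_prop)
    · exact ((continuous_longEdge (s := s) (t := t) (e₀ := e₀) e).comp
        (f := fun x : ℝ × unitInterval => (1 + 2 * (x.2 : ℝ)) * max 0 (min x.1 1) - x.2)
        (by fun_prop)).congr fun x => (pushHomotopy_edge he x.1 x.2.2.1).symm
  right_inv := by
    refine ContinuousMap.Homotopic.symm ⟨⟨⟨fun x => glue (fun v => vert _ _ v)
      (fun e r => edge _ _ e ((1 + 2 * (x.1 : ℝ)) * r - x.1)) x.2, ?_⟩, fun x => ?_, fun x => ?_⟩⟩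
    · have key : ∀ e r, ∀ τ : unitInterval,
          (glue (fun v => vert _ _ v) (fun e r => edge _ _ e ((1 + 2 * (τ : ℝ)) * r - τ))
          (edge (contractEnd s t e₀ h s) (contractEnd s t e₀ h t) e r) :
          GraphReal (contractEnd s t e₀ h s) (contractEnd s t e₀ h t)) =
          edge _ _ e ((1 + 2 * (τ : ℝ)) * r - τ) := by
        intro e r τ
        have := τ.2.1
        rw [glue_edge]
        · intro r hr
          rw [edge_of_nonpos (by nlinarith)]
        · intro r hr
          rw [edge_of_one_le (by nlinarith)]
      refine (continuous_uncurry (F := fun x (τ : unitInterval) => glue (fun v => vert _ _ v)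
        (fun e r => edge _ _ e ((1 + 2 * (τ : ℝ)) * r - τ)) x) (fun v => continuous_const)
        fun e => ?_).comp continuous_swap
      simp only [key]
      exact (continuous_edge _).comp (by fun_prop)
    · induction x using ind with
      | hv v => rfl
      | he e r hr =>
        simp only [ContinuousMap.id_apply]
        refine (glue_edge_of_mem _ _ hr).trans ?_
        simp
    · induction x using ind with
      | hv v => exact congrArg _ (contractVert_of_ne h v.2).symm
      | he e r hr =>
        change glue (fun v => vert _ _ v) (fun e r => edge _ _ e
          ((1 + 2 * (1 : ℝ)) * r - 1)) (edge _ _ e r) =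
          contractMap h (expandMap h (edge _ _ e r))
        rw [glue_edge_of_mem _ _ hr, expandMap_edge, contractMap_pushHomotopy_expand h e.2]
        congr 1; ring

end Contraction

end GraphReal

/-- Preconnectedness is a homotopy invariant. -/
lemma ContinuousMap.HomotopyEquiv.preconnectedSpace {X Y : Type*} [TopologicalSpace X]
    [TopologicalSpace Y] (h : ContinuousMap.HomotopyEquiv X Y) [PreconnectedSpace X] :
    PreconnectedSpace Y := by
  obtain ⟨H⟩ := h.right_inv
  refine preconnectedSpace_of_forall_constant fun u hu x y => ?_
  have hH : ∀ z, u (h.toFun (h.invFun z)) = u z := fun z => by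
    have hc : Continuous fun τ : unitInterval => u (H (τ, z)) :=
      hu.comp (H.continuous.comp (Continuous.prodMk_left z))
    have := PreconnectedSpace.constant inferInstance hc (x := 0) (y := 1)
    simpa using this
  rw [← hH x, ← hH y]
  exact PreconnectedSpace.constant ‹_› (hu.comp h.toFun.continuous)

/-- The bouquet of `b` circles. -/
abbrev Bouquet (b : ℕ) : Type := GraphReal (fun _ : Fin b => ()) (fun _ => ())

namespace GraphReal

/-- A finite connected graph is homotopy equivalent to a bouquet of `|E| - |V| + 1` circles:
contract edges that are not loops until there is one vertex left. -/
theorem exists_homotopyEquiv_bouquet (k : ℕ) : ∀ {V E : Type} [Finite V] [Finite E]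
    (s t : E → V) [PreconnectedSpace (GraphReal s t)], Nat.card V = k + 1 →
    ∃ b, b + (k + 1) = Nat.card E + 1 ∧
      Nonempty (ContinuousMap.HomotopyEquiv (GraphReal s t) (Bouquet b)) := by
  induction k with
  | zero =>
    intro V E _ _ s t _ hV
    obtain ⟨_, ⟨v⟩⟩ := Nat.card_eq_one_iff_unique.1 hV
    have : Unique V := uniqueOfSubsingleton v
    refine ⟨Nat.card E, by omega, ⟨(congrHomeo (Equiv.ofUnique V Unit)
      (Finite.equivFin E) (fun _ => rfl) (fun _ => rfl)).toHomotopyEquiv⟩⟩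
  | succ k ih =>
    intro V E _ _ s t _ hV
    have : Nontrivial V := by
      rw [← Finite.one_lt_card_iff_nontrivial]; omega
    obtain ⟨a, b, hab⟩ := exists_pair_ne V
    obtain ⟨e₀, h⟩ := exists_nonloop (s := s) (t := t) hab
    have := (contractEquiv h).preconnectedSpace
    have hcard : ∀ (α : Type) [Finite α] (x : α), Nat.card {y // y ≠ x} + 1 = Nat.card α := by
      intro α _ x
      classical
      have := Fintype.ofFinite α
      rw [Nat.card_eq_fintype_card, Nat.card_eq_fintype_card, Fintype.card_subtype_compl,
        Fintype.card_subtype_eq]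
      have : 0 < Fintype.card α := Fintype.card_pos_iff.2 ⟨x⟩
      omega
    have hV' := hcard V (s e₀)
    have hE' := hcard E e₀
    obtain ⟨b, hb, ⟨f⟩⟩ := ih (contractEnd s t e₀ h s) (contractEnd s t e₀ h t) (by omega)
    exact ⟨b, by omega, ⟨(contractEquiv h).trans f⟩⟩

end GraphReal

/-! ### Circle-valued maps and their degrees -/

/-- Two continuous real functions with the same image in the circle differ by a constant. -/
lemma sub_eq_sub_of_circleExp_eq {A : Type*} [TopologicalSpace A] [PreconnectedSpace A]
    {θ θ' : A → ℝ} (hθ : Continuous θ) (hθ' : Continuous θ')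
    (h : ∀ a, Circle.exp (θ a) = Circle.exp (θ' a)) (a b : A) : θ a - θ' a = θ b - θ' b := by
  obtain ⟨m, hm⟩ := Circle.exp_eq_exp.1 (h a)
  have := Circle.isCoveringMap_exp.eq_of_comp_eq hθ
    (show Continuous fun x => θ' x + m * (2 * Real.pi) by fun_prop) (by
      ext1 x
      exact (h x).trans (Circle.exp_eq_exp.2 ⟨-m, by push_cast; ring⟩)) a hm
  rw [congrFun this a, congrFun this b]
  ring

/-- Having a real-valued logarithm is invariant under homotopy of maps to the circle. -/
lemma exists_lift_of_homotopic {X : Type*} [TopologicalSpace X] {u v : C(X, Circle)}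
    (h : u.Homotopic v) (hu : ∃ θ : C(X, ℝ), ∀ x, u x = Circle.exp (θ x)) :
    ∃ θ : C(X, ℝ), ∀ x, v x = Circle.exp (θ x) := by
  obtain ⟨H⟩ := h
  obtain ⟨θ, hθ⟩ := hu
  have h0 : ∀ a, H.toContinuousMap (0, a) = Circle.exp (θ a) := fun a => by
    rw [← hθ]; exact H.apply_zero a
  refine ⟨(Circle.isCoveringMap_exp.liftHomotopy H.toContinuousMap θ h0).comp
    ⟨fun x => (1, x), by fun_prop⟩, fun x => ?_⟩
  have := congrFun (Circle.isCoveringMap_exp.liftHomotopy_lifts H.toContinuousMap θ h0) (1, x)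
  exact (H.apply_one x).symm.trans this.symm

lemma exists_lift_real (u : C(ℝ, Circle)) : ∃ θ : C(ℝ, ℝ), ∀ x, u x = Circle.exp (θ x) := by
  obtain ⟨e, he⟩ := Circle.exp_surjective (u 0)
  obtain ⟨F, hF, -⟩ := Circle.isCoveringMap_exp.existsUnique_continuousMap_lifts u 0 e he
  exact ⟨F, fun x => (congrFun hF.2 x).symm⟩

lemma circleExp_sum {ι : Type*} (s : Finset ι) (c : ι → ℤ) (θ : ι → ℝ) :
    Circle.exp (∑ i ∈ s, c i * θ i) = ∏ i ∈ s, Circle.exp (θ i) ^ c i := by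
  classical
  induction s using Finset.induction_on with
  | empty => simp
  | insert i s hi ih =>
    rw [Finset.sum_insert hi, Finset.prod_insert hi, Circle.exp_add, ih, Circle.exp_intCast_mul]

/-- If the space `X` is homotopy equivalent to a bouquet of `b` circles and carries `a` maps to the
circle that are multiplicatively independent modulo maps with a real logarithm, then `a ≤ b`:
the classes of such maps are determined by their degrees on the `b` loops. -/
theorem card_le_of_homotopyEquiv_bouquet {X : Type*} [TopologicalSpace X] {a b : ℕ}
    (h : ContinuousMap.HomotopyEquiv X (Bouquet b)) (f : Fin a → C(X, Circle))
    (hf : ∀ c : Fin a → ℤ, (∃ θ : C(X, ℝ), ∀ x, ∏ i, f i x ^ c i = Circle.exp (θ x)) → c = 0) :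
    a ≤ b := by
  have hl : ∀ i e, ∃ θ : C(ℝ, ℝ), ∀ r,
      f i (h.invFun (GraphReal.edge _ _ e r)) = Circle.exp (θ r) := fun i e =>
    exists_lift_real ⟨fun r => f i (h.invFun (GraphReal.edge _ _ e r)),
      (f i).continuous.comp (h.invFun.continuous.comp (GraphReal.continuous_edge e))⟩
  choose θ hθ using hl
  have hk : ∀ i e, ∃ k : ℤ, θ i e 1 = θ i e 0 + k * (2 * Real.pi) := fun i e => by
    refine Circle.exp_eq_exp.1 ?_
    rw [← hθ, ← hθ, GraphReal.edge_of_one_le le_rfl, GraphReal.edge_of_nonpos le_rfl]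
  choose k hk using hk
  have hli : LinearIndependent ℤ k := by
    rw [Fintype.linearIndependent_iff]
    intro c hc
    suffices c = 0 from fun i => congrFun this i
    have hlift : ∃ Θ : C(Bouquet b, ℝ), ∀ y,
        ∏ i, f i (h.invFun y) ^ c i = Circle.exp (Θ y) := by
      obtain ⟨θ₀, hθ₀⟩ := Circle.exp_surjective
        (∏ i, f i (h.invFun (GraphReal.vert _ _ ())) ^ c i)
      let p : Fin b → ℝ → ℝ := fun e r =>
        ∑ i, c i * θ i e (max 0 (min r 1)) - ∑ i, c i * θ i e 0 + θ₀
      have p0 : ∀ e, ∀ r ≤ 0, p e r = θ₀ := fun e r hr => by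
        simp [p, min_eq_left (hr.trans zero_le_one), max_eq_left hr]
      have p1 : ∀ e r, 1 ≤ r → p e r = θ₀ := fun e r hr => by
        have : ∑ i, (c i : ℝ) * k i e = 0 := by
          have := congrFun hc e
          simp only [Finset.sum_apply, Pi.smul_apply, smul_eq_mul, Pi.zero_apply] at this
          exact_mod_cast this
        simp only [p, min_eq_right hr, max_eq_right zero_le_one, hk, mul_add,
          Finset.sum_add_distrib]
        simp only [← mul_assoc, ← Finset.sum_mul, this]
        ring
      refine ⟨⟨GraphReal.glue (fun _ => θ₀) p, GraphReal.continuous_glue (fun e => ?_) p0 p1⟩,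
        fun y => ?_⟩
      · simp only [p]
        fun_prop
      · induction y using GraphReal.ind with
        | hv v => exact hθ₀.symm
        | he e r hr =>
          simp only [ContinuousMap.coe_mk]
          rw [GraphReal.glue_edge_of_mem _ _ hr]
          simp only [p, min_eq_left hr.2.le, max_eq_right hr.1.le]
          rw [Circle.exp_add, Circle.exp_sub, circleExp_sum, circleExp_sum, hθ₀]
          simp only [← hθ, GraphReal.edge_of_nonpos le_rfl]
          rw [div_mul_cancel]
    obtain ⟨Θ, hΘ⟩ := hlift
    let F : C(X, Circle) := ∏ i, f i ^ c i
    have hF : ∀ x, F x = ∏ i, f i x ^ c i := fun x => by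
      simp [F, ContinuousMap.prod_apply]
    have hom : (F.comp (h.invFun.comp h.toFun)).Homotopic (F.comp (ContinuousMap.id X)) :=
      ContinuousMap.Homotopic.comp (.refl F) h.left_inv
    obtain ⟨Θ', hΘ'⟩ := exists_lift_of_homotopic hom
      ⟨Θ.comp h.toFun, fun x => (hF _).trans (hΘ _)⟩
    exact hf c ⟨Θ', fun x => by rw [← hF, ← hΘ']; rfl⟩
  simpa using hli.fintype_card_le_finrank

/-! ### Regions swept by horizontal lines -/

/-- A compact planar region, equal to the closure of its interior, whose frontier is a union of
non-horizontal segments (indexed by `ι`) that meet only at endpoints, at most two at a time.  The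
segment `e` is the graph of `x = α e + β e * y` over `lo e ≤ y ≤ hi e`. -/
structure SweepRegion (ι : Type) where
  /-- the region -/
  L : Set (ℝ × ℝ)
  /-- the lower height of a segment -/
  lo : ι → ℝ
  /-- the upper height of a segment -/
  hi : ι → ℝ
  /-- the constant coefficient of a segment -/
  α : ι → ℝ
  /-- the inverse slope of a segment -/
  β : ι → ℝ
  isCompact : IsCompact L
  closure_interior : closure (interior L) = L
  lo_lt_hi : ∀ e, lo e < hi e
  frontier_iff : ∀ p : ℝ × ℝ,
    p ∈ frontier L ↔ ∃ e, lo e ≤ p.2 ∧ p.2 ≤ hi e ∧ p.1 = α e + β e * p.2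
  endpoint : ∀ e f y, e ≠ f → y ∈ Icc (lo e) (hi e) → y ∈ Icc (lo f) (hi f) →
    α e + β e * y = α f + β f * y → y = lo e ∨ y = hi e
  three : ∀ e f g y, e ≠ f → e ≠ g → f ≠ g → y ∈ Icc (lo e) (hi e) → y ∈ Icc (lo f) (hi f) →
    y ∈ Icc (lo g) (hi g) → α e + β e * y = α f + β f * y → α e + β e * y ≠ α g + β g * y

/-- An open horizontal slab between two consecutive heights of endpoints. -/
@[ext] structure Slab {ι : Type} (lo hi : ι → ℝ) where
  /-- the lower height of the slab -/
  bot : ℝ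
  /-- the upper height of the slab -/
  top : ℝ
  bot_mem : bot ∈ range lo ∪ range hi
  top_mem : top ∈ range lo ∪ range hi
  lt : bot < top
  gap : ∀ y ∈ range lo ∪ range hi, ¬ (bot < y ∧ y < top)

/-- A segment together with a slab that it crosses from bottom to top. -/
@[ext] structure Piece {ι : Type} (lo hi : ι → ℝ) where
  /-- the segment -/
  edge : ι
  /-- the slab -/
  slab : Slab lo hi
  lo_le : lo edge ≤ slab.bot
  le_hi : slab.top ≤ hi edge

section Slab

variable {ι : Type} {lo hi : ι → ℝ}

instance [Finite ι] : Finite (Slab lo hi) := by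
  have : Finite ↥(range lo ∪ range hi) := ((finite_range lo).union (finite_range hi)).to_subtype
  refine Finite.of_injective (β := ↥(range lo ∪ range hi) × ↥(range lo ∪ range hi))
    (fun σ => (⟨σ.bot, σ.bot_mem⟩, ⟨σ.top, σ.top_mem⟩)) fun σ τ h => ?_
  simp only [Prod.mk.injEq, Subtype.mk.injEq] at h
  exact Slab.ext h.1 h.2

instance [Finite ι] : Finite (Piece lo hi) := by
  refine Finite.of_injective (β := ι × Slab lo hi) (fun π => (π.edge, π.slab)) fun σ τ h => ?_
  simp only [Prod.mk.injEq] at h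
  exact Piece.ext h.1 h.2

namespace Slab

/-- The height half-way up a slab. -/
noncomputable def mid (σ : Slab lo hi) : ℝ := (σ.bot + σ.top) / 2

lemma mid_mem (σ : Slab lo hi) : σ.mid ∈ Ioo σ.bot σ.top := by
  have := σ.lt
  constructor <;> unfold mid <;> linarith

/-- A segment that enters the open slab crosses it. -/
lemma spans {σ : Slab lo hi} {e : ι} {y : ℝ} (hy : y ∈ Ioo σ.bot σ.top) (h1 : lo e ≤ y)
    (h2 : y ≤ hi e) : lo e ≤ σ.bot ∧ σ.top ≤ hi e := by
  constructor
  · by_contra! h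
    exact σ.gap _ (Or.inl ⟨e, rfl⟩) ⟨h, h1.trans_lt hy.2⟩
  · by_contra! h
    exact σ.gap _ (Or.inr ⟨e, rfl⟩) ⟨hy.1.trans_le h2, h⟩

lemma eq_of_mem {σ τ : Slab lo hi} {y : ℝ} (h1 : y ∈ Ioo σ.bot σ.top) (h2 : y ∈ Ioo τ.bot τ.top) :
    σ = τ := by
  refine Slab.ext (le_antisymm ?_ ?_) (le_antisymm ?_ ?_) <;> by_contra! h
  · exact τ.gap _ σ.bot_mem ⟨h, h1.1.trans h2.2⟩
  · exact σ.gap _ τ.bot_mem ⟨h, h2.1.trans h1.2⟩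
  · exact σ.gap _ τ.top_mem ⟨h1.1.trans h2.2, h⟩
  · exact τ.gap _ σ.top_mem ⟨h2.1.trans h1.2, h⟩

lemma eq_of_bot_eq {σ τ : Slab lo hi} (h : σ.bot = τ.bot) : σ = τ := by
  refine Slab.ext h (le_antisymm ?_ ?_) <;> by_contra! h'
  · exact σ.gap _ τ.top_mem ⟨h ▸ τ.lt, h'⟩
  · exact τ.gap _ σ.top_mem ⟨h ▸ σ.lt, h'⟩

lemma eq_of_top_eq {σ τ : Slab lo hi} (h : σ.top = τ.top) : σ = τ := by
  refine Slab.ext (le_antisymm ?_ ?_) h <;> by_contra! h'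
  · exact τ.gap _ σ.bot_mem ⟨h', h ▸ σ.lt⟩
  · exact σ.gap _ τ.bot_mem ⟨h', h ▸ τ.lt⟩

/-- A height that is not the height of an endpoint but is reached by a segment lies in a slab. -/
lemma exists_mem [Finite ι] {e : ι} {y : ℝ} (h1 : lo e ≤ y) (h2 : y ≤ hi e)
    (hy : y ∉ range lo ∪ range hi) : ∃ σ : Slab lo hi, y ∈ Ioo σ.bot σ.top := by
  have hfin : (range lo ∪ range hi).Finite := (finite_range lo).union (finite_range hi)
  obtain ⟨c, ⟨hc, hcy⟩, hc'⟩ := (hfin.subset (t := {z ∈ range lo ∪ range hi | z < y})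
    fun z hz => hz.1).exists_maximal
    ⟨lo e, Or.inl ⟨e, rfl⟩, h1.lt_of_ne fun h => hy (h ▸ Or.inl ⟨e, rfl⟩)⟩
  obtain ⟨d, ⟨hd, hdy⟩, hd'⟩ := (hfin.subset (t := {z ∈ range lo ∪ range hi | y < z})
    fun z hz => hz.1).exists_minimal
    ⟨hi e, Or.inr ⟨e, rfl⟩, h2.lt_of_ne fun h => hy (h ▸ Or.inr ⟨e, rfl⟩)⟩
  refine ⟨⟨c, d, hc, hd, hcy.trans hdy, fun z hz hz' => ?_⟩, hcy, hdy⟩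
  rcases lt_trichotomy z y with h | h | h
  · exact hz'.1.not_ge (hc' ⟨hz, h⟩ hz'.1.le)
  · exact hy (h ▸ hz)
  · exact hz'.2.not_ge (hd' ⟨hz, h⟩ hz'.2.le)

/-- A height reached by a segment lies in the closure of a slab crossed by this segment. -/
lemma exists_mem_Icc [Finite ι] {e : ι} {y : ℝ} (he : lo e < hi e) (h1 : lo e ≤ y) (h2 : y ≤ hi e) :
    ∃ σ : Slab lo hi, lo e ≤ σ.bot ∧ σ.top ≤ hi e ∧ y ∈ Icc σ.bot σ.top := by
  have hfin : (range lo ∪ range hi).Finite := (finite_range lo).union (finite_range hi)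
  rcases h2.lt_or_eq with h2 | rfl
  · obtain ⟨c, ⟨hc, hcy⟩, hc'⟩ := (hfin.subset (t := {z ∈ range lo ∪ range hi | z ≤ y})
      fun z hz => hz.1).exists_maximal ⟨lo e, Or.inl ⟨e, rfl⟩, h1⟩
    obtain ⟨d, ⟨hd, hdy⟩, hd'⟩ := (hfin.subset (t := {z ∈ range lo ∪ range hi | y < z})
      fun z hz => hz.1).exists_minimal ⟨hi e, Or.inr ⟨e, rfl⟩, h2⟩
    have hg : ∀ z ∈ range lo ∪ range hi, ¬ (c < z ∧ z < d) := fun z hz hz' => by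
      rcases le_or_gt z y with h | h
      · exact hz'.1.not_ge (hc' ⟨hz, h⟩ hz'.1.le)
      · exact hz'.2.not_ge (hd' ⟨hz, h⟩ hz'.2.le)
    refine ⟨⟨c, d, hc, hd, hcy.trans_lt hdy, hg⟩, ?_, ?_, hcy, hdy.le⟩
    · by_contra! h
      exact hg _ (Or.inl ⟨e, rfl⟩) ⟨h, h1.trans_lt hdy⟩
    · by_contra! h
      exact hg _ (Or.inr ⟨e, rfl⟩) ⟨hcy.trans_lt h2, h⟩
  · obtain ⟨c, ⟨hc, hcy⟩, hc'⟩ := (hfin.subset (t := {z ∈ range lo ∪ range hi | z < hi e})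
      fun z hz => hz.1).exists_maximal ⟨lo e, Or.inl ⟨e, rfl⟩, he⟩
    exact ⟨⟨c, hi e, hc, Or.inr ⟨e, rfl⟩, hcy, fun z hz hz' =>
      hz'.1.not_ge (hc' ⟨hz, hz'.2⟩ hz'.1.le)⟩, hc' ⟨Or.inl ⟨e, rfl⟩, he⟩ |> fun h => by
        by_contra! h'
        exact h'.not_ge (h h'.le), le_rfl, hcy.le, le_rfl⟩

end Slab

end Slab

/-- A preconnected set that avoids the frontier of `L` lies in the interior of `L` or avoids `L`. -/
lemma IsPreconnected.subset_interior_or_disjoint {X : Type*} [TopologicalSpace X] {C L : Set X}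
    (hC : IsPreconnected C) (h : Disjoint C (frontier L)) : C ⊆ interior L ∨ Disjoint C L := by
  have hu : C ⊆ interior L ∪ (closure L)ᶜ := fun x hx => by
    by_cases h1 : x ∈ interior L
    · exact Or.inl h1
    · exact Or.inr fun h2 => h.le_bot ⟨hx, h2, h1⟩
  by_cases hne : (C ∩ interior L).Nonempty
  · exact Or.inl (hC.subset_left_of_subset_union isOpen_interior isClosed_closure.isOpen_compl
      (disjoint_compl_right.mono_left (interior_subset.trans subset_closure)) hu hne)
  · refine Or.inr (disjoint_left.2 fun x hx hxL => ?_)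
    rcases hu hx with h1 | h1
    · exact hne ⟨x, hx, h1⟩
    · exact h1 (subset_closure hxL)

namespace SweepRegion

variable {ι : Type} (S : SweepRegion ι)

/-- The abscissa of the segment `e` at height `y`. -/
def X (e : ι) (y : ℝ) : ℝ := S.α e + S.β e * y

lemma continuous_X (e : ι) : Continuous (S.X e) := by unfold X; fun_prop

lemma isClosed : IsClosed S.L := S.isCompact.isClosed

/-- The heights of the endpoints of the segments. -/
abbrev levels : Set ℝ := range S.lo ∪ range S.hi

variable {S}

lemma mem_frontier {e : ι} {y : ℝ} (hy : y ∈ Icc (S.lo e) (S.hi e)) :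
    (S.X e y, y) ∈ frontier S.L := (S.frontier_iff _).2 ⟨e, hy.1, hy.2, rfl⟩

lemma mem_L {e : ι} {y : ℝ} (hy : y ∈ Icc (S.lo e) (S.hi e)) : (S.X e y, y) ∈ S.L :=
  S.isClosed.frontier_subset (mem_frontier hy)

/-- Two segments crossing a slab are disjoint in the open slab, so their order is constant. -/
lemma X_lt_X_of_lt {σ : Slab S.lo S.hi} {e f : ι} (he : S.lo e ≤ σ.bot ∧ σ.top ≤ S.hi e)
    (hf : S.lo f ≤ σ.bot ∧ σ.top ≤ S.hi f) {y y' : ℝ} (hy : y ∈ Ioo σ.bot σ.top)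
    (hy' : y' ∈ Ioo σ.bot σ.top) (h : S.X e y < S.X f y) : S.X e y' < S.X f y' := by
  by_contra! h'
  obtain ⟨z, hz, hz0⟩ := (isPreconnected_Ioo (a := σ.bot) (b := σ.top)).intermediate_value₂ hy hy'
    (S.continuous_X e).continuousOn (S.continuous_X f).continuousOn h.le h'
  have hne : e ≠ f := by rintro rfl; exact h.ne rfl
  rcases S.endpoint e f z hne ⟨he.1.trans hz.1.le, hz.2.le.trans he.2⟩
    ⟨hf.1.trans hz.1.le, hz.2.le.trans hf.2⟩ hz0 with h | h
  · linarith [hz.1, he.1]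
  · linarith [hz.2, he.2]

lemma X_le_X_of_lt {σ : Slab S.lo S.hi} {e f : ι} (he : S.lo e ≤ σ.bot ∧ σ.top ≤ S.hi e)
    (hf : S.lo f ≤ σ.bot ∧ σ.top ≤ S.hi f) {y y' : ℝ} (hy : y ∈ Ioo σ.bot σ.top)
    (hy' : y' ∈ Icc σ.bot σ.top) (h : S.X e y < S.X f y) : S.X e y' ≤ S.X f y' := by
  have hc : IsClosed {z | S.X e z ≤ S.X f z} :=
    isClosed_le (S.continuous_X e) (S.continuous_X f)
  have hs : Ioo σ.bot σ.top ⊆ {z | S.X e z ≤ S.X f z} :=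
    fun z hz => (X_lt_X_of_lt he hf hy hz h).le
  have := hc.closure_subset_iff.2 hs
  rw [closure_Ioo σ.lt.ne] at this
  exact this hy'

lemma eq_of_X_eq {σ : Slab S.lo S.hi} {e f : ι} (he : S.lo e ≤ σ.bot ∧ σ.top ≤ S.hi e)
    (hf : S.lo f ≤ σ.bot ∧ σ.top ≤ S.hi f) {y : ℝ} (hy : y ∈ Ioo σ.bot σ.top)
    (h : S.X e y = S.X f y) : e = f := by
  by_contra hne
  rcases S.endpoint e f y hne ⟨he.1.trans hy.1.le, hy.2.le.trans he.2⟩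
    ⟨hf.1.trans hy.1.le, hy.2.le.trans hf.2⟩ h with h | h
  · linarith [hy.1, he.1]
  · linarith [hy.2, he.2]

lemma _root_.Piece.spans {lo hi : ι → ℝ} (π : Piece lo hi) :
    lo π.edge ≤ π.slab.bot ∧ π.slab.top ≤ hi π.edge := ⟨π.lo_le, π.le_hi⟩

lemma _root_.Piece.mem_Icc {lo hi : ι → ℝ} (π : Piece lo hi) {y : ℝ}
    (hy : y ∈ Icc π.slab.bot π.slab.top) : y ∈ Icc (lo π.edge) (hi π.edge) :=
  ⟨π.lo_le.trans hy.1, hy.2.trans π.le_hi⟩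

variable (S)

/-- The open trapezoid of the slab of `π` between the segment of `π` and the segment preceding it
on the left. -/
def cell (π : Piece S.lo S.hi) : Set (ℝ × ℝ) :=
  {p | p.2 ∈ Ioo π.slab.bot π.slab.top ∧ p.1 < S.X π.edge p.2 ∧
    ∀ f, S.lo f ≤ π.slab.bot ∧ π.slab.top ≤ S.hi f →
      S.X f π.slab.mid < S.X π.edge π.slab.mid → S.X f p.2 < p.1}

lemma convex_cell (π : Piece S.lo S.hi) : Convex ℝ (S.cell π) := by
  have h1 : ∀ e, Convex ℝ {p : ℝ × ℝ | p.1 < S.X e p.2} := fun e => by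
    have : IsLinearMap ℝ fun p : ℝ × ℝ => p.1 - S.β e * p.2 :=
      ⟨fun p q => by simp only [Prod.fst_add, Prod.snd_add]; ring,
        fun c p => by simp only [Prod.smul_fst, Prod.smul_snd, smul_eq_mul]; ring⟩
    convert! convex_halfSpace_lt this (S.α e) using 3 with p
    unfold X
    constructor <;> intro h <;> linarith
  have h2 : ∀ e, Convex ℝ {p : ℝ × ℝ | S.X e p.2 < p.1} := fun e => by
    have : IsLinearMap ℝ fun p : ℝ × ℝ => p.1 - S.β e * p.2 :=
      ⟨fun p q => by simp only [Prod.fst_add, Prod.snd_add]; ring,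
        fun c p => by simp only [Prod.smul_fst, Prod.smul_snd, smul_eq_mul]; ring⟩
    convert! convex_halfSpace_gt this (S.α e) using 3 with p
    unfold X
    constructor <;> intro h <;> linarith
  have h3 : Convex ℝ {p : ℝ × ℝ | p.2 ∈ Ioo π.slab.bot π.slab.top} :=
    (convex_Ioo (𝕜 := ℝ) π.slab.bot π.slab.top).linear_preimage (LinearMap.snd ℝ ℝ ℝ)
  have : S.cell π = {p : ℝ × ℝ | p.2 ∈ Ioo π.slab.bot π.slab.top} ∩
      ({p | p.1 < S.X π.edge p.2} ∩ ⋂ f, ⋂ (_ : S.lo f ≤ π.slab.bot ∧ π.slab.top ≤ S.hi f),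
        ⋂ (_ : S.X f π.slab.mid < S.X π.edge π.slab.mid), {p | S.X f p.2 < p.1}) := by
    ext p
    simp [cell]
  rw [this]
  exact h3.inter ((h1 _).inter (convex_iInter fun f => convex_iInter fun _ =>
    convex_iInter fun _ => h2 f))

lemma disjoint_cell_frontier (π : Piece S.lo S.hi) : Disjoint (S.cell π) (frontier S.L) := by
  refine disjoint_left.2 fun p hp hf => ?_
  obtain ⟨f, h1, h2, h3⟩ := (S.frontier_iff p).1 hf
  have hs := Slab.spans hp.1 h1 h2
  change p.1 = S.X f p.2 at h3
  rcases lt_or_ge (S.X f π.slab.mid) (S.X π.edge π.slab.mid) with h | h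
  · exact (hp.2.2 f hs h).ne' h3
  · rcases h.lt_or_eq with h | h
    · have := X_lt_X_of_lt π.spans hs π.slab.mid_mem hp.1 h
      linarith [hp.2.1]
    · have := eq_of_X_eq π.spans hs π.slab.mid_mem h
      subst this
      exact hp.2.1.ne h3

/-- A piece is a left piece if the region is not on its left. -/
def Left (π : Piece S.lo S.hi) : Prop := Disjoint (S.cell π) S.L

variable {S}

lemma cell_subset {π : Piece S.lo S.hi} (h : ¬ S.Left π) : S.cell π ⊆ interior S.L :=
  ((S.convex_cell π).isPreconnected.subset_interior_or_disjoint
    (S.disjoint_cell_frontier π)).resolve_right h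

variable (S)

lemma finite_frontier_level [Finite ι] (y : ℝ) : {x | (x, y) ∈ frontier S.L}.Finite := by
  refine (finite_range fun e => S.X e y).subset fun x hx => ?_
  obtain ⟨e, -, -, h⟩ := (S.frontier_iff _).1 hx
  exact ⟨e, h.symm⟩

lemma eventually_notMem_frontier [Finite ι] (x₀ y : ℝ) :
    ∀ᶠ x in 𝓝[<] x₀, (x, y) ∉ frontier S.L := by
  have hfin := (S.finite_frontier_level y).subset (sdiff_subset (t := {x₀}))
  have h1 : ∀ᶠ x in 𝓝[<] x₀, x ∉ {x | (x, y) ∈ frontier S.L} \ {x₀} :=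
    mem_nhdsWithin_of_mem_nhds (hfin.isClosed.isOpen_compl.mem_nhds fun h => h.2 rfl)
  filter_upwards [h1, self_mem_nhdsWithin] with x hx hlt h
  exact hx ⟨h, hlt.ne⟩

variable {S}

/-- Just to the left of a segment, at any height of the closed slab, the region looks as in the
cell, provided no other segment interferes at this height. -/
lemma eventually_mem_iff [Finite ι] (π : Piece S.lo S.hi) {y₀ : ℝ}
    (hy₀ : y₀ ∈ Icc π.slab.bot π.slab.top)
    (h : ∀ f, S.lo f ≤ π.slab.bot ∧ π.slab.top ≤ S.hi f →
      S.X f π.slab.mid < S.X π.edge π.slab.mid → S.X f y₀ ≠ S.X π.edge y₀) :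
    ∀ᶠ x in 𝓝[<] S.X π.edge y₀, (x, y₀) ∈ S.L ↔ ¬ S.Left π := by
  have h1 : ∀ᶠ x in 𝓝[<] S.X π.edge y₀, ∀ f, S.lo f ≤ π.slab.bot ∧ π.slab.top ≤ S.hi f →
      S.X f π.slab.mid < S.X π.edge π.slab.mid → S.X f y₀ < x := by
    simp only [eventually_all]
    intro f hf hlt
    have := (X_le_X_of_lt hf π.spans π.slab.mid_mem hy₀ hlt).lt_of_ne (h f hf hlt)
    exact mem_nhdsWithin_of_mem_nhds (Ioi_mem_nhds this)
  filter_upwards [h1, S.eventually_notMem_frontier _ y₀, self_mem_nhdsWithin] with x hx hfr hlt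
  have hne : (𝓝[Ioo π.slab.bot π.slab.top] y₀).NeBot := by
    rw [← mem_closure_iff_nhdsWithin_neBot, closure_Ioo π.slab.lt.ne]
    exact hy₀
  -- `(x, y₀)` is a limit of points of the cell and does not lie on the frontier
  have hcell : ∀ᶠ y in 𝓝[Ioo π.slab.bot π.slab.top] y₀, (x, y) ∈ S.cell π := by
    have h2 : ∀ᶠ y in 𝓝[Ioo π.slab.bot π.slab.top] y₀, x < S.X π.edge y :=
      mem_nhdsWithin_of_mem_nhds
        ((isOpen_lt continuous_const (S.continuous_X _)).mem_nhds hlt)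
    have h3 : ∀ᶠ y in 𝓝[Ioo π.slab.bot π.slab.top] y₀, ∀ f,
        S.lo f ≤ π.slab.bot ∧ π.slab.top ≤ S.hi f →
        S.X f π.slab.mid < S.X π.edge π.slab.mid → S.X f y < x := by
      simp only [eventually_all]
      intro f hf hlt
      exact mem_nhdsWithin_of_mem_nhds
        ((isOpen_lt (S.continuous_X _) continuous_const).mem_nhds (hx f hf hlt))
    filter_upwards [h2, h3, self_mem_nhdsWithin] with y h2 h3 h4
    exact ⟨h4, h2, h3⟩
  have hcont : Continuous fun y : ℝ => (x, y) := by fun_prop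
  constructor
  · intro hL hleft
    have hint : (x, y₀) ∈ interior S.L := by
      by_contra hni
      exact hfr ⟨subset_closure hL, hni⟩
    have h5 : ∀ᶠ y in 𝓝[Ioo π.slab.bot π.slab.top] y₀, (x, y) ∈ interior S.L :=
      mem_nhdsWithin_of_mem_nhds ((isOpen_interior.preimage hcont).mem_nhds hint)
    obtain ⟨y, h6, h7⟩ := (hcell.and h5).exists
    exact disjoint_left.1 hleft h6 (interior_subset h7)
  · intro hleft
    by_contra hL
    have h5 : ∀ᶠ y in 𝓝[Ioo π.slab.bot π.slab.top] y₀, (x, y) ∈ S.Lᶜ :=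
      mem_nhdsWithin_of_mem_nhds ((S.isClosed.isOpen_compl.preimage hcont).mem_nhds hL)
    obtain ⟨y, h6, h7⟩ := (hcell.and h5).exists
    exact h7 (interior_subset (cell_subset hleft h6))

/-! ### Reflection, and the right-hand sides -/

variable (S)

/-- Reflection in the vertical axis. -/
def flip : ℝ × ℝ ≃ₜ ℝ × ℝ := (Homeomorph.neg ℝ).prodCongr (Homeomorph.refl ℝ)

/-- The mirror image of a region in the vertical axis. -/
abbrev mirror : SweepRegion ι where
  L := flip ⁻¹' S.L
  lo := S.lo
  hi := S.hi
  α := fun e => -S.α e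
  β := fun e => -S.β e
  isCompact := flip.isCompact_preimage.2 S.isCompact
  closure_interior := by
    rw [← flip.preimage_interior, ← flip.preimage_closure, S.closure_interior]
  lo_lt_hi := S.lo_lt_hi
  frontier_iff p := by
    rw [← flip.preimage_frontier, mem_preimage, S.frontier_iff]
    refine exists_congr fun e => and_congr Iff.rfl (and_congr Iff.rfl ?_)
    change -p.1 = _ + _ * p.2 ↔ _
    constructor <;> intro h <;> linarith
  endpoint e f y hne h1 h2 h := S.endpoint e f y hne h1 h2 (by linarith)
  three e f g y h1 h2 h3 h4 h5 h6 h7 h8 := S.three e f g y h1 h2 h3 h4 h5 h6 (by linarith)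
    (by linarith)

lemma mirror_X (e : ι) (y : ℝ) : S.mirror.X e y = -S.X e y := by
  simp only [X]; ring

lemma mem_mirror (x y : ℝ) : (x, y) ∈ S.mirror.L ↔ (-x, y) ∈ S.L := Iff.rfl

variable {S}

/-- The region lies on exactly one side of each piece. -/
lemma mirror_left_iff [Finite ι] (π : Piece S.lo S.hi) : S.mirror.Left π ↔ ¬ S.Left π := by
  set m := π.slab.mid with hm
  have hmI : m ∈ Ioo π.slab.bot π.slab.top := π.slab.mid_mem
  have hN : ∀ᶠ q in 𝓝 (S.X π.edge m, m), q ∈ S.cell π ∨ q.1 = S.X π.edge q.2 ∨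
      (-q.1, q.2) ∈ S.mirror.cell π := by
    have c : ∀ f, Continuous fun q : ℝ × ℝ => S.X f q.2 := fun f =>
      (S.continuous_X f).comp continuous_snd
    have h1 : ∀ᶠ q : ℝ × ℝ in 𝓝 (S.X π.edge m, m), q.2 ∈ Ioo π.slab.bot π.slab.top :=
      (isOpen_Ioo.preimage continuous_snd).mem_nhds hmI
    have h2 : ∀ᶠ q : ℝ × ℝ in 𝓝 (S.X π.edge m, m), ∀ f, S.X f m < S.X π.edge m →
        S.X f q.2 < q.1 := by
      simp only [eventually_all]
      exact fun f hf => (isOpen_lt (c f) continuous_fst).mem_nhds hf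
    have h3 : ∀ᶠ q : ℝ × ℝ in 𝓝 (S.X π.edge m, m), ∀ f, S.X π.edge m < S.X f m →
        q.1 < S.X f q.2 := by
      simp only [eventually_all]
      exact fun f hf => (isOpen_lt continuous_fst (c f)).mem_nhds hf
    filter_upwards [h1, h2, h3] with q h1 h2 h3
    rcases lt_trichotomy q.1 (S.X π.edge q.2) with h | h | h
    · exact Or.inl ⟨h1, h, fun f _ hf => h2 f hf⟩
    · exact Or.inr (Or.inl h)
    · refine Or.inr (Or.inr ⟨h1, ?_, fun f _ hf => ?_⟩)
      · rw [mirror_X]; simpa using h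
      · rw [mirror_X, mirror_X, neg_lt_neg_iff] at hf
        rw [mirror_X]
        exact neg_lt_neg (h3 f hf)
  have hmem := mem_frontier (S := S) (π.mem_Icc (Ioo_subset_Icc_self hmI))
  constructor
  · -- if the region were on neither side, it would be thin near the segment
    intro hr hl
    have hcl : (S.X π.edge m, m) ∈ closure (interior S.L) := by
      rw [S.closure_interior]; exact S.isClosed.frontier_subset hmem
    obtain ⟨q, hq, hqint⟩ := ((mem_closure_iff_frequently.1 hcl).and_eventually
      (eventually_eventually_nhds.2 hN)).exists
    have hq' : ∀ᶠ z in 𝓝 q, z ∈ interior S.L ∧ z.1 = S.X π.edge z.2 := by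
      filter_upwards [isOpen_interior.mem_nhds hq, hqint] with z hz hz'
      refine ⟨hz, ?_⟩
      rcases hz' with h | h | h
      · exact absurd (interior_subset hz) (disjoint_left.1 hl h)
      · exact h
      · refine absurd ?_ (disjoint_left.1 hr h)
        rw [mem_mirror, neg_neg]
        exact interior_subset hz
    have hc : Tendsto (fun x : ℝ => (x, q.2)) (𝓝[≠] q.1) (𝓝 q) :=
      ((Continuous.prodMk_left q.2).tendsto q.1).mono_left nhdsWithin_le_nhds
    obtain ⟨x, hx, hxq⟩ := ((hc.eventually hq').and self_mem_nhdsWithin).exists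
    exact hxq (hx.2.trans hq'.self_of_nhds.2.symm)
  · -- if the region were on both sides, the segment would lie in its interior
    intro hl
    by_contra hr
    refine hmem.2 (mem_interior_iff_mem_nhds.2 ?_)
    have hfr : ∀ᶠ q in 𝓝 (S.X π.edge m, m), q.2 ∈ Ioo π.slab.bot π.slab.top :=
      (isOpen_Ioo.preimage continuous_snd).mem_nhds hmI
    filter_upwards [hN, hfr] with q hq hq2
    rcases hq with h | h | h
    · exact interior_subset (cell_subset hl h)
    · have := mem_L (S := S) (π.mem_Icc (Ioo_subset_Icc_self hq2))
      rwa [← h] at this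
    · have := interior_subset (cell_subset (S := S.mirror) hr h)
      rwa [mem_mirror, neg_neg] at this

/-- The right-hand version of `eventually_mem_iff`. -/
lemma eventually_mem_iff_right [Finite ι] (π : Piece S.lo S.hi) {y₀ : ℝ}
    (hy₀ : y₀ ∈ Icc π.slab.bot π.slab.top)
    (h : ∀ f, S.lo f ≤ π.slab.bot ∧ π.slab.top ≤ S.hi f →
      S.X π.edge π.slab.mid < S.X f π.slab.mid → S.X f y₀ ≠ S.X π.edge y₀) :
    ∀ᶠ x in 𝓝[>] S.X π.edge y₀, (x, y₀) ∈ S.L ↔ S.Left π := by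
  have := eventually_mem_iff (S := S.mirror) π hy₀ (fun f hf hlt => by
    rw [mirror_X, mirror_X, neg_lt_neg_iff] at hlt
    rw [mirror_X, mirror_X, Ne, neg_inj]
    exact h f hf hlt)
  rw [mirror_X] at this
  filter_upwards [tendsto_neg_nhdsGT.eventually this] with x hx
  rwa [mem_mirror, neg_neg, mirror_left_iff, not_not] at hx

end SweepRegion

namespace SweepRegion

variable {ι : Type} (S : SweepRegion ι)

/-! ### Fibers of the height function -/

/-- Two points lie on the same fiber if the horizontal segment between them lies in the region. -/
def Rel (p q : ℝ × ℝ) : Prop := p.2 = q.2 ∧ ∀ x ∈ uIcc p.1 q.1, (x, p.2) ∈ S.L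

variable {S}

lemma Rel.symm {p q : ℝ × ℝ} (h : S.Rel p q) : S.Rel q p :=
  ⟨h.1.symm, fun x hx => by rw [← h.1]; exact h.2 x (uIcc_comm q.1 p.1 ▸ hx)⟩

lemma Rel.trans {p q r : ℝ × ℝ} (h : S.Rel p q) (h' : S.Rel q r) : S.Rel p r := by
  refine ⟨h.1.trans h'.1, fun x hx => ?_⟩
  rcases uIcc_subset_uIcc_union_uIcc hx with hx | hx
  · exact h.2 x hx
  · rw [h.1]; exact h'.2 x hx

lemma Rel.refl {p : ℝ × ℝ} (h : p ∈ S.L) : S.Rel p p :=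
  ⟨rfl, fun x hx => by
    have : x = p.1 := by simpa using hx
    rw [this]; exact h⟩

variable (S)

/-- The equivalence relation whose quotient is the Reeb graph. -/
def reeb : Setoid S.L where
  r x y := S.Rel x y
  iseqv := ⟨fun x => Rel.refl x.2, Rel.symm, Rel.trans⟩

variable {S}

/-- Every point can be moved to the left within its fiber until it hits the frontier, beyond which
there are points outside the region. -/
lemma exists_left_end {p : ℝ × ℝ} (hp : p ∈ S.L) : ∃ e, p.2 ∈ Icc (S.lo e) (S.hi e) ∧
    S.Rel (S.X e p.2, p.2) p ∧ S.X e p.2 ≤ p.1 ∧ ∃ᶠ x in 𝓝[<] S.X e p.2, (x, p.2) ∉ S.L := by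
  obtain ⟨m, hm⟩ := (S.isCompact.image continuous_fst).bddBelow
  set B := {x | x ≤ p.1 ∧ (x, p.2) ∉ S.L} with hB
  have hne : B.Nonempty := ⟨min p.1 (m - 1), min_le_left _ _, fun h => by
    have := hm ⟨_, h, rfl⟩
    have h2 : min p.1 (m - 1) ≤ m - 1 := min_le_right _ _
    simp only at this
    linarith⟩
  have hbdd : BddAbove B := ⟨p.1, fun x hx => hx.1⟩
  have hlub := isLUB_csSup hne hbdd
  set l := sSup B
  have hlp : l ≤ p.1 := hlub.2 fun x hx => hx.1
  have hin : ∀ x, l < x → x ≤ p.1 → (x, p.2) ∈ S.L := fun x h1 h2 => by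
    by_contra h
    exact h1.not_ge (hlub.1 ⟨h2, h⟩)
  have hl : (l, p.2) ∈ S.L := by
    rcases hlp.eq_or_lt with h | h
    · rw [h]; exact hp
    · have hcl : IsClosed {x : ℝ | (x, p.2) ∈ S.L} := S.isClosed.preimage (by fun_prop)
      have : l ∈ closure (Ioo l p.1) := by
        rw [closure_Ioo h.ne]; exact ⟨le_rfl, hlp⟩
      exact closure_minimal (fun x hx => hin x hx.1 hx.2.le) hcl this
  have hfreq : ∃ᶠ x in 𝓝[<] l, (x, p.2) ∉ S.L := by
    have h1 := hlub.frequently_mem hne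
    rw [frequently_nhdsWithin_iff] at h1 ⊢
    refine h1.mono fun x hx => ⟨hx.1.2, mem_Iio.2 (lt_of_le_of_ne hx.2 fun h => hx.1.2 ?_)⟩
    rw [h]; exact hl
  have hfr : (l, p.2) ∈ frontier S.L := by
    refine ⟨subset_closure hl, fun hint => ?_⟩
    have hc : Continuous fun x : ℝ => (x, p.2) := by fun_prop
    have : ∀ᶠ x in 𝓝[<] l, (x, p.2) ∈ interior S.L :=
      mem_nhdsWithin_of_mem_nhds ((isOpen_interior.preimage hc).mem_nhds hint)
    obtain ⟨x, h1, h2⟩ := (hfreq.and_eventually this).exists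
    exact h1 (interior_subset h2)
  obtain ⟨e, h1, h2, h3⟩ := (S.frontier_iff _).1 hfr
  change l = S.X e p.2 at h3
  simp only at h1 h2
  rw [h3] at hlp hfreq hin hl
  refine ⟨e, ⟨h1, h2⟩, ⟨rfl, fun x hx => ?_⟩, hlp, hfreq⟩
  rw [uIcc_of_le hlp] at hx
  rcases hx.1.eq_or_lt with h | h
  · rw [← h]; exact hl
  · exact hin x h hx.2

variable (S)

/-- The fibers through the heights of endpoints: the vertices of the graph. -/
def LevelFiber : Type := {q : Quotient S.reeb // ∃ x : S.L, Quotient.mk _ x = q ∧ x.1.2 ∈ S.levels}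

/-- The left pieces: the edges of the graph. -/
def LeftPiece : Type := {π : Piece S.lo S.hi // S.Left π}

instance [Finite ι] : Finite S.LeftPiece := Subtype.finite

instance [Finite ι] : Finite S.LevelFiber := by
  have : Finite S.levels := ((finite_range S.lo).union (finite_range S.hi)).to_subtype
  have hq : ∀ v : S.LevelFiber, ∃ a : ι × S.levels, ∃ h : (S.X a.1 a.2, (a.2 : ℝ)) ∈ S.L,
      Quotient.mk S.reeb ⟨_, h⟩ = v.1 := by
    rintro ⟨-, x, rfl, hx⟩
    obtain ⟨e, h1, h2, -⟩ := exists_left_end x.2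
    exact ⟨(e, ⟨_, hx⟩), mem_L h1, Quotient.sound h2⟩
  choose a ha ha' using hq
  refine Finite.of_injective a fun v w h => Subtype.ext ?_
  rw [← ha' v, ← ha' w]
  congr 2
  rw [h]

noncomputable instance [Finite ι] : Fintype S.LeftPiece := Fintype.ofFinite _

noncomputable instance [Finite ι] : Fintype S.LevelFiber := Fintype.ofFinite _

variable {S}

/-- The point of a piece at a given height. -/
def pt (π : Piece S.lo S.hi) {y : ℝ} (hy : y ∈ Icc π.slab.bot π.slab.top) : S.L :=
  ⟨(S.X π.edge y, y), mem_L (π.mem_Icc hy)⟩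

/-- The fiber at the lower end of a left piece. -/
def botFiber (g : S.LeftPiece) : S.LevelFiber :=
  ⟨Quotient.mk _ (pt g.1 (left_mem_Icc.2 g.1.slab.lt.le)), _, rfl, g.1.slab.bot_mem⟩

/-- The fiber at the upper end of a left piece. -/
def topFiber (g : S.LeftPiece) : S.LevelFiber :=
  ⟨Quotient.mk _ (pt g.1 (right_mem_Icc.2 g.1.slab.lt.le)), _, rfl, g.1.slab.top_mem⟩

/-! ### Winding numbers of flows -/

open Classical in
/-- The winding number of a flow `z` around the points of a piece: the total flow that passes on
the left of the piece. -/
noncomputable def winding [Finite ι] (z : S.LeftPiece → ℚ) (π : Piece S.lo S.hi) : ℚ :=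
  ∑ g : S.LeftPiece,
    if g.1.slab = π.slab ∧ S.X g.1.edge π.slab.mid < S.X π.edge π.slab.mid then z g else 0

open Classical in
/-- A function on the left pieces is a flow if at each vertex the inflow equals the outflow. -/
def IsFlow [Finite ι] (z : S.LeftPiece → ℚ) : Prop :=
  ∀ v : S.LevelFiber, (∑ g, if botFiber g = v then z g else 0) =
    ∑ g, if topFiber g = v then z g else 0

/-- If `π` is the only piece of its slab through its point at height `y₀`, then a left piece lies
on the left of `π` if and only if its fiber at height `y₀` has points on the left of `π`. -/
lemma X_lt_iff_exists_rel [Finite ι] {π g : Piece S.lo S.hi} (hg : S.Left g)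
    (hs : g.slab = π.slab) {y₀ : ℝ} (hy₀ : y₀ ∈ Icc π.slab.bot π.slab.top)
    (hu : ∀ f, S.lo f ≤ π.slab.bot ∧ π.slab.top ≤ S.hi f → f ≠ π.edge →
      S.X f y₀ ≠ S.X π.edge y₀) :
    S.X g.edge π.slab.mid < S.X π.edge π.slab.mid ↔
      ∃ x < S.X π.edge y₀, S.Rel (S.X g.edge y₀, y₀) (x, y₀) := by
  have hgs : S.lo g.edge ≤ π.slab.bot ∧ π.slab.top ≤ S.hi g.edge := hs ▸ g.spans
  have hgL : (S.X g.edge y₀, y₀) ∈ S.L := mem_L ⟨hgs.1.trans hy₀.1, hy₀.2.trans hgs.2⟩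
  constructor
  · intro h
    refine ⟨S.X g.edge y₀, ?_, Rel.refl hgL⟩
    refine (X_le_X_of_lt hgs π.spans π.slab.mid_mem hy₀ h).lt_of_ne (hu _ hgs ?_)
    intro he
    rw [he] at h
    exact h.ne rfl
  · rintro ⟨x, hx, -, hrel⟩
    by_contra! hle
    have hle' : S.X π.edge y₀ ≤ S.X g.edge y₀ := by
      rcases hle.lt_or_eq with h | h
      · exact X_le_X_of_lt π.spans hgs π.slab.mid_mem hy₀ h
      · rw [eq_of_X_eq π.spans hgs π.slab.mid_mem h]
    rw [uIcc_of_ge (hx.le.trans hle')] at hrel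
    have hleft : ¬ S.Left π := by
      have h1 := eventually_mem_iff π hy₀ fun f hf hlt => hu f hf (by rintro rfl; exact hlt.ne rfl)
      obtain ⟨x', h2, h3⟩ := (h1.and (Ioo_mem_nhdsLT hx)).exists
      exact h2.1 (hrel x' ⟨h3.1.le, h3.2.le.trans hle'⟩)
    by_cases he : g.edge = π.edge
    · exact hleft (Piece.ext he hs ▸ hg)
    · have hlt : S.X π.edge y₀ < S.X g.edge y₀ := hle'.lt_of_ne (hu _ hgs he).symm
      have h1 := eventually_mem_iff_right π hy₀
        fun f hf hlt => hu f hf (by rintro rfl; exact hlt.ne rfl)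
      obtain ⟨x', h2, h3⟩ := (h1.and (Ioo_mem_nhdsGT hlt)).exists
      exact hleft (h2.1 (hrel x' ⟨hx.le.trans h3.1.le, h3.2.le⟩))

/-- At most one segment, apart from `e` and `e'`, passes through their common point. -/
lemma X_ne_of_through {e e' f : ι} {c : ℝ} (he : c ∈ Icc (S.lo e) (S.hi e))
    (he' : c ∈ Icc (S.lo e') (S.hi e')) (hf : c ∈ Icc (S.lo f) (S.hi f)) (hX : S.X e c = S.X e' c)
    (hne : f ≠ e) (h1 : e' = e → c ∈ Ioo (S.lo e) (S.hi e))
    (h2 : e' = f → c ∈ Ioo (S.lo f) (S.hi f)) : S.X f c ≠ S.X e c := by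
  intro h
  by_cases hee : e' = e
  · rcases S.endpoint e f c hne.symm he hf h.symm with h3 | h3
    · exact (h1 hee).1.ne' h3
    · exact (h1 hee).2.ne h3
  by_cases hef : e' = f
  · rcases S.endpoint f e c hne hf he h with h3 | h3
    · exact (h2 hef).1.ne' h3
    · exact (h2 hef).2.ne h3
  · exact S.three f e e' c hne (Ne.symm hef) (Ne.symm hee) hf he he' h (h.trans hX)

/-- Winding numbers do not change when the frontier crosses the height of an endpoint. -/
lemma winding_eq_of_adjacent [Finite ι] {z : S.LeftPiece → ℚ} (hz : IsFlow z)
    {π π' : Piece S.lo S.hi} (hc : π.slab.bot = π'.slab.top)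
    (hX : S.X π.edge π.slab.bot = S.X π'.edge π.slab.bot) : winding z π = winding z π' := by
  classical
  set c := π.slab.bot with hcdef
  have hcπ : c ∈ Icc π.slab.bot π.slab.top := left_mem_Icc.2 π.slab.lt.le
  have hcπ' : c ∈ Icc π'.slab.bot π'.slab.top := by
    rw [hc]; exact right_mem_Icc.2 π'.slab.lt.le
  have l1 : c < π.slab.top := π.slab.lt
  have l2 : π'.slab.bot < c := by rw [hc]; exact π'.slab.lt
  -- Both winding numbers are the total flow through the vertices on the left of the common point:
  -- above it as outflow of these vertices, below it as inflow.
  let T : S.LevelFiber → Prop := fun v =>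
    ∃ x : S.L, Quotient.mk _ x = v.1 ∧ x.1.2 = c ∧ x.1.1 < S.X π.edge c
  have hT : ∀ (g : S.LeftPiece) (y : ℝ) (hy : y ∈ Icc g.1.slab.bot g.1.slab.top),
      (∃ x : S.L, Quotient.mk _ x = Quotient.mk S.reeb (pt g.1 hy) ∧ x.1.2 = c ∧
        x.1.1 < S.X π.edge c) ↔ y = c ∧ ∃ x < S.X π.edge c, S.Rel (S.X g.1.edge c, c) (x, c) := by
    intro g y hy
    constructor
    · rintro ⟨x, h1, h2, h3⟩
      have h4 : S.Rel x.1 (S.X g.1.edge y, y) := Quotient.exact h1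
      have h5 : y = c := h4.1.symm.trans h2
      subst h5
      refine ⟨rfl, x.1.1, h3, ?_⟩
      have : x.1 = (x.1.1, c) := Prod.ext rfl h2
      rw [← this]
      exact h4.symm
    · rintro ⟨rfl, x, h3, h4⟩
      exact ⟨⟨(x, c), by have := h4.symm.2 x left_mem_uIcc; exact this⟩,
        Quotient.sound h4.symm, rfl, h3⟩
  have hbot : ∀ g : S.LeftPiece, (g.1.slab = π.slab ∧
      S.X g.1.edge π.slab.mid < S.X π.edge π.slab.mid) ↔ T (botFiber g) := by
    intro g
    have hu : ∀ f, S.lo f ≤ π.slab.bot ∧ π.slab.top ≤ S.hi f → f ≠ π.edge →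
        S.X f c ≠ S.X π.edge c := fun f hf hne =>
      X_ne_of_through (π.mem_Icc hcπ) (π'.mem_Icc hcπ') ⟨hf.1, l1.le.trans hf.2⟩ hX hne
        (fun h => ⟨h ▸ π'.lo_le.trans_lt l2, l1.trans_le π.le_hi⟩)
        (fun h => ⟨h ▸ π'.lo_le.trans_lt l2, l1.trans_le hf.2⟩)
    refine Iff.trans ?_ (hT g _ _).symm
    constructor
    · rintro ⟨hs, h⟩
      exact ⟨by rw [hs], (X_lt_iff_exists_rel g.2 hs hcπ hu).1 h⟩
    · rintro ⟨hs, h⟩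
      have hs' : g.1.slab = π.slab := Slab.eq_of_bot_eq hs
      exact ⟨hs', (X_lt_iff_exists_rel g.2 hs' hcπ hu).2 h⟩
  have htop : ∀ g : S.LeftPiece, (g.1.slab = π'.slab ∧
      S.X g.1.edge π'.slab.mid < S.X π'.edge π'.slab.mid) ↔ T (topFiber g) := by
    intro g
    have hu : ∀ f, S.lo f ≤ π'.slab.bot ∧ π'.slab.top ≤ S.hi f → f ≠ π'.edge →
        S.X f c ≠ S.X π'.edge c := fun f hf hne =>
      X_ne_of_through (π'.mem_Icc hcπ') (π.mem_Icc hcπ) ⟨hf.1.trans l2.le, hc ▸ hf.2⟩ hX.symm hne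
        (fun h => ⟨π'.lo_le.trans_lt l2, h ▸ l1.trans_le π.le_hi⟩)
        (fun h => ⟨hf.1.trans_lt l2, h ▸ l1.trans_le π.le_hi⟩)
    refine Iff.trans ?_ (hT g _ _).symm
    rw [hX]
    constructor
    · rintro ⟨hs, h⟩
      exact ⟨by rw [hs, hc], (X_lt_iff_exists_rel g.2 hs hcπ' hu).1 h⟩
    · rintro ⟨hs, h⟩
      have hs' : g.1.slab = π'.slab := Slab.eq_of_top_eq (hs.trans hc)
      exact ⟨hs', (X_lt_iff_exists_rel g.2 hs' hcπ' hu).2 h⟩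
  have key : ∀ F : S.LeftPiece → S.LevelFiber, (∑ g, if T (F g) then z g else 0) =
      ∑ v, if T v then ∑ g, (if F g = v then z g else 0) else 0 := by
    intro F
    have : ∀ v, (if T v then ∑ g, (if F g = v then z g else 0) else 0) =
        ∑ g, if F g = v then (if T v then z g else 0) else 0 := fun v => by
      split_ifs <;> simp
    simp only [this]
    rw [Finset.sum_comm]
    simp
  unfold winding
  simp only [hbot, htop]
  rw [key, key]
  exact Finset.sum_congr rfl fun v _ => by rw [hz v]

/-- Winding numbers do not change at an endpoint where two segments meet from the same side. -/
lemma winding_eq_of_meet [Finite ι] {z : S.LeftPiece → ℚ} (hz : IsFlow z)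
    {π₁ π₂ : Piece S.lo S.hi} (hs : π₁.slab = π₂.slab)
    (hlt : S.X π₁.edge π₁.slab.mid < S.X π₂.edge π₁.slab.mid) {y₀ : ℝ}
    (hy₀ : y₀ ∈ Icc π₁.slab.bot π₁.slab.top) (hX : S.X π₁.edge y₀ = S.X π₂.edge y₀) :
    winding z π₁ = winding z π₂ := by
  classical
  have sp₂ : S.lo π₂.edge ≤ π₁.slab.bot ∧ π₁.slab.top ≤ S.hi π₂.edge := hs ▸ π₂.spans
  have hy₂ : y₀ ∈ Icc π₂.slab.bot π₂.slab.top := hs ▸ hy₀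
  have hne : π₁.edge ≠ π₂.edge := fun h => hlt.ne (by rw [h])
  have hthree : ∀ f, y₀ ∈ Icc (S.lo f) (S.hi f) → S.X f y₀ = S.X π₁.edge y₀ →
      f = π₁.edge ∨ f = π₂.edge := by
    intro f hf hfX
    by_contra! h
    exact S.three π₁.edge π₂.edge f y₀ hne h.1.symm h.2.symm (π₁.mem_Icc hy₀) (π₂.mem_Icc hy₂) hf
      hX hfX.symm
  -- no third segment passes between `π₁` and `π₂`, as it would run into their common endpoint
  have hnot : ∀ f, S.lo f ≤ π₁.slab.bot ∧ π₁.slab.top ≤ S.hi f →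
      S.X π₁.edge π₁.slab.mid < S.X f π₁.slab.mid →
      ¬ S.X f π₁.slab.mid < S.X π₂.edge π₁.slab.mid := by
    intro f hf h1 h2
    have h3 := X_le_X_of_lt π₁.spans hf π₁.slab.mid_mem hy₀ h1
    have h4 := X_le_X_of_lt hf sp₂ π₁.slab.mid_mem hy₀ h2
    rcases hthree f ⟨hf.1.trans hy₀.1, hy₀.2.trans hf.2⟩ (by linarith) with h | h
    · rw [h] at h1; exact h1.ne rfl
    · rw [h] at h2; exact h2.ne rfl
  -- if `π₁` is a left piece, then the fiber of the common endpoint is a single point, and `π₁` is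
  -- the only left piece there, so it carries no flow
  have hzero : ∀ g : S.LeftPiece, g.1 = π₁ → z g = 0 := by
    rintro ⟨g, hg⟩ rfl
    simp only at hne hthree hnot hlt hX hs hy₀ sp₂
    have hmid := eventually_mem_iff_right g (Ioo_subset_Icc_self g.slab.mid_mem)
      (fun f hf h => h.ne')
    have hright : ¬ S.Left π₂ := by
      intro h2
      obtain ⟨x, h3, h4⟩ := (hmid.and (Ioo_mem_nhdsGT hlt)).exists
      refine disjoint_left.1 h2 (?_ : (x, g.slab.mid) ∈ _) (h3.2 hg)
      refine ⟨hs ▸ g.slab.mid_mem, h4.2, fun f hf h5 => ?_⟩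
      rw [← hs] at hf h5
      by_contra! h6
      exact hnot f hf (h4.1.trans_le h6) h5
    have hrel : ∀ x, S.Rel (S.X g.edge y₀, y₀) (x, y₀) → x = S.X g.edge y₀ := by
      rintro x ⟨-, hx⟩
      rcases lt_trichotomy x (S.X g.edge y₀) with h | h | h
      · have h1 := eventually_mem_iff g hy₀ fun f hf h1 h2 => by
          rcases hthree f ⟨hf.1.trans hy₀.1, hy₀.2.trans hf.2⟩ h2 with h3 | h3
          · rw [h3] at h1; exact h1.ne rfl
          · rw [h3] at h1; exact h1.not_gt hlt
        obtain ⟨x', h2, h3⟩ := (h1.and (Ioo_mem_nhdsLT h)).exists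
        rw [uIcc_of_ge h.le] at hx
        exact absurd hg (h2.1 (hx x' ⟨h3.1.le, h3.2.le⟩))
      · exact h
      · have h1 := eventually_mem_iff_right π₂ hy₂ fun f hf h1 h2 => by
          rw [← hs] at hf h1
          rcases hthree f ⟨hf.1.trans hy₀.1, hy₀.2.trans hf.2⟩ (h2.trans hX.symm) with h3 | h3
          · rw [h3] at h1; exact h1.not_gt hlt
          · rw [h3] at h1; exact h1.ne rfl
        rw [← hX] at h1
        obtain ⟨x', h2, h3⟩ := (h1.and (Ioo_mem_nhdsGT h)).exists
        rw [uIcc_of_le h.le] at hx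
        exact absurd (h2.1 (hx x' ⟨h3.1.le, h3.2.le⟩)) hright
    have heq : ∀ (k : S.LeftPiece) (y : ℝ) (hy : y ∈ Icc k.1.slab.bot k.1.slab.top),
        Quotient.mk S.reeb (pt k.1 hy) = Quotient.mk S.reeb (pt g hy₀) →
        y = y₀ ∧ (k.1.edge = g.edge ∨ k.1.edge = π₂.edge) := by
      intro k y hy h
      have h1 : S.Rel (S.X k.1.edge y, y) (S.X g.edge y₀, y₀) := Quotient.exact h
      have h2 : y = y₀ := h1.1
      subst h2
      exact ⟨rfl, hthree _ (k.1.mem_Icc hy) (hrel _ h1.symm)⟩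
    have hself : ∀ k : S.LeftPiece, k.1.slab = g.slab →
        (k.1.edge = g.edge ∨ k.1.edge = π₂.edge) → k = ⟨g, hg⟩ := by
      rintro ⟨k, hk⟩ h1 (h2 | h2)
      · exact Subtype.ext (Piece.ext h2 h1)
      · have : k = π₂ := Piece.ext h2 (h1.trans hs)
        exact absurd (this ▸ hk) hright
    have hend := S.endpoint _ _ y₀ hne (g.mem_Icc hy₀) (π₂.mem_Icc hy₂) hX
    have hend' := S.endpoint _ _ y₀ hne.symm (π₂.mem_Icc hy₂) (g.mem_Icc hy₀) hX.symm
    have l1 := g.slab.lt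
    have l2 := g.spans
    -- conservation of the flow at the fiber of the endpoint reads `z g = 0` or `0 = z g`
    by_cases hb : y₀ = g.slab.bot
    · subst hb
      have h1 := hz (botFiber ⟨g, hg⟩)
      rw [Finset.sum_eq_single ⟨g, hg⟩, if_pos rfl, Finset.sum_eq_zero] at h1
      · exact h1
      · intro k _
        refine if_neg fun h => ?_
        obtain ⟨h2, h3⟩ := heq k _ _ (congrArg Subtype.val h)
        have h5 := k.1.lo_le
        have h6 := k.1.slab.lt
        rcases h3 with h3 | h3 <;> rw [h3] at h5
        · rcases hend with h | h <;> linarith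
        · rcases hend' with h | h <;> linarith
      · intro k _ hk
        refine if_neg fun h => hk ?_
        obtain ⟨h2, h3⟩ := heq k _ _ (congrArg Subtype.val h)
        exact hself k (Slab.eq_of_bot_eq h2) h3
      · exact fun h => absurd (Finset.mem_univ _) h
    · have ht : y₀ = g.slab.top := by
        by_contra ht
        exact hne (eq_of_X_eq g.spans sp₂
          ⟨lt_of_le_of_ne hy₀.1 (Ne.symm hb), lt_of_le_of_ne hy₀.2 ht⟩ hX)
      subst ht
      have h1 := hz (topFiber ⟨g, hg⟩)
      symm at h1
      rw [Finset.sum_eq_single ⟨g, hg⟩, if_pos rfl, Finset.sum_eq_zero] at h1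
      · exact h1
      · intro k _
        refine if_neg fun h => ?_
        obtain ⟨h2, h3⟩ := heq k _ _ (congrArg Subtype.val h)
        have h5 := k.1.le_hi
        have h6 := k.1.slab.lt
        rcases h3 with h3 | h3 <;> rw [h3] at h5
        · rcases hend with h | h <;> linarith
        · rcases hend' with h | h <;> linarith
      · intro k _ hk
        refine if_neg fun h => hk ?_
        obtain ⟨h2, h3⟩ := heq k _ _ (congrArg Subtype.val h)
        exact hself k (Slab.eq_of_top_eq h2) h3
      · exact fun h => absurd (Finset.mem_univ _) h
  unfold winding
  refine Finset.sum_congr rfl fun g _ => ?_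
  by_cases hg : g.1.slab = π₁.slab
  · by_cases h1 : S.X g.1.edge π₁.slab.mid < S.X π₁.edge π₁.slab.mid
    · rw [if_pos ⟨hg, h1⟩, if_pos ⟨hg.trans hs, by rw [← hs]; exact h1.trans hlt⟩]
    rw [if_neg fun h => h1 h.2]
    split_ifs with h2
    · rw [← hs] at h2
      have hgs : S.lo g.1.edge ≤ π₁.slab.bot ∧ π₁.slab.top ≤ S.hi g.1.edge := hg ▸ g.1.spans
      rcases (not_lt.1 h1).lt_or_eq with h3 | h3
      · exact absurd h2.2 (hnot _ hgs h3)
      · exact (hzero g (Piece.ext (eq_of_X_eq π₁.spans hgs π₁.slab.mid_mem h3).symm hg)).symm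
    · rfl
  · rw [if_neg fun h => hg h.1, if_neg fun h => hg (h.1.trans hs.symm)]

/-- Pieces that touch have the same winding number. -/
lemma winding_eq_of_touch [Finite ι] {z : S.LeftPiece → ℚ} (hz : IsFlow z)
    {π₁ π₂ : Piece S.lo S.hi} {y : ℝ} (h1 : y ∈ Icc π₁.slab.bot π₁.slab.top)
    (h2 : y ∈ Icc π₂.slab.bot π₂.slab.top) (hX : S.X π₁.edge y = S.X π₂.edge y) :
    winding z π₁ = winding z π₂ := by
  by_cases hs : π₁.slab = π₂.slab
  · have sp₂ : S.lo π₂.edge ≤ π₁.slab.bot ∧ π₁.slab.top ≤ S.hi π₂.edge := hs ▸ π₂.spans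
    rcases lt_trichotomy (S.X π₁.edge π₁.slab.mid) (S.X π₂.edge π₁.slab.mid) with h | h | h
    · exact winding_eq_of_meet hz hs h h1 hX
    · rw [Piece.ext (eq_of_X_eq π₁.spans sp₂ π₁.slab.mid_mem h) hs]
    · exact (winding_eq_of_meet hz hs.symm (hs ▸ h) h2 hX.symm).symm
  · have key : ∀ {σ τ : Slab S.lo S.hi}, y ∈ Icc σ.bot σ.top → y ∈ Icc τ.bot τ.top → σ ≠ τ →
        y = σ.bot ∨ y = σ.top := by
      intro σ τ hσ hτ hne
      by_contra! h
      have hσ' : y ∈ Ioo σ.bot σ.top := ⟨lt_of_le_of_ne hσ.1 h.1.symm, lt_of_le_of_ne hσ.2 h.2⟩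
      rcases hτ.1.eq_or_lt with h3 | h3
      · exact σ.gap _ τ.bot_mem (h3 ▸ hσ')
      rcases hτ.2.eq_or_lt with h4 | h4
      · exact σ.gap _ τ.top_mem (h4 ▸ hσ')
      · exact hne (Slab.eq_of_mem hσ' ⟨h3, h4⟩)
    rcases key h1 h2 hs with h3 | h3 <;> rcases key h2 h1 (Ne.symm hs) with h4 | h4
    · exact absurd (Slab.eq_of_bot_eq (h3.symm.trans h4)) hs
    · exact winding_eq_of_adjacent hz (h3.symm.trans h4) (h3 ▸ hX)
    · exact (winding_eq_of_adjacent hz (h4.symm.trans h3) (h4 ▸ hX.symm)).symm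
    · exact absurd (Slab.eq_of_top_eq (h3.symm.trans h4)) hs

end SweepRegion

namespace SweepRegion

variable {ι : Type} {S : SweepRegion ι}

/-! ### Counting vertices and edges of the Reeb graph -/

/-- The flow through a left piece is the difference of two winding numbers. -/
lemma exists_winding_eq_add [Finite ι] (g₀ : S.LeftPiece) :
    ∃ π : Piece S.lo S.hi, ∀ z, winding z π = winding z g₀.1 + z g₀ := by
  classical
  obtain ⟨g, hgdef⟩ : ∃ g, g = g₀.1 := ⟨_, rfl⟩
  have hg : S.Left g := hgdef ▸ g₀.2
  rw [← hgdef]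
  set m := g.slab.mid with hm
  -- the next piece on the right: without one, the unbounded cell would belong to the region
  have hne : {f | (S.lo f ≤ g.slab.bot ∧ g.slab.top ≤ S.hi f) ∧
      S.X g.edge m < S.X f m}.Nonempty := by
    by_contra hne
    obtain ⟨M, hM⟩ := (S.isCompact.image continuous_fst).bddAbove
    have hcell : (-(max (M + 1) (S.X g.edge m + 1)), m) ∈ S.mirror.cell g := by
      refine ⟨g.slab.mid_mem, ?_, fun f hf hlt => absurd ?_ hne⟩
      · rw [mirror_X]
        have : S.X g.edge m + 1 ≤ max (M + 1) (S.X g.edge m + 1) := le_max_right _ _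
        change -max (M + 1) (S.X g.edge m + 1) < -S.X g.edge m
        linarith
      · rw [mirror_X, mirror_X, neg_lt_neg_iff] at hlt
        exact ⟨f, hf, hlt⟩
    have hr : ¬ S.mirror.Left g := by rw [mirror_left_iff, not_not]; exact hg
    have := interior_subset (cell_subset hr hcell)
    rw [mem_mirror, neg_neg] at this
    have h2 := hM ⟨_, this, rfl⟩
    have : M + 1 ≤ max (M + 1) (S.X g.edge m + 1) := le_max_left _ _
    simp only at h2
    linarith
  obtain ⟨f, ⟨hf, hlt⟩, hmin⟩ := exists_min_image _ (fun f => S.X f m) (toFinite _) hne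
  refine ⟨⟨f, g.slab, hf.1, hf.2⟩, fun z => ?_⟩
  have hsplit : ∀ k : S.LeftPiece,
      (if k.1.slab = g.slab ∧ S.X k.1.edge m < S.X f m then z k else 0) =
      (if k.1.slab = g.slab ∧ S.X k.1.edge m < S.X g.edge m then z k else 0) +
      if k = g₀ then z k else 0 := by
    intro k
    by_cases hs : k.1.slab = g.slab
    · by_cases hk : k = g₀
      · subst hk
        rw [← hgdef, if_pos ⟨rfl, hlt⟩, if_neg (fun h => h.2.ne rfl), if_pos rfl, zero_add]
      · have hks : S.lo k.1.edge ≤ g.slab.bot ∧ g.slab.top ≤ S.hi k.1.edge := hs ▸ k.1.spans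
        have hiff : S.X k.1.edge m < S.X f m ↔ S.X k.1.edge m < S.X g.edge m := by
          refine ⟨fun h => ?_, fun h => h.trans hlt⟩
          by_contra! h2
          rcases h2.lt_or_eq with h3 | h3
          · exact h.not_ge (hmin _ ⟨hks, h3⟩)
          · have hkg : k.1 = g := Piece.ext (eq_of_X_eq g.spans hks g.slab.mid_mem h3).symm hs
            exact hk (Subtype.ext (hkg.trans hgdef))
        simp [hs, hk, hiff]
    · have hk : k ≠ g₀ := fun h => hs (by rw [h, hgdef])
      simp [hs, hk]
  unfold winding
  simp only [← hm, hsplit, Finset.sum_add_distrib, Finset.sum_ite_eq', Finset.mem_univ, if_true]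

/-- Nothing flows on the left of the leftmost piece of a slab. -/
lemma exists_winding_eq_zero [Finite ι] [Nonempty ι] :
    ∃ π : Piece S.lo S.hi, ∀ z, winding z π = 0 := by
  classical
  obtain ⟨e⟩ := ‹Nonempty ι›
  obtain ⟨σ, h1, h2, -⟩ := Slab.exists_mem_Icc (S.lo_lt_hi e) le_rfl (S.lo_lt_hi e).le
  obtain ⟨f, hf, hmin⟩ := exists_min_image {f | S.lo f ≤ σ.bot ∧ σ.top ≤ S.hi f}
    (fun f => S.X f σ.mid) (toFinite _) ⟨e, h1, h2⟩
  refine ⟨⟨f, σ, hf.1, hf.2⟩, fun z => Finset.sum_eq_zero fun g _ => if_neg ?_⟩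
  rintro ⟨hs, hlt⟩
  exact hlt.not_ge (hmin _ (by have := g.1.spans; rwa [hs] at this))

/-- The points of the frontier that lie on a piece. -/
def pieceSet (π : Piece S.lo S.hi) : Set (frontier S.L) :=
  {p | p.1.2 ∈ Icc π.slab.bot π.slab.top ∧ p.1.1 = S.X π.edge p.1.2}

lemma isClosed_pieceSet (π : Piece S.lo S.hi) : IsClosed (pieceSet π) := by
  have h1 : Continuous fun p : frontier S.L => p.1.2 := by fun_prop
  exact (isClosed_Icc.preimage h1).inter
    (isClosed_eq (by fun_prop) ((S.continuous_X _).comp h1))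

lemma exists_mem_pieceSet [Finite ι] (p : frontier S.L) : ∃ π, p ∈ pieceSet π := by
  obtain ⟨e, h1, h2, h3⟩ := (S.frontier_iff _).1 p.2
  obtain ⟨σ, h4, h5, h6⟩ := Slab.exists_mem_Icc (S.lo_lt_hi e) h1 h2
  exact ⟨⟨e, σ, h4, h5⟩, h6, h3⟩

lemma pieceSet_nonempty (π : Piece S.lo S.hi) : (pieceSet π).Nonempty :=
  ⟨⟨(S.X π.edge π.slab.mid, π.slab.mid),
    mem_frontier (π.mem_Icc (Ioo_subset_Icc_self π.slab.mid_mem))⟩,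
    Ioo_subset_Icc_self π.slab.mid_mem, rfl⟩

/-- The winding number of a flow is constant on the components of the frontier. -/
lemma winding_eq_of_component [Finite ι] {z : S.LeftPiece → ℚ} (hz : IsFlow z)
    {p q : frontier S.L} (h : ConnectedComponents.mk p = ConnectedComponents.mk q)
    {π π' : Piece S.lo S.hi} (hp : p ∈ pieceSet π) (hq : q ∈ pieceSet π') :
    winding z π = winding z π' := by
  choose c hc using exists_mem_pieceSet (S := S)
  have hw : ∀ p π, p ∈ pieceSet π → winding z (c p) = winding z π := fun p π hπ =>
    winding_eq_of_touch hz (hc p).1 hπ.1 ((hc p).2.symm.trans hπ.2)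
  have hcl : ∀ T : Set ℚ, IsClosed ((fun p => winding z (c p)) ⁻¹' T) := fun T => by
    have : (fun p => winding z (c p)) ⁻¹' T =
        ⋃ π ∈ {π : Piece S.lo S.hi | winding z π ∈ T}, pieceSet π := by
      ext p
      simp only [mem_preimage, mem_iUnion, mem_ofPred_eq, exists_prop]
      constructor
      · exact fun h => ⟨c p, h, hc p⟩
      · rintro ⟨π, h1, h2⟩
        rwa [hw p π h2]
    rw [this]
    exact (toFinite _).isClosed_biUnion fun π _ => isClosed_pieceSet π
  have hloc : IsLocallyConstant fun p => winding z (c p) := fun T => by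
    rw [← isClosed_compl_iff, ← preimage_compl]
    exact hcl _
  rw [← hw p π hp, ← hw q π' hq]
  exact hloc.apply_eq_of_isPreconnected isPreconnected_connectedComponent mem_connectedComponent
    (by rw [ConnectedComponents.coe_eq_coe.1 h]; exact mem_connectedComponent)

open Classical in
/-- The net flow out of the vertices. -/
noncomputable def div [Finite ι] (S : SweepRegion ι) :
    (S.LeftPiece → ℚ) →ₗ[ℚ] (S.LevelFiber → ℚ) where
  toFun z v := (∑ g, if botFiber g = v then z g else 0) - ∑ g, if topFiber g = v then z g else 0
  map_add' z z' := by
    ext v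
    simp only [Pi.add_apply, ite_add_zero, Finset.sum_add_distrib]
    ring
  map_smul' a z := by
    ext v
    simp only [Pi.smul_apply, smul_eq_mul, RingHom.id_apply, mul_sub, Finset.mul_sum, mul_ite,
      mul_zero]

lemma sum_div [Finite ι] (z : S.LeftPiece → ℚ) : ∑ v, S.div z v = 0 := by
  classical
  simp only [div, LinearMap.coe_mk, AddHom.coe_mk, Finset.sum_sub_distrib]
  rw [Finset.sum_comm, Finset.sum_comm (f := fun v g => if topFiber g = v then z g else 0)]
  simp

/-- The winding number around a piece, as a linear form. -/
noncomputable def windingHom [Finite ι] (π : Piece S.lo S.hi) : (S.LeftPiece → ℚ) →ₗ[ℚ] ℚ where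
  toFun z := winding z π
  map_add' z z' := by
    simp only [winding, Pi.add_apply, ite_add_zero, Finset.sum_add_distrib]
  map_smul' a z := by
    simp only [winding, Pi.smul_apply, smul_eq_mul, RingHom.id_apply, Finset.mul_sum, mul_ite,
      mul_zero]

/-- The first Betti number of the Reeb graph is less than the number of frontier components: a flow
is determined by its winding numbers around the components, and one of these vanishes. -/
theorem card_leftPiece_add_two_le [Finite ι] [Nonempty ι]
    [Finite (ConnectedComponents (frontier S.L))] :
    Nat.card S.LeftPiece + 2 ≤
      Nat.card S.LevelFiber + Nat.card (ConnectedComponents (frontier S.L)) := by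
  classical
  have : Fintype (ConnectedComponents (frontier S.L)) := Fintype.ofFinite _
  obtain ⟨π₀, hπ₀⟩ := exists_winding_eq_zero (S := S)
  obtain ⟨p₀, hp₀⟩ := pieceSet_nonempty π₀
  obtain ⟨e⟩ := ‹Nonempty ι›
  let v₀ : S.LevelFiber := ⟨Quotient.mk _ ⟨(S.X e (S.lo e), S.lo e),
    mem_L (left_mem_Icc.2 (S.lo_lt_hi e).le)⟩, _, rfl, Or.inl ⟨e, rfl⟩⟩
  have hρ : ∀ C : ConnectedComponents (frontier S.L), ∃ π, (∃ p ∈ pieceSet π,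
      ConnectedComponents.mk p = C) ∧ (C = ConnectedComponents.mk p₀ → π = π₀) := by
    intro C
    by_cases hC : C = ConnectedComponents.mk p₀
    · exact ⟨π₀, ⟨p₀, hp₀, hC.symm⟩, fun _ => rfl⟩
    · obtain ⟨p, rfl⟩ := ConnectedComponents.surjective_coe C
      obtain ⟨π, hπ⟩ := exists_mem_pieceSet p
      exact ⟨π, ⟨p, hπ, rfl⟩, fun h => absurd h hC⟩
  choose ρ hρ hρ₀ using hρ
  -- The divergence of `z` sums to zero and its winding number around `π₀` vanishes. Two extra
  -- variables, added at `v₀` and at the component of `π₀`, turn both relations into dimensions.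
  let Ψ : ((S.LeftPiece → ℚ) × (ℚ × ℚ)) →ₗ[ℚ]
      ((S.LevelFiber → ℚ) × (ConnectedComponents (frontier S.L) → ℚ)) :=
    LinearMap.prod
      (S.div ∘ₗ LinearMap.fst _ _ _ + LinearMap.single ℚ (fun _ => ℚ) v₀ ∘ₗ
        LinearMap.fst _ _ _ ∘ₗ LinearMap.snd _ _ _)
      (LinearMap.pi (fun C => windingHom (ρ C)) ∘ₗ LinearMap.fst _ _ _ +
        LinearMap.single ℚ (fun _ => ℚ) (ConnectedComponents.mk p₀) ∘ₗ
        LinearMap.snd _ _ _ ∘ₗ LinearMap.snd _ _ _)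
  have hinj : Function.Injective Ψ := by
    rw [← LinearMap.ker_eq_bot, LinearMap.ker_eq_bot']
    rintro ⟨z, a, b⟩ h
    have h1 : ∀ v, S.div z v + Pi.single (M := fun _ => ℚ) v₀ a v = 0 :=
      fun v => congrFun (congrArg Prod.fst h) v
    have h2 : ∀ C, winding z (ρ C) +
        Pi.single (M := fun _ => ℚ) (ConnectedComponents.mk p₀) b C = 0 :=
      fun C => congrFun (congrArg Prod.snd h) C
    have ha : a = 0 := by
      have := Finset.sum_congr rfl fun v (_ : v ∈ Finset.univ) => h1 v
      rw [Finset.sum_add_distrib, sum_div] at this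
      simpa using this
    have hb : b = 0 := by
      have := h2 (ConnectedComponents.mk p₀)
      rw [hρ₀ _ rfl, hπ₀] at this
      simpa using this
    subst ha hb
    simp only [Pi.single_zero, Pi.zero_apply, add_zero] at h1 h2
    have hflow : IsFlow z := fun v => sub_eq_zero.1 (h1 v)
    have hz0 : ∀ π, winding z π = 0 := by
      intro π
      obtain ⟨q, hq⟩ := pieceSet_nonempty π
      obtain ⟨p, hp, hpq⟩ := hρ (ConnectedComponents.mk q)
      rw [← winding_eq_of_component hflow hpq hp hq, h2]
    have hz : z = 0 := funext fun g => by
      obtain ⟨π, hπ⟩ := exists_winding_eq_add g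
      simpa [hz0] using (hπ z).symm
    rw [hz]
    rfl
  have := LinearMap.finrank_le_finrank_of_injective hinj
  simpa [Nat.card_eq_fintype_card] using this

/-! ### The Reeb graph as the realization of a finite graph -/

lemma isClosed_rel : IsClosed {x : S.L × S.L | S.Rel x.1 x.2} := by
  have : {x : S.L × S.L | S.Rel x.1 x.2} = {x : S.L × S.L | x.1.1.2 = x.2.1.2} ∩
      ⋂ θ ∈ Icc (0 : ℝ) 1, {x : S.L × S.L |
        ((1 - θ) • x.1.1.1 + θ • x.2.1.1, x.1.1.2) ∈ S.L} := by
    ext x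
    simp only [Rel, ← segment_eq_uIcc, segment_eq_image, forall_mem_image, mem_ofPred_eq,
      mem_inter_iff, mem_iInter]
  rw [this]
  refine (isClosed_eq (by fun_prop) (by fun_prop)).inter (isClosed_biInter fun θ _ => ?_)
  exact S.isClosed.preimage (by fun_prop)

/-- The Reeb graph is Hausdorff, since it is the quotient of a compact space by a closed
relation. -/
instance : T2Space (Quotient S.reeb) := by
  have : CompactSpace S.L := isCompact_iff_compactSpace.1 S.isCompact
  have hsat : ∀ C : Set S.L, IsClosed C →
      IsClosed (Quotient.mk S.reeb ⁻¹' (Quotient.mk S.reeb '' C)) := by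
    intro C hC
    have : Quotient.mk S.reeb ⁻¹' (Quotient.mk S.reeb '' C) =
        Prod.snd '' ({x : S.L × S.L | S.Rel x.1 x.2} ∩ Prod.fst ⁻¹' C) := by
      ext y
      simp only [mem_preimage, mem_image, mem_inter_iff, mem_ofPred_eq, Prod.exists]
      constructor
      · rintro ⟨x, hx, h⟩
        exact ⟨x, y, ⟨Quotient.exact h, hx⟩, rfl⟩
      · rintro ⟨x, y', ⟨h, hx⟩, rfl⟩
        exact ⟨x, hx, Quotient.sound h⟩
    rw [this]
    exact ((isClosed_rel.inter (hC.preimage continuous_fst)).isCompact.image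
      continuous_snd).isClosed
  have hcm : IsClosedMap (Quotient.mk S.reeb) := fun C hC =>
    isQuotientMap_quotient_mk'.isClosed_preimage.1 (hsat C hC)
  have hpr : IsProperMap (Quotient.mk S.reeb) := by
    refine isProperMap_iff_isClosedMap_and_compact_fibers.2
      ⟨continuous_quotient_mk', hcm, fun q => ?_⟩
    obtain ⟨x, rfl⟩ := Quotient.exists_rep q
    have := hsat {x} isClosed_singleton
    rw [image_singleton] at this
    exact this.isCompact
  rw [t2_iff_isClosed_diagonal]
  have : diagonal (Quotient S.reeb) =
      Prod.map (Quotient.mk S.reeb) (Quotient.mk S.reeb) '' {x : S.L × S.L | S.Rel x.1 x.2} := by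
    ext ⟨a, b⟩
    simp only [mem_diagonal_iff, mem_image, mem_ofPred_eq, Prod.exists, Prod.map_apply,
      Prod.mk.injEq]
    constructor
    · rintro rfl
      obtain ⟨x, rfl⟩ := Quotient.exists_rep a
      exact ⟨x, x, Rel.refl x.2, rfl, rfl⟩
    · rintro ⟨x, y, h, rfl, rfl⟩
      exact Quotient.sound h
  rw [this]
  exact (hpr.prodMap hpr).isClosedMap _ isClosed_rel

/-- The height on a piece, affinely parametrized by `[0, 1]` and constant outside. -/
noncomputable def _root_.Slab.height {lo hi : ι → ℝ} (σ : Slab lo hi) (r : ℝ) : ℝ :=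
  σ.bot + max 0 (min r 1) * (σ.top - σ.bot)

lemma _root_.Slab.height_mem {lo hi : ι → ℝ} (σ : Slab lo hi) (r : ℝ) :
    σ.height r ∈ Icc σ.bot σ.top := by
  have h1 : 0 ≤ max 0 (min r 1) := le_max_left _ _
  have h2 : max 0 (min r 1) ≤ 1 := max_le zero_le_one (min_le_right _ _)
  have := σ.lt
  unfold Slab.height
  constructor <;> nlinarith

lemma _root_.Slab.height_eq {lo hi : ι → ℝ} (σ : Slab lo hi) {r : ℝ} (hr : r ∈ Ioo (0 : ℝ) 1) :
    σ.height r = σ.bot + r * (σ.top - σ.bot) := by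
  rw [Slab.height, min_eq_left hr.2.le, max_eq_right hr.1.le]

lemma _root_.Slab.height_mem_Ioo {lo hi : ι → ℝ} (σ : Slab lo hi) {r : ℝ}
    (hr : r ∈ Ioo (0 : ℝ) 1) : σ.height r ∈ Ioo σ.bot σ.top := by
  have := σ.lt
  rw [σ.height_eq hr]
  constructor <;> nlinarith [hr.1, hr.2]

/-- The Reeb graph is a finite graph: its vertices are the fibers at the heights of endpoints, its
edges are the left pieces, a fiber between two such heights being located by its left end. -/
theorem nonempty_homeomorph [Finite ι] :
    Nonempty (GraphReal (botFiber (S := S)) topFiber ≃ₜ Quotient S.reeb) := by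
  let p : S.LeftPiece → ℝ → Quotient S.reeb := fun g r =>
    Quotient.mk _ (pt g.1 (g.1.slab.height_mem r))
  let F : GraphReal (botFiber (S := S)) topFiber → Quotient S.reeb :=
    GraphReal.glue (fun v => v.1) p
  have hcont : Continuous F := by
    refine GraphReal.continuous_glue (fun g => ?_) (fun g r hr => ?_) (fun g r hr => ?_)
    · refine continuous_quotient_mk'.comp (Continuous.subtype_mk ?_ _)
      have : Continuous g.1.slab.height := by unfold Slab.height; fun_prop
      exact ((S.continuous_X _).comp this).prodMk this
    · have : g.1.slab.height r = g.1.slab.bot := by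
        simp [Slab.height, min_eq_left (hr.trans zero_le_one), max_eq_left hr]
      simp only [p, this]
      rfl
    · have : g.1.slab.height r = g.1.slab.top := by
        simp [Slab.height, min_eq_right hr]
      simp only [p, this]
      rfl
  have hFe : ∀ g, ∀ r ∈ Ioo (0 : ℝ) 1, F (GraphReal.edge _ _ g r) = p g r :=
    fun g r hr => GraphReal.glue_edge_of_mem _ _ hr
  have hnl : ∀ (g : S.LeftPiece) (v : S.LevelFiber), ∀ r ∈ Ioo (0 : ℝ) 1, v.1 ≠ p g r := by
    rintro g ⟨-, x, rfl, hx⟩ r hr h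
    have h1 : x.1.2 = g.1.slab.height r := (Quotient.exact h : S.Rel _ _).1
    exact g.1.slab.gap _ hx (h1 ▸ g.1.slab.height_mem_Ioo hr)
  -- a left piece is determined by its fibers
  have hle : ∀ g k : S.LeftPiece, g.1.slab = k.1.slab → ∀ y ∈ Ioo g.1.slab.bot g.1.slab.top,
      S.Rel (S.X g.1.edge y, y) (S.X k.1.edge y, y) → S.X g.1.edge y ≤ S.X k.1.edge y := by
    intro g k hs y hy hrel
    by_contra! h
    have h1 := eventually_mem_iff g.1 (Ioo_subset_Icc_self hy) fun f hf hlt =>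
      (X_lt_X_of_lt hf g.1.spans g.1.slab.mid_mem hy hlt).ne
    obtain ⟨x, h2, h3⟩ := (h1.and (Ioo_mem_nhdsLT h)).exists
    have := hrel.2 x (by rw [uIcc_of_ge h.le]; exact ⟨h3.1.le, h3.2.le⟩)
    exact h2.1 this g.2
  have hinj : Function.Injective F := by
    intro x y hxy
    induction x using GraphReal.ind with
    | hv v =>
      induction y using GraphReal.ind with
      | hv w => exact congrArg _ (Subtype.ext hxy)
      | he g r hr => rw [hFe g r hr] at hxy; exact absurd hxy (hnl g v r hr)
    | he g r hr =>
      rw [hFe g r hr] at hxy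
      induction y using GraphReal.ind with
      | hv w => exact absurd hxy.symm (hnl g w r hr)
      | he k r' hr' =>
        rw [hFe k r' hr'] at hxy
        have hrel : S.Rel (S.X g.1.edge (g.1.slab.height r), g.1.slab.height r)
          (S.X k.1.edge (k.1.slab.height r'), k.1.slab.height r') := Quotient.exact hxy
        have hy := g.1.slab.height_mem_Ioo hr
        have hh : g.1.slab.height r = k.1.slab.height r' := hrel.1
        have hs : g.1.slab = k.1.slab := Slab.eq_of_mem hy (hh ▸ k.1.slab.height_mem_Ioo hr')
        rw [← hh] at hrel
        have hX := le_antisymm (hle g k hs _ hy hrel) (hle k g hs.symm _ (hs ▸ hy) hrel.symm)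
        have hgk : g = k := Subtype.ext (Piece.ext
          (eq_of_X_eq g.1.spans (hs ▸ k.1.spans) hy hX) hs)
        subst hgk
        rw [Slab.height_eq _ hr, Slab.height_eq _ hr'] at hh
        have := g.1.slab.lt
        have : r = r' := by
          have h3 : (r - r') * (g.1.slab.top - g.1.slab.bot) = 0 := by linarith
          rcases mul_eq_zero.1 h3 with h | h <;> linarith
        rw [this]
  have hsurj : Function.Surjective F := by
    intro q
    obtain ⟨x, rfl⟩ := Quotient.exists_rep q
    by_cases hx : x.1.2 ∈ S.levels
    · exact ⟨GraphReal.vert _ _ ⟨_, x, rfl, hx⟩, rfl⟩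
    obtain ⟨e, h1, h2, h3, h4⟩ := exists_left_end x.2
    obtain ⟨σ, hσ⟩ := Slab.exists_mem h1.1 h1.2 hx
    obtain ⟨h5, h6⟩ := Slab.spans hσ h1.1 h1.2
    have hleft : S.Left ⟨e, σ, h5, h6⟩ := by
      by_contra hl
      have h7 := eventually_mem_iff ⟨e, σ, h5, h6⟩ (Ioo_subset_Icc_self hσ) fun f hf hlt =>
        (X_lt_X_of_lt hf ⟨h5, h6⟩ σ.mid_mem hσ hlt).ne
      obtain ⟨y, h8, h9⟩ := (h4.and_eventually h7).exists
      exact h8 (h9.2 hl)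
    have hpos : 0 < σ.top - σ.bot := sub_pos.2 σ.lt
    have hr : (x.1.2 - σ.bot) / (σ.top - σ.bot) ∈ Ioo (0 : ℝ) 1 :=
      ⟨div_pos (sub_pos.2 hσ.1) hpos, (div_lt_one hpos).2 (by linarith [hσ.2])⟩
    refine ⟨GraphReal.edge _ _ ⟨⟨e, σ, h5, h6⟩, hleft⟩ _, (hFe _ _ hr).trans ?_⟩
    have hh : σ.height ((x.1.2 - σ.bot) / (σ.top - σ.bot)) = x.1.2 := by
      rw [σ.height_eq hr, div_mul_cancel₀ _ hpos.ne']
      ring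
    refine Quotient.sound ?_
    change S.Rel (S.X e (σ.height _), σ.height _) x
    rw [hh]
    exact h2
  exact ⟨Continuous.homeoOfEquivCompactToT2 (f := Equiv.ofBijective F ⟨hinj, hsurj⟩) hcont⟩

end SweepRegion

/-! ### Polygons in general position -/

/-- A non-horizontal segment as a graph over its interval of heights. -/
lemma mem_segment_iff_of_snd_lt {a b p : ℝ × ℝ} (h : a.2 < b.2) : p ∈ segment ℝ a b ↔
    a.2 ≤ p.2 ∧ p.2 ≤ b.2 ∧
      p.1 = (a.1 - (b.1 - a.1) / (b.2 - a.2) * a.2) + (b.1 - a.1) / (b.2 - a.2) * p.2 := by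
  have hpos : 0 < b.2 - a.2 := sub_pos.2 h
  rw [segment_eq_image]
  constructor
  · rintro ⟨t, ht, rfl⟩
    simp only [Prod.fst_add, Prod.snd_add, Prod.smul_fst, Prod.smul_snd, smul_eq_mul]
    refine ⟨by nlinarith [ht.1, ht.2], by nlinarith [ht.1, ht.2], ?_⟩
    field_simp
    ring
  · rintro ⟨h1, h2, h3⟩
    refine ⟨(p.2 - a.2) / (b.2 - a.2), ⟨div_nonneg (by linarith) hpos.le,
      (div_le_one hpos).2 (by linarith)⟩, ?_⟩
    ext
    · simp only [Prod.fst_add, Prod.smul_fst, smul_eq_mul]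
      rw [h3]
      field_simp
      ring
    · simp only [Prod.snd_add, Prod.smul_snd, smul_eq_mul]
      field_simp
      ring

namespace PlanarPolygon

variable (P : PlanarPolygon)

/-- The edges of the polygon, directed upwards. -/
def UpEdge : Type := {e : (ℝ × ℝ) × (ℝ × ℝ) // P.edges.Adj e.1 e.2 ∧ e.1.2 < e.2.2}

instance : Finite P.UpEdge := by
  refine Finite.of_injective (β := P.vertices × P.vertices)
    (fun e => (⟨e.1.1, P.mem_vertices_of_adj _ _ e.2.1⟩,
      ⟨e.1.2, P.mem_vertices_of_adj _ _ e.2.1.symm⟩)) fun e f h => ?_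
  simp only [Prod.mk.injEq, Subtype.mk.injEq] at h
  exact Subtype.ext (Prod.ext h.1 h.2)

variable {P}

lemma snd_ne_of_adj (hP : P.InGeneralPosition) {a b : ℝ × ℝ} (h : P.edges.Adj a b) :
    a.2 ≠ b.2 :=
  hP a (P.mem_vertices_of_adj _ _ h) b (P.mem_vertices_of_adj _ _ h.symm) h.ne

lemma UpEdge.sym2_ne {e f : P.UpEdge} (h : e ≠ f) : s(e.1.1, e.1.2) ≠ s(f.1.1, f.1.2) := by
  intro heq
  rcases Sym2.eq_iff.1 heq with ⟨h1, h2⟩ | ⟨h1, h2⟩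
  · exact h (Subtype.ext (Prod.ext h1 h2))
  · have := e.2.2
    have := f.2.2
    rw [h1, h2] at *
    linarith

lemma UpEdge.mem_segment (e : P.UpEdge) {x y : ℝ} (hy : y ∈ Icc e.1.1.2 e.1.2.2)
    (hx : x = (e.1.1.1 - (e.1.2.1 - e.1.1.1) / (e.1.2.2 - e.1.1.2) * e.1.1.2) +
      (e.1.2.1 - e.1.1.1) / (e.1.2.2 - e.1.1.2) * y) : (x, y) ∈ segment ℝ e.1.1 e.1.2 :=
  (mem_segment_iff_of_snd_lt e.2.2).2 ⟨hy.1, hy.2, hx⟩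

lemma mem_endpoints {e f : P.UpEdge} (h : e ≠ f) {p : ℝ × ℝ} (he : p ∈ segment ℝ e.1.1 e.1.2)
    (hf : p ∈ segment ℝ f.1.1 f.1.2) : p = e.1.1 ∨ p = e.1.2 := by
  have := (P.segment_inter_segment _ _ _ _ e.2.1 f.2.1 (UpEdge.sym2_ne h) ⟨he, hf⟩).1
  simpa using this

/-- At most two edges meet at a point. -/
lemma not_three_edges {e f g : P.UpEdge} (h1 : e ≠ f) (h2 : e ≠ g) (h3 : f ≠ g) {p : ℝ × ℝ}
    (he : p ∈ segment ℝ e.1.1 e.1.2) (hf : p ∈ segment ℝ f.1.1 f.1.2)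
    (hg : p ∈ segment ℝ g.1.1 g.1.2) : False := by
  have key : ∀ {k l : P.UpEdge}, k ≠ l → p ∈ segment ℝ k.1.1 k.1.2 → p ∈ segment ℝ l.1.1 l.1.2 →
      ∃ n, s(k.1.1, k.1.2) = s(p, n) ∧ P.edges.Adj p n := by
    intro k l hkl hk hl
    rcases mem_endpoints hkl hk hl with h | h
    · exact ⟨k.1.2, by rw [h], by rw [h]; exact k.2.1⟩
    · exact ⟨k.1.1, by rw [h, Sym2.eq_swap], by rw [h]; exact k.2.1.symm⟩
  obtain ⟨x, hx, hx'⟩ := key h1 he hf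
  obtain ⟨y, hy, hy'⟩ := key h3 hf hg
  obtain ⟨z, hz, hz'⟩ := key h2.symm hg he
  have hxy : x ≠ y := fun h => UpEdge.sym2_ne h1 (by rw [hx, hy, h])
  have hxz : x ≠ z := fun h => UpEdge.sym2_ne h2 (by rw [hx, hz, h])
  have hyz : y ≠ z := fun h => UpEdge.sym2_ne h3 (by rw [hy, hz, h])
  obtain ⟨a, b, -, hab⟩ := ncard_eq_two.1 (P.ncard_neighborSet p (P.mem_vertices_of_adj _ _ hx'))
  have hm : ∀ n, P.edges.Adj p n → n = a ∨ n = b := fun n hn => by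
    have : n ∈ P.edges.neighborSet p := hn
    rw [hab] at this
    simpa using this
  rcases hm x hx' with rfl | rfl <;> rcases hm y hy' with rfl | rfl <;>
    rcases hm z hz' with rfl | rfl <;> simp_all

/-- A polygon in general position, as a region swept by horizontal lines. -/
noncomputable def toSweep (P : PlanarPolygon) (hP : P.InGeneralPosition) :
    SweepRegion P.UpEdge where
  L := P.carrier
  lo e := e.1.1.2
  hi e := e.1.2.2
  α e := e.1.1.1 - (e.1.2.1 - e.1.1.1) / (e.1.2.2 - e.1.1.2) * e.1.1.2
  β e := (e.1.2.1 - e.1.1.1) / (e.1.2.2 - e.1.1.2)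
  isCompact := P.isCompact_carrier
  closure_interior := P.closure_interior_carrier
  lo_lt_hi e := e.2.2
  frontier_iff p := by
    rw [P.frontier_carrier]
    constructor
    · rintro ⟨a, b, hab, hp⟩
      rcases (snd_ne_of_adj hP hab).lt_or_gt with h | h
      · exact ⟨⟨(a, b), hab, h⟩, (mem_segment_iff_of_snd_lt h).1 hp⟩
      · rw [segment_symm] at hp
        exact ⟨⟨(b, a), hab.symm, h⟩, (mem_segment_iff_of_snd_lt h).1 hp⟩
    · rintro ⟨e, he⟩
      exact ⟨_, _, e.2.1, (mem_segment_iff_of_snd_lt e.2.2).2 he⟩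
  endpoint e f y hne he hf h := by
    rcases mem_endpoints hne (e.mem_segment he rfl) (f.mem_segment hf h) with h3 | h3
    · exact Or.inl (congrArg Prod.snd h3)
    · exact Or.inr (congrArg Prod.snd h3)
  three e f g y h1 h2 h3 he hf hg h h' :=
    not_three_edges h1 h2 h3 (e.mem_segment he rfl) (f.mem_segment hf h) (g.mem_segment hg h')

/-- Fibers are horizontal segments. -/
lemma fiber_eq_iff (x y : P.carrier) : P.fiber x = P.fiber y ↔
    x.1.2 = y.1.2 ∧ ∀ u ∈ uIcc x.1.1 y.1.1, (u, x.1.2) ∈ P.carrier := by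
  have hself : ∀ z : P.carrier, z.1 ∈ P.fiber z := fun z => mem_connectedComponentIn ⟨z.2, rfl⟩
  constructor
  · intro h
    have hy : y.1 ∈ P.fiber x := h ▸ hself y
    have hsub : P.fiber x ⊆ {p | p ∈ P.carrier ∧ p.2 = x.1.2} := connectedComponentIn_subset _ _
    refine ⟨(hsub hy).2.symm, fun u hu => ?_⟩
    have hpre : IsPreconnected (Prod.fst '' P.fiber x) :=
      isPreconnected_connectedComponentIn.image _ continuous_fst.continuousOn
    obtain ⟨q, hq, rfl⟩ := hpre.ordConnected.uIcc_subset (mem_image_of_mem _ (hself x))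
      (mem_image_of_mem _ hy) hu
    have := hsub hq
    rw [← this.2]
    exact this.1
  · rintro ⟨h1, h2⟩
    have hpre : IsPreconnected ((fun u : ℝ => (u, x.1.2)) '' uIcc x.1.1 y.1.1) :=
      isPreconnected_uIcc.image _ (by fun_prop)
    have hy : y.1 ∈ P.fiber x := by
      refine hpre.subset_connectedComponentIn ⟨x.1.1, left_mem_uIcc, rfl⟩ ?_
        ⟨y.1.1, right_mem_uIcc, by rw [h1]⟩
      rintro - ⟨u, hu, rfl⟩
      exact ⟨h2 u hu, rfl⟩
    have := connectedComponentIn_eq hy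
    unfold fiber
    rw [this, h1]

lemma fiberSetoid_eq_reeb (hP : P.InGeneralPosition) : P.fiberSetoid = (P.toSweep hP).reeb :=
  Setoid.ext fun x y => fiber_eq_iff x y

lemma segment_subset_frontier {a b : ℝ × ℝ} (h : P.edges.Adj a b) :
    segment ℝ a b ⊆ frontier P.carrier := by
  rw [P.frontier_carrier]
  exact fun p hp => ⟨a, b, h, hp⟩

lemma vertex_mem_frontier {v : ℝ × ℝ} (hv : v ∈ P.vertices) : v ∈ frontier P.carrier := by
  obtain ⟨a, b, -, hab⟩ := ncard_eq_two.1 (P.ncard_neighborSet v hv)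
  have : P.edges.Adj v a := by
    have : a ∈ P.edges.neighborSet v := by rw [hab]; simp
    exact this
  exact segment_subset_frontier this (left_mem_segment ℝ v a)

lemma mk_eq_mk_of_mem_segment {a b : ℝ × ℝ} (h : P.edges.Adj a b) {p q : frontier P.carrier}
    (hp : p.1 ∈ segment ℝ a b) (hq : q.1 ∈ segment ℝ a b) :
    ConnectedComponents.mk p = ConnectedComponents.mk q := by
  have hpre : IsPreconnected ((↑) ⁻¹' segment ℝ a b : Set (frontier P.carrier)) := by
    rw [← IsInducing.subtypeVal.isPreconnected_image, Subtype.image_preimage_coe,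
      inter_eq_right.2 (segment_subset_frontier h)]
    exact (convex_segment a b).isPreconnected
  exact ConnectedComponents.coe_eq_coe'.2 (hpre.subset_connectedComponent hq hp)

variable (P)

/-- The component of the frontier that contains a given vertex. -/
noncomputable def vertexComponent (v : P.vertices) : ConnectedComponents (frontier P.carrier) :=
  ConnectedComponents.mk ⟨v.1, vertex_mem_frontier v.2⟩

variable {P}

lemma vertexComponent_eq_of_adj {v w : P.vertices} (h : P.edges.Adj v.1 w.1) :
    P.vertexComponent v = P.vertexComponent w :=
  mk_eq_mk_of_mem_segment h (left_mem_segment ℝ _ _) (right_mem_segment ℝ _ _)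

lemma vertexComponent_surjective : Function.Surjective P.vertexComponent := by
  intro C
  obtain ⟨p, rfl⟩ := ConnectedComponents.surjective_coe C
  have hp : p.1 ∈ {q | ∃ a b, P.edges.Adj a b ∧ q ∈ segment ℝ a b} := by
    rw [← P.frontier_carrier]
    exact p.2
  obtain ⟨a, b, hab, hp⟩ := hp
  exact ⟨⟨a, P.mem_vertices_of_adj _ _ hab⟩,
    mk_eq_mk_of_mem_segment hab (left_mem_segment ℝ _ _) hp⟩

instance : Finite (ConnectedComponents (frontier P.carrier)) :=
  Finite.of_surjective _ vertexComponent_surjective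

/-- Each component of the frontier has at least three vertices: a vertex and its two
neighbours. -/
lemma three_mul_card_le :
    3 * Nat.card (ConnectedComponents (frontier P.carrier)) ≤ P.vertices.card := by
  classical
  have : Fintype (ConnectedComponents (frontier P.carrier)) := Fintype.ofFinite _
  have h3 : ∀ C ∈ (Finset.univ : Finset (ConnectedComponents (frontier P.carrier))),
      3 ≤ (Finset.univ.filter fun v => P.vertexComponent v = C).card := by
    intro C _
    obtain ⟨v, rfl⟩ := vertexComponent_surjective C
    obtain ⟨a, b, hne, hab⟩ := ncard_eq_two.1 (P.ncard_neighborSet v.1 v.2)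
    have ha : P.edges.Adj v.1 a := by
      have : a ∈ P.edges.neighborSet v.1 := by rw [hab]; simp
      exact this
    have hb : P.edges.Adj v.1 b := by
      have : b ∈ P.edges.neighborSet v.1 := by rw [hab]; simp
      exact this
    let a' : P.vertices := ⟨a, P.mem_vertices_of_adj _ _ ha.symm⟩
    let b' : P.vertices := ⟨b, P.mem_vertices_of_adj _ _ hb.symm⟩
    have hcard : ({v, a', b'} : Finset P.vertices).card = 3 := by
      rw [Finset.card_eq_three]
      exact ⟨v, a', b', fun h => ha.ne (congrArg Subtype.val h),
        fun h => hb.ne (congrArg Subtype.val h), fun h => hne (congrArg Subtype.val h), rfl⟩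
    rw [← hcard]
    refine Finset.card_le_card fun w hw => ?_
    simp only [Finset.mem_insert, Finset.mem_singleton] at hw
    rw [Finset.mem_filter]
    refine ⟨Finset.mem_univ _, ?_⟩
    rcases hw with rfl | rfl | rfl
    · rfl
    · exact (vertexComponent_eq_of_adj (w := a') ha).symm
    · exact (vertexComponent_eq_of_adj (w := b') hb).symm
  have h := Finset.card_nsmul_le_sum _ _ 3 h3
  rw [← Finset.card_eq_sum_card_fiberwise (s := Finset.univ) (f := P.vertexComponent)
    fun v _ => Finset.mem_coe.2 (Finset.mem_univ _)] at h
  simp only [smul_eq_mul, Finset.card_univ, Fintype.card_coe] at h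
  rw [Nat.card_eq_fintype_card]
  omega

/-- In general position distinct vertices lie on distinct fibers. -/
lemma ncard_reebVertices (hP : P.InGeneralPosition) : P.reebVertices.ncard = P.vertices.card := by
  have hmem : ∀ v : P.vertices, v.1 ∈ P.carrier := fun v =>
    P.isCompact_carrier.isClosed.frontier_subset (vertex_mem_frontier v.2)
  have hr : P.reebVertices = range fun v : P.vertices =>
      Quotient.mk P.fiberSetoid ⟨v.1, hmem v⟩ := by
    ext q
    constructor
    · rintro ⟨x, hx, rfl⟩
      exact ⟨⟨x.1, hx⟩, rfl⟩
    · rintro ⟨v, rfl⟩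
      exact ⟨⟨v.1, hmem v⟩, v.2, rfl⟩
  have hinj : Function.Injective fun v : P.vertices =>
      Quotient.mk P.fiberSetoid ⟨v.1, hmem v⟩ := by
    intro v w h
    by_contra hne
    have := ((fiber_eq_iff _ _).1 (Quotient.exact h)).1
    exact hP v.1 v.2 w.1 w.2 (fun h => hne (Subtype.ext h)) this
  rw [hr, ← image_univ, ncard_image_of_injective _ hinj, ncard_univ]
  simp

/-- The Reeb graph is homotopy equivalent to a bouquet of fewer circles than there are frontier
components. -/
theorem exists_homotopyEquiv_bouquet (hP : P.InGeneralPosition) (hne : P.carrier.Nonempty)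
    (hconn : PreconnectedSpace P.ReebGraph) :
    ∃ b, b + 1 ≤ Nat.card (ConnectedComponents (frontier P.carrier)) ∧
      Nonempty (ContinuousMap.HomotopyEquiv P.ReebGraph (Bouquet b)) := by
  suffices key : ∀ r : Setoid P.carrier, r = (P.toSweep hP).reeb → PreconnectedSpace (Quotient r) →
      ∃ b, b + 1 ≤ Nat.card (ConnectedComponents (frontier P.carrier)) ∧
        Nonempty (ContinuousMap.HomotopyEquiv (Quotient r) (Bouquet b)) from
    key _ (fiberSetoid_eq_reeb hP) hconn
  rintro _ rfl hconn
  obtain ⟨φ⟩ := SweepRegion.nonempty_homeomorph (S := P.toSweep hP)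
  obtain ⟨p, hp⟩ := hne
  obtain ⟨e, he, -⟩ := SweepRegion.exists_left_end (S := P.toSweep hP) hp
  have : Nonempty P.UpEdge := ⟨e⟩
  have hfin : Finite (ConnectedComponents (frontier (P.toSweep hP).L)) :=
    inferInstanceAs (Finite (ConnectedComponents (frontier P.carrier)))
  have hcard := SweepRegion.card_leftPiece_add_two_le (S := P.toSweep hP)
  have : Nonempty (P.toSweep hP).LevelFiber :=
    ⟨⟨Quotient.mk _ ⟨_, SweepRegion.mem_L (left_mem_Icc.2 ((P.toSweep hP).lo_lt_hi e).le)⟩,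
      _, rfl, Or.inl ⟨e, rfl⟩⟩⟩
  have hpos : 0 < Nat.card (P.toSweep hP).LevelFiber := Nat.card_pos
  have : PreconnectedSpace (GraphReal (SweepRegion.botFiber (S := P.toSweep hP))
      SweepRegion.topFiber) :=
    @ContinuousMap.HomotopyEquiv.preconnectedSpace _ _ _ _ φ.symm.toHomotopyEquiv hconn
  obtain ⟨b, hb, ⟨f⟩⟩ := GraphReal.exists_homotopyEquiv_bouquet
    (Nat.card (P.toSweep hP).LevelFiber - 1) (SweepRegion.botFiber (S := P.toSweep hP))
    SweepRegion.topFiber (by omega)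
  refine ⟨b, ?_, ⟨φ.symm.toHomotopyEquiv.trans f⟩⟩
  have : Nat.card (ConnectedComponents (frontier P.carrier)) =
    Nat.card (ConnectedComponents (frontier (P.toSweep hP).L)) := rfl
  omega

end PlanarPolygon

/-! ### Triangles with a vertical side -/

/-- A triangle with a vertical side from `(x₀, lo)` to `(x₀, hi)` and the third corner `(x₁, mid)`
on the right of this side. -/
structure SideTriangle where
  /-- the abscissa of the vertical side -/
  x₀ : ℝ
  /-- the abscissa of the third corner -/
  x₁ : ℝ
  /-- the height of the lowest corner -/
  lo : ℝ
  /-- the height of the third corner -/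
  mid : ℝ
  /-- the height of the highest corner -/
  hi : ℝ
  x_lt : x₀ < x₁
  lo_lt : lo < mid
  lt_hi : mid < hi

namespace SideTriangle

variable (T : SideTriangle)

/-- The corners of the triangle, ordered by height. -/
def corner : Fin 3 → ℝ × ℝ := ![(T.x₀, T.lo), (T.x₁, T.mid), (T.x₀, T.hi)]

/-- The barycentric coordinates with respect to the corners. -/
noncomputable def bary : Fin 3 → ℝ × ℝ → ℝ :=
  ![fun p => (T.hi - p.2 - (p.1 - T.x₀) / (T.x₁ - T.x₀) * (T.hi - T.mid)) / (T.hi - T.lo),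
    fun p => (p.1 - T.x₀) / (T.x₁ - T.x₀),
    fun p => (p.2 - T.lo - (p.1 - T.x₀) / (T.x₁ - T.x₀) * (T.mid - T.lo)) / (T.hi - T.lo)]

/-- The triangle as a set. -/
def hull : Set (ℝ × ℝ) := convexHull ℝ (range T.corner)

lemma width_pos : 0 < T.x₁ - T.x₀ := sub_pos.2 T.x_lt

lemma height_pos : 0 < T.hi - T.lo := sub_pos.2 (T.lo_lt.trans T.lt_hi)

lemma bary_corner (i j : Fin 3) : T.bary i (T.corner j) = if i = j then 1 else 0 := by
  have h1 := T.width_pos.ne'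
  have h2 := T.height_pos.ne'
  fin_cases i <;> fin_cases j <;> simp [bary, corner, h1, h2]

lemma sum_bary (p : ℝ × ℝ) : ∑ i, T.bary i p = 1 := by
  have h1 := T.width_pos.ne'
  have h2 := T.height_pos.ne'
  simp only [Fin.sum_univ_three, bary, Matrix.cons_val]
  field_simp
  ring

lemma sum_bary_smul (p : ℝ × ℝ) : ∑ i, T.bary i p • T.corner i = p := by
  have h1 := T.width_pos.ne'
  have h2 := T.height_pos.ne'
  ext
  · simp only [Fin.sum_univ_three, bary, corner, Matrix.cons_val, Prod.fst_add, Prod.smul_fst,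
      smul_eq_mul]
    field_simp
    ring
  · simp only [Fin.sum_univ_three, bary, corner, Matrix.cons_val, Prod.snd_add, Prod.smul_snd,
      smul_eq_mul]
    field_simp
    ring

lemma bary_comb (i : Fin 3) (p q : ℝ × ℝ) {a b : ℝ} (h : a + b = 1) :
    T.bary i (a • p + b • q) = a * T.bary i p + b * T.bary i q := by
  have h1 := T.width_pos.ne'
  have h2 := T.height_pos.ne'
  obtain rfl : b = 1 - a := by linarith
  fin_cases i <;> simp [bary] <;> field_simp <;> ring

lemma continuous_bary (i : Fin 3) : Continuous (T.bary i) := by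
  fin_cases i <;> simp only [bary, Fin.zero_eta, Fin.mk_one, Fin.reduceFinMk, Matrix.cons_val] <;>
    fun_prop

lemma mem_hull_iff {p : ℝ × ℝ} : p ∈ T.hull ↔ ∀ i, 0 ≤ T.bary i p := by
  constructor
  · intro hp i
    have hconv : Convex ℝ {q | 0 ≤ T.bary i q} := by
      intro q hq r hr a b ha hb hab
      simp only [mem_ofPred_eq] at hq hr ⊢
      rw [T.bary_comb i _ _ hab]
      positivity
    refine convexHull_min ?_ hconv hp
    rintro - ⟨j, rfl⟩
    simp only [mem_ofPred_eq, bary_corner]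
    split_ifs <;> norm_num
  · intro h
    rw [← T.sum_bary_smul p]
    exact (convex_convexHull ℝ _).sum_mem (fun i _ => h i) (T.sum_bary p)
      fun i _ => subset_convexHull ℝ _ (mem_range_self i)

lemma corner_mem_hull (i : Fin 3) : T.corner i ∈ T.hull :=
  subset_convexHull ℝ _ (mem_range_self i)

lemma isCompact_hull : IsCompact T.hull := (finite_range _).isCompact_convexHull ℝ

lemma mem_interior_iff {p : ℝ × ℝ} : p ∈ interior T.hull ↔ ∀ i, 0 < T.bary i p := by
  constructor
  · intro hp i
    -- moving away from the corner `i` decreases the coordinate `i`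
    have hc : Tendsto (fun t : ℝ => (1 + t) • p + (-t) • T.corner i) (𝓝[>] 0) (𝓝 p) := by
      have : Continuous fun t : ℝ => (1 + t) • p + (-t) • T.corner i := by fun_prop
      simpa using (this.tendsto 0).mono_left nhdsWithin_le_nhds
    obtain ⟨t, ht, ht0⟩ := ((hc.eventually (mem_interior_iff_mem_nhds.1 hp)).and
      self_mem_nhdsWithin).exists
    have ht0 : 0 < t := ht0
    have := T.mem_hull_iff.1 ht i
    rw [T.bary_comb i _ _ (by ring), bary_corner, if_pos rfl] at this
    nlinarith
  · intro h
    have ho : IsOpen {q | ∀ i, 0 < T.bary i q} := by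
      simp only [ofPred_forall]
      exact isOpen_iInter_of_finite fun i => isOpen_lt continuous_const (T.continuous_bary i)
    exact interior_maximal (fun q hq => T.mem_hull_iff.2 fun i => (hq i).le) ho h

lemma bary_eq_zero_of_mem_segment {p : ℝ × ℝ} {i j k : Fin 3} (hi : k ≠ i) (hj : k ≠ j)
    (hp : p ∈ segment ℝ (T.corner i) (T.corner j)) : T.bary k p = 0 := by
  obtain ⟨a, b, -, -, hab, rfl⟩ := hp
  rw [T.bary_comb k _ _ hab, bary_corner, bary_corner, if_neg hi, if_neg hj]
  ring

lemma mem_frontier_iff {p : ℝ × ℝ} :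
    p ∈ frontier T.hull ↔ ∃ i j, i ≠ j ∧ p ∈ segment ℝ (T.corner i) (T.corner j) := by
  rw [T.isCompact_hull.isClosed.frontier_eq, Set.mem_sdiff, mem_interior_iff]
  constructor
  · rintro ⟨h1, h2⟩
    push Not at h2
    obtain ⟨k, hk⟩ := h2
    have hk0 : T.bary k p = 0 := le_antisymm hk (T.mem_hull_iff.1 h1 k)
    obtain ⟨i, j, hij, huniv⟩ : ∃ i j : Fin 3, i ≠ j ∧ ∀ f : Fin 3 → ℝ, f k = 0 →
        ∑ l, f l = f i + f j := by
      fin_cases k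
      · exact ⟨1, 2, by decide, fun f h => by simp_all [Fin.sum_univ_three]⟩
      · exact ⟨0, 2, by decide, fun f h => by simp_all [Fin.sum_univ_three]⟩
      · exact ⟨0, 1, by decide, fun f h => by simp_all [Fin.sum_univ_three]⟩
    refine ⟨i, j, hij, T.bary i p, T.bary j p, T.mem_hull_iff.1 h1 i, T.mem_hull_iff.1 h1 j, ?_, ?_⟩
    · rw [← huniv (fun l => T.bary l p) hk0, sum_bary]
    · conv_rhs => rw [← T.sum_bary_smul p]
      ext
      · rw [Prod.fst_sum, huniv (fun l => (T.bary l p • T.corner l).1) (by simp [hk0])]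
        rfl
      · rw [Prod.snd_sum, huniv (fun l => (T.bary l p • T.corner l).2) (by simp [hk0])]
        rfl
  · rintro ⟨i, j, hij, hp⟩
    refine ⟨(convex_convexHull ℝ _).segment_subset (T.corner_mem_hull i) (T.corner_mem_hull j) hp,
      fun h => ?_⟩
    have hthird : ∀ i j : Fin 3, ∃ k : Fin 3, k ≠ i ∧ k ≠ j := by decide
    obtain ⟨k, hk⟩ := hthird i j
    exact (h k).ne' (T.bary_eq_zero_of_mem_segment hk.1 hk.2 hp)

lemma affineIndependent_corner : AffineIndependent ℝ T.corner := by
  rw [affineIndependent_iff_of_fintype]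
  intro w hw h
  rw [Finset.univ.weightedVSub_eq_linear_combination hw] at h
  have h1 := congrArg Prod.fst h
  have h2 := congrArg Prod.snd h
  simp only [Fin.sum_univ_three, corner, Matrix.cons_val, Prod.fst_add, Prod.smul_fst,
    Prod.snd_add, Prod.smul_snd, smul_eq_mul, Prod.fst_zero, Prod.snd_zero] at h1 h2 hw
  have e1 : w 1 * (T.x₁ - T.x₀) = 0 := by linear_combination h1 - T.x₀ * hw
  have e1' : w 1 = 0 := (mul_eq_zero.1 e1).resolve_right T.width_pos.ne'
  have e2 : w 2 * (T.hi - T.lo) = 0 := by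
    linear_combination h2 - T.lo * hw - (T.mid - T.lo) * e1'
  have e2' : w 2 = 0 := (mul_eq_zero.1 e2).resolve_right T.height_pos.ne'
  have e0' : w 0 = 0 := by linarith
  intro i
  fin_cases i <;> assumption

lemma interior_hull_nonempty : (interior T.hull).Nonempty := by
  refine ⟨∑ j, (1 / 3 : ℝ) • T.corner j, ?_⟩
  rw [mem_interior_iff]
  have h1 := T.width_pos
  have h2 := T.height_pos
  intro i
  have : T.bary i (∑ j, (1 / 3 : ℝ) • T.corner j) = 1 / 3 := by
    fin_cases i <;> simp [bary, corner, Fin.sum_univ_three] <;> field_simp <;> ring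
  rw [this]
  norm_num

lemma closure_interior_hull : closure (interior T.hull) = T.hull := by
  have := (convex_convexHull ℝ (range T.corner)).closure_interior_eq_closure_of_nonempty_interior
    T.interior_hull_nonempty
  rw [hull, this]
  exact T.isCompact_hull.isClosed.closure_eq

/-- Two distinct sides of a triangle meet in a common corner. -/
lemma segment_inter_segment {i j k l : Fin 3} (hij : i ≠ j) (hkl : k ≠ l)
    (h : s(i, j) ≠ s(k, l)) :
    segment ℝ (T.corner i) (T.corner j) ∩ segment ℝ (T.corner k) (T.corner l) ⊆
      {T.corner i, T.corner j} ∩ {T.corner k, T.corner l} := by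
  rintro p ⟨hp, hp'⟩
  obtain ⟨u, h1, h2, h3⟩ : ∃ u : Fin 3, (u = i ∨ u = j) ∧ (u = k ∨ u = l) ∧
      ∀ r, r ≠ u → (r ≠ i ∧ r ≠ j) ∨ (r ≠ k ∧ r ≠ l) := by
    clear hp hp'
    revert i j k l; decide
  have hzero : ∀ r, r ≠ u → T.bary r p = 0 := fun r hr => by
    rcases h3 r hr with h | h
    · exact T.bary_eq_zero_of_mem_segment h.1 h.2 hp
    · exact T.bary_eq_zero_of_mem_segment h.1 h.2 hp'
  have hone : T.bary u p = 1 := by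
    rw [← T.sum_bary p, Finset.sum_eq_single u (fun r _ hr => hzero r hr) (by simp)]
  have hpu : p = T.corner u := by
    conv_lhs => rw [← T.sum_bary_smul p]
    rw [Finset.sum_eq_single u (fun r _ hr => by rw [hzero r hr, zero_smul]) (by simp), hone,
      one_smul]
  rw [hpu]
  constructor
  · rcases h1 with rfl | rfl <;> simp
  · rcases h2 with rfl | rfl <;> simp

lemma bary_zero_eq (p : ℝ × ℝ) : T.bary 0 p =
    ((T.hi - p.2) * (T.x₁ - T.x₀) - (T.hi - T.mid) * (p.1 - T.x₀)) / (T.x₁ - T.x₀) /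
      (T.hi - T.lo) := by
  have h1 := T.width_pos.ne'
  simp only [bary, Matrix.cons_val]
  congr 1
  field_simp

lemma bary_two_eq (p : ℝ × ℝ) : T.bary 2 p =
    ((p.2 - T.lo) * (T.x₁ - T.x₀) - (T.mid - T.lo) * (p.1 - T.x₀)) / (T.x₁ - T.x₀) /
      (T.hi - T.lo) := by
  have h1 := T.width_pos.ne'
  simp only [bary, Matrix.cons_val]
  congr 1
  field_simp

lemma mem_hull_iff_ineq {p : ℝ × ℝ} : p ∈ T.hull ↔ T.x₀ ≤ p.1 ∧
    (T.mid - T.lo) * (p.1 - T.x₀) ≤ (p.2 - T.lo) * (T.x₁ - T.x₀) ∧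
    (T.hi - T.mid) * (p.1 - T.x₀) ≤ (T.hi - p.2) * (T.x₁ - T.x₀) := by
  rw [mem_hull_iff, Fin.forall_fin_succ, Fin.forall_fin_two]
  simp only [Fin.succ_zero_eq_one, Fin.succ_one_eq_two, bary_zero_eq, bary_two_eq,
    le_div_iff₀ T.height_pos, le_div_iff₀ T.width_pos, zero_mul]
  simp only [bary, Matrix.cons_val, le_div_iff₀ T.width_pos, zero_mul, sub_nonneg]
  tauto

lemma mem_interior_iff_ineq {p : ℝ × ℝ} : p ∈ interior T.hull ↔ T.x₀ < p.1 ∧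
    (T.mid - T.lo) * (p.1 - T.x₀) < (p.2 - T.lo) * (T.x₁ - T.x₀) ∧
    (T.hi - T.mid) * (p.1 - T.x₀) < (T.hi - p.2) * (T.x₁ - T.x₀) := by
  rw [mem_interior_iff, Fin.forall_fin_succ, Fin.forall_fin_two]
  simp only [Fin.succ_zero_eq_one, Fin.succ_one_eq_two, bary_zero_eq, bary_two_eq,
    div_pos_iff_of_pos_right T.height_pos, div_pos_iff_of_pos_right T.width_pos]
  simp only [bary, Matrix.cons_val, div_pos_iff_of_pos_right T.width_pos, sub_pos]
  tauto

end SideTriangle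

/-! ### Triangles with triangular holes -/

/-- A triangle (with index `none`) together with `m` pairwise disjoint triangles in its interior,
all corners having different heights. -/
structure TriangleWithHoles (m : ℕ) where
  /-- the outer triangle and the holes -/
  T : Option (Fin m) → SideTriangle
  hull_subset : ∀ i, (T (some i)).hull ⊆ interior (T none).hull
  disjoint_hull : ∀ i j, i ≠ j → Disjoint (T (some i)).hull (T (some j)).hull
  height_injective : Function.Injective fun k : Option (Fin m) × Fin 3 => ((T k.1).corner k.2).2

namespace TriangleWithHoles

variable {m : ℕ} (D : TriangleWithHoles m)

/-- The outer triangle without the interiors of the holes. -/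
def carrier : Set (ℝ × ℝ) := (D.T none).hull \ ⋃ i, interior (D.T (some i)).hull

/-- The sides of the triangles, as an adjacency relation between corners. -/
def sides : SimpleGraph (ℝ × ℝ) where
  Adj v w := v ≠ w ∧ ∃ k, v ∈ range (D.T k).corner ∧ w ∈ range (D.T k).corner
  symm := ⟨fun _ _ h => ⟨h.1.symm, h.2.imp fun _ hk => ⟨hk.2, hk.1⟩⟩⟩
  loopless := ⟨fun _ h => h.1 rfl⟩

lemma corner_injective :
    Function.Injective fun k : Option (Fin m) × Fin 3 => (D.T k.1).corner k.2 :=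
  fun _ _ h => D.height_injective (congrArg Prod.snd h)

lemma corner_inj {k l : Option (Fin m)} {i j : Fin 3}
    (h : (D.T k).corner i = (D.T l).corner j) : k = l ∧ i = j := by
  have := @corner_injective _ D (k, i) (l, j) h
  simpa using this

lemma sides_adj_iff {v w : ℝ × ℝ} : D.sides.Adj v w ↔
    ∃ k i j, i ≠ j ∧ v = (D.T k).corner i ∧ w = (D.T k).corner j := by
  constructor
  · rintro ⟨hne, k, ⟨i, rfl⟩, ⟨j, rfl⟩⟩
    exact ⟨k, i, j, fun h => hne (by rw [h]), rfl, rfl⟩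
  · rintro ⟨k, i, j, hij, rfl, rfl⟩
    exact ⟨fun h => hij (D.corner_inj h).2, k, ⟨i, rfl⟩, ⟨j, rfl⟩⟩

lemma isClosed_hull (k : Option (Fin m)) : IsClosed (D.T k).hull := (D.T k).isCompact_hull.isClosed

lemma frontier_subset_hull (k : Option (Fin m)) : frontier (D.T k).hull ⊆ (D.T k).hull :=
  (D.isClosed_hull k).frontier_subset

lemma disjoint_frontier {k l : Option (Fin m)} (h : k ≠ l) :
    Disjoint (frontier (D.T k).hull) (frontier (D.T l).hull) := by
  have key : ∀ i, Disjoint (frontier (D.T none).hull) (frontier (D.T (some i)).hull) := fun i =>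
    disjoint_left.2 fun p hp hp' => hp.2 (D.hull_subset i (D.frontier_subset_hull _ hp'))
  rcases k with _ | i <;> rcases l with _ | j
  · exact absurd rfl h
  · exact key j
  · exact (key i).symm
  · exact (D.disjoint_hull i j fun hij => h (by rw [hij])).mono
      (D.frontier_subset_hull _) (D.frontier_subset_hull _)

lemma isCompact_carrier : IsCompact D.carrier :=
  (D.T none).isCompact_hull.diff (isOpen_iUnion fun _ => isOpen_interior)

lemma interior_carrier :
    interior D.carrier = interior (D.T none).hull \ ⋃ i, (D.T (some i)).hull := by
  rw [carrier, sdiff_eq, interior_inter, interior_compl, closure_iUnion_of_finite]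
  simp only [SideTriangle.closure_interior_hull]
  rfl

lemma closure_interior_carrier : closure (interior D.carrier) = D.carrier := by
  refine (closure_minimal interior_subset D.isCompact_carrier.isClosed).antisymm fun p hp => ?_
  rw [interior_carrier]
  have hpi : ∀ i, p ∉ interior (D.T (some i)).hull := fun i hi => hp.2 (mem_iUnion.2 ⟨i, hi⟩)
  by_cases h : ∃ i, p ∈ (D.T (some i)).hull
  · obtain ⟨i, hi⟩ := h
    -- near `p` only the hole `i` matters
    have hN : IsOpen (interior (D.T none).hull ∩ ⋂ j, ⋂ (_ : j ≠ i), (D.T (some j)).hullᶜ) :=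
      isOpen_interior.inter (isOpen_iInter_of_finite fun j => isOpen_iInter_of_finite fun _ =>
        (D.isClosed_hull _).isOpen_compl)
    have hpN : p ∈ interior (D.T none).hull ∩ ⋂ j, ⋂ (_ : j ≠ i), (D.T (some j)).hullᶜ :=
      ⟨D.hull_subset i hi, mem_iInter₂.2 fun j hj =>
        disjoint_left.1 (D.disjoint_hull i j (Ne.symm hj)) hi⟩
    have hcl : p ∈ closure ((D.T (some i)).hullᶜ) := by
      rw [closure_compl]
      exact hpi i
    refine closure_mono ?_ (hN.inter_closure ⟨hpN, hcl⟩)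
    rintro q ⟨⟨h1, h2⟩, h3⟩
    refine ⟨h1, fun h4 => ?_⟩
    obtain ⟨j, hj⟩ := mem_iUnion.1 h4
    by_cases hji : j = i
    · subst hji
      exact h3 hj
    · exact mem_iInter₂.1 h2 j hji hj
  · push Not at h
    have hN : IsOpen (⋂ j, (D.T (some j)).hullᶜ) :=
      isOpen_iInter_of_finite fun j => (D.isClosed_hull _).isOpen_compl
    have hcl : p ∈ closure (interior (D.T none).hull) := by
      rw [SideTriangle.closure_interior_hull]
      exact hp.1
    refine closure_mono ?_ (hN.inter_closure ⟨mem_iInter.2 h, hcl⟩)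
    rintro q ⟨h1, h2⟩
    exact ⟨h2, fun h4 => by
      obtain ⟨j, hj⟩ := mem_iUnion.1 h4
      exact mem_iInter.1 h1 j hj⟩

lemma mem_frontier_carrier {p : ℝ × ℝ} :
    p ∈ frontier D.carrier ↔ ∃ k, p ∈ frontier (D.T k).hull := by
  rw [D.isCompact_carrier.isClosed.frontier_eq, interior_carrier]
  constructor
  · rintro ⟨⟨h1, h2⟩, h3⟩
    by_cases h4 : p ∈ interior (D.T none).hull
    · have h5 : p ∈ ⋃ i, (D.T (some i)).hull := by
        by_contra h5
        exact h3 ⟨h4, h5⟩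
      obtain ⟨i, hi⟩ := mem_iUnion.1 h5
      exact ⟨some i, subset_closure hi, fun h => h2 (mem_iUnion.2 ⟨i, h⟩)⟩
    · exact ⟨none, subset_closure h1, h4⟩
  · rintro ⟨_ | i, hk⟩
    · refine ⟨⟨D.frontier_subset_hull _ hk, fun h => ?_⟩, fun h => hk.2 h.1⟩
      obtain ⟨i, hi⟩ := mem_iUnion.1 h
      exact hk.2 (D.hull_subset i (interior_subset hi))
    · have hi := D.frontier_subset_hull _ hk
      refine ⟨⟨interior_subset (D.hull_subset i hi), fun h => ?_⟩,
        fun h => h.2 (mem_iUnion.2 ⟨i, hi⟩)⟩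
      obtain ⟨j, hj⟩ := mem_iUnion.1 h
      by_cases hji : j = i
      · subst hji
        exact hk.2 hj
      · exact disjoint_left.1 (D.disjoint_hull i j (Ne.symm hji)) hi (interior_subset hj)

open Classical in
/-- The polygon obtained from a triangle by removing the interiors of triangular holes. -/
noncomputable def polygon : PlanarPolygon where
  carrier := D.carrier
  vertices := Finset.univ.image fun k : Option (Fin m) × Fin 3 => (D.T k.1).corner k.2
  edges := D.sides
  mem_vertices_of_adj v w h := by
    obtain ⟨k, i, j, -, rfl, -⟩ := D.sides_adj_iff.1 h
    exact Finset.mem_image.2 ⟨(k, i), Finset.mem_univ _, rfl⟩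
  ncard_neighborSet v hv := by
    obtain ⟨⟨k, i⟩, -, rfl⟩ := Finset.mem_image.1 hv
    have hset : D.sides.neighborSet ((D.T k).corner i) = (D.T k).corner '' {j | j ≠ i} := by
      ext w
      rw [SimpleGraph.mem_neighborSet, sides_adj_iff]
      constructor
      · rintro ⟨l, i', j, hij, h1, rfl⟩
        obtain ⟨rfl, rfl⟩ := D.corner_inj h1
        exact ⟨j, hij.symm, rfl⟩
      · rintro ⟨j, hj, rfl⟩
        exact ⟨k, i, j, Ne.symm hj, rfl, rfl⟩
    rw [hset, ncard_image_of_injective _ fun a b h => (D.corner_inj h).2]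
    have : {j : Fin 3 | j ≠ i} = ↑(Finset.univ.erase i) := by ext; simp
    rw [this, ncard_coe_finset]
    simp
  segment_inter_segment a b c d hab hcd hne := by
    obtain ⟨k, i, j, hij, rfl, rfl⟩ := D.sides_adj_iff.1 hab
    obtain ⟨l, i', j', hij', rfl, rfl⟩ := D.sides_adj_iff.1 hcd
    by_cases hkl : k = l
    · subst hkl
      refine (D.T k).segment_inter_segment hij hij' fun h => hne ?_
      simpa using congrArg (Sym2.map (D.T k).corner) h
    · rintro p ⟨h1, h2⟩
      exact absurd ((D.T l).mem_frontier_iff.2 ⟨_, _, hij', h2⟩)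
        (disjoint_left.1 (D.disjoint_frontier hkl) ((D.T k).mem_frontier_iff.2 ⟨_, _, hij, h1⟩))
  isCompact_carrier := D.isCompact_carrier
  closure_interior_carrier := D.closure_interior_carrier
  frontier_carrier := by
    ext p
    rw [mem_frontier_carrier]
    constructor
    · rintro ⟨k, hk⟩
      obtain ⟨i, j, hij, hp⟩ := (D.T k).mem_frontier_iff.1 hk
      exact ⟨_, _, D.sides_adj_iff.2 ⟨k, i, j, hij, rfl, rfl⟩, hp⟩
    · rintro ⟨a, b, hab, hp⟩
      obtain ⟨k, i, j, hij, rfl, rfl⟩ := D.sides_adj_iff.1 hab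
      exact ⟨k, (D.T k).mem_frontier_iff.2 ⟨i, j, hij, hp⟩⟩

lemma mem_vertices_polygon {v : ℝ × ℝ} :
    v ∈ D.polygon.vertices ↔ ∃ k i, (D.T k).corner i = v := by
  unfold polygon
  simp

lemma inGeneralPosition_polygon : D.polygon.InGeneralPosition := by
  intro v hv w hw hne h
  obtain ⟨k, i, rfl⟩ := D.mem_vertices_polygon.1 hv
  obtain ⟨l, j, rfl⟩ := D.mem_vertices_polygon.1 hw
  have := @height_injective _ D (k, i) (l, j) h
  simp only [Prod.mk.injEq] at this
  exact hne (by rw [this.1, this.2])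

lemma card_vertices_polygon : D.polygon.vertices.card = 3 * (m + 1) := by
  classical
  have : D.polygon.vertices =
      Finset.univ.image fun k : Option (Fin m) × Fin 3 => (D.T k.1).corner k.2 := by
    ext v
    rw [mem_vertices_polygon]
    simp
  rw [this, Finset.card_image_of_injective _ D.corner_injective]
  simp [mul_comm]

lemma isTriangleWithTriangularHoles_polygon : D.polygon.IsTriangleWithTriangularHoles m := by
  refine ⟨⟨(D.T none).corner, (D.T none).affineIndependent_corner⟩,
    fun i => ⟨(D.T (some i)).corner, (D.T (some i)).affineIndependent_corner⟩,
    D.hull_subset, D.disjoint_hull, rfl, ?_⟩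
  ext v
  rw [Finset.mem_coe, mem_vertices_polygon]
  constructor
  · rintro ⟨_ | k, i, rfl⟩
    · exact Or.inl ⟨i, rfl⟩
    · exact Or.inr (mem_iUnion.2 ⟨k, i, rfl⟩)
  · rintro (⟨i, rfl⟩ | h)
    · exact ⟨none, i, rfl⟩
    · obtain ⟨k, i, rfl⟩ := mem_iUnion.1 h
      exact ⟨some k, i, rfl⟩

/-- The boundaries of the triangles are the components of the frontier. -/
lemma card_components_polygon :
    Nat.card (ConnectedComponents (frontier D.polygon.carrier)) = m + 1 := by
  have hfr : ∀ p : frontier D.polygon.carrier, ∃ k, p.1 ∈ frontier (D.T k).hull := fun p =>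
    D.mem_frontier_carrier.1 p.2
  choose κ hκ using hfr
  have huniq : ∀ p k, p.1 ∈ frontier (D.T k).hull → κ p = k := fun p k hk => by
    by_contra h
    exact disjoint_left.1 (D.disjoint_frontier h) (hκ p) hk
  have hloc : IsLocallyConstant κ := fun A => by
    rw [← isClosed_compl_iff, ← preimage_compl]
    have : κ ⁻¹' Aᶜ = ⋃ k ∈ Aᶜ, (↑) ⁻¹' frontier (D.T k).hull := by
      ext p
      simp only [mem_preimage, mem_iUnion, exists_prop]
      constructor
      · exact fun h => ⟨κ p, h, hκ p⟩
      · rintro ⟨k, h1, h2⟩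
        rwa [huniq p k h2]
    rw [this]
    exact (toFinite _).isClosed_biUnion fun k _ => isClosed_frontier.preimage continuous_subtype_val
  have hv : ∀ k i, (D.T k).corner i ∈ D.polygon.vertices := fun k i =>
    D.mem_vertices_polygon.2 ⟨k, i, rfl⟩
  have hcorner : ∀ k i, (D.T k).corner i ∈ frontier (D.T k).hull := fun k i =>
    (D.T k).mem_frontier_iff.2 ⟨i, i + 1, by revert i; decide, left_mem_segment ℝ _ _⟩
  have hbij : Function.Bijective fun k : Option (Fin m) =>
      D.polygon.vertexComponent ⟨(D.T k).corner 0, hv k 0⟩ := by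
    constructor
    · intro k l h
      have h1 := ConnectedComponents.coe_eq_coe.1 h
      have := hloc.apply_eq_of_isPreconnected isPreconnected_connectedComponent
        mem_connectedComponent (h1 ▸ mem_connectedComponent)
      rw [huniq _ l (hcorner l 0), huniq _ k (hcorner k 0)] at this
      exact this.symm
    · intro C
      obtain ⟨⟨v, hvm⟩, rfl⟩ := PlanarPolygon.vertexComponent_surjective C
      obtain ⟨k, i, rfl⟩ := D.mem_vertices_polygon.1 hvm
      refine ⟨k, ?_⟩
      by_cases hi : (0 : Fin 3) = i
      · subst hi
        rfl
      · exact PlanarPolygon.vertexComponent_eq_of_adj (P := D.polygon)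
          (D.sides_adj_iff.2 ⟨k, 0, i, hi, rfl, rfl⟩)
  rw [← Nat.card_eq_of_bijective _ hbij]
  simp

end TriangleWithHoles

/-! ### A triangle with holes stacked above each other -/

/-- The triangles of the stacked example: the hole with index `i` occupies the heights
`[3 * i, 3 * i + 2]` and has its vertical side on the line `x = 0`. -/
def stackedTriangle (m : ℕ) : Option (Fin m) → SideTriangle
  | none => ⟨-1, 3, -2, -1, 6 * m + 3, by norm_num, by norm_num, by
      have : (0 : ℝ) ≤ m := Nat.cast_nonneg m
      linarith⟩
  | some i => ⟨0, 1, 3 * (i : ℕ), 3 * (i : ℕ) + 1, 3 * (i : ℕ) + 2, by norm_num, by norm_num,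
      by norm_num⟩

namespace Stacked

variable {m : ℕ}

lemma mem_outer {p : ℝ × ℝ} : p ∈ (stackedTriangle m none).hull ↔
    -1 ≤ p.1 ∧ p.1 + 1 ≤ 4 * (p.2 + 2) ∧ (6 * m + 4) * (p.1 + 1) ≤ 4 * (6 * m + 3 - p.2) := by
  rw [SideTriangle.mem_hull_iff_ineq]
  simp only [stackedTriangle]
  refine and_congr Iff.rfl (and_congr ?_ ?_) <;> constructor <;> intro h <;> linarith

lemma mem_interior_outer {p : ℝ × ℝ} : p ∈ interior (stackedTriangle m none).hull ↔
    -1 < p.1 ∧ p.1 + 1 < 4 * (p.2 + 2) ∧ (6 * m + 4) * (p.1 + 1) < 4 * (6 * m + 3 - p.2) := by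
  rw [SideTriangle.mem_interior_iff_ineq]
  simp only [stackedTriangle]
  refine and_congr Iff.rfl (and_congr ?_ ?_) <;> constructor <;> intro h <;> linarith

lemma mem_hole {i : Fin m} {p : ℝ × ℝ} : p ∈ (stackedTriangle m (some i)).hull ↔
    0 ≤ p.1 ∧ p.1 ≤ p.2 - 3 * (i : ℕ) ∧ p.1 ≤ 3 * (i : ℕ) + 2 - p.2 := by
  rw [SideTriangle.mem_hull_iff_ineq]
  simp only [stackedTriangle]
  refine and_congr Iff.rfl (and_congr ?_ ?_) <;> constructor <;> intro h <;> linarith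

lemma mem_interior_hole {i : Fin m} {p : ℝ × ℝ} : p ∈ interior (stackedTriangle m (some i)).hull ↔
    0 < p.1 ∧ p.1 < p.2 - 3 * (i : ℕ) ∧ p.1 < 3 * (i : ℕ) + 2 - p.2 := by
  rw [SideTriangle.mem_interior_iff_ineq]
  simp only [stackedTriangle]
  refine and_congr Iff.rfl (and_congr ?_ ?_) <;> constructor <;> intro h <;> linarith

lemma cast_index_le (i : Fin m) : ((i : ℕ) : ℝ) + 1 ≤ m := by exact_mod_cast i.2

lemma hull_subset (i : Fin m) : (stackedTriangle m (some i)).hull ⊆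
    interior (stackedTriangle m none).hull := by
  intro p hp
  rw [mem_hole] at hp
  rw [mem_interior_outer]
  obtain ⟨h1, h2, h3⟩ := hp
  have hi := cast_index_le i
  have hi0 : (0 : ℝ) ≤ (i : ℕ) := Nat.cast_nonneg _
  refine ⟨by linarith, by linarith, ?_⟩
  have h4 : p.1 ≤ 1 := by linarith
  nlinarith

lemma disjoint_hull (i j : Fin m) (h : i ≠ j) :
    Disjoint (stackedTriangle m (some i)).hull (stackedTriangle m (some j)).hull := by
  refine disjoint_left.2 fun p hp hq => ?_
  rw [mem_hole] at hp hq
  rcases lt_or_gt_of_ne (Fin.val_ne_of_ne h) with h | h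
  · have : ((i : ℕ) : ℝ) + 1 ≤ (j : ℕ) := by exact_mod_cast h
    linarith [hp.1, hp.2.2, hq.2.1]
  · have : ((j : ℕ) : ℝ) + 1 ≤ (i : ℕ) := by exact_mod_cast h
    linarith [hp.1, hp.2.1, hq.2.2]

/-- The heights of the corners, as integers. -/
def cornerHeight (m : ℕ) : Option (Fin m) → Fin 3 → ℤ
  | none => ![-2, -1, 6 * m + 3]
  | some i => fun j => 3 * (i : ℕ) + (j : ℕ)

lemma corner_snd (k : Option (Fin m)) (j : Fin 3) :
    ((stackedTriangle m k).corner j).2 = (cornerHeight m k j : ℝ) := by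
  rcases k with _ | i <;> fin_cases j <;> simp [stackedTriangle, SideTriangle.corner, cornerHeight]

lemma cornerHeight_injective :
    Function.Injective fun k : Option (Fin m) × Fin 3 => cornerHeight m k.1 k.2 := by
  rintro ⟨_ | i, a⟩ ⟨_ | j, b⟩ h
  · fin_cases a <;> fin_cases b <;> simp [cornerHeight] at h ⊢ <;> omega
  · have := j.2
    fin_cases a <;> simp [cornerHeight] at h <;> omega
  · have := i.2
    fin_cases b <;> simp [cornerHeight] at h <;> omega
  · simp only [cornerHeight] at h
    have := a.2
    have := b.2
    have h1 : i = j := Fin.ext (by omega)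
    have h2 : a = b := Fin.ext (by omega)
    rw [h1, h2]

end Stacked

/-- A triangle with `m` triangular holes stacked above each other. -/
def stacked (m : ℕ) : TriangleWithHoles m where
  T := stackedTriangle m
  hull_subset := Stacked.hull_subset
  disjoint_hull := Stacked.disjoint_hull
  height_injective := fun k l h => Stacked.cornerHeight_injective (by
    simp only [Stacked.corner_snd] at h
    exact_mod_cast h)

namespace Stacked

variable {m : ℕ}

lemma mem_carrier {p : ℝ × ℝ} : p ∈ (stacked m).carrier ↔ p ∈ (stackedTriangle m none).hull ∧
    ∀ i : Fin m, ¬ (0 < p.1 ∧ p.1 < p.2 - 3 * (i : ℕ) ∧ p.1 < 3 * (i : ℕ) + 2 - p.2) := by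
  unfold TriangleWithHoles.carrier
  rw [Set.mem_sdiff, mem_iUnion, not_exists]
  exact and_congr Iff.rfl (forall_congr' fun i => not_congr mem_interior_hole)

lemma convex_outer : Convex ℝ (stackedTriangle m none).hull := convex_convexHull ℝ _

lemma isConnected_carrier : IsConnected (stacked m).carrier := by
  have hm : (0 : ℝ) ≤ m := Nat.cast_nonneg m
  set A := (stackedTriangle m none).hull with hA
  have hx1 : Convex ℝ {p : ℝ × ℝ | p.1 ≤ 0} :=
    (convex_Iic (𝕜 := ℝ) (0 : ℝ)).linear_preimage (LinearMap.fst ℝ ℝ ℝ)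
  have hx2 : Convex ℝ {p : ℝ × ℝ | 1 ≤ p.1} :=
    (convex_Ici (𝕜 := ℝ) (1 : ℝ)).linear_preimage (LinearMap.fst ℝ ℝ ℝ)
  have hy1 : Convex ℝ {p : ℝ × ℝ | p.2 ≤ 0} :=
    (convex_Iic (𝕜 := ℝ) (0 : ℝ)).linear_preimage (LinearMap.snd ℝ ℝ ℝ)
  have hy2 : Convex ℝ {p : ℝ × ℝ | 3 * m ≤ p.2} :=
    (convex_Ici (𝕜 := ℝ) (3 * m : ℝ)).linear_preimage (LinearMap.snd ℝ ℝ ℝ)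
  -- the parts of the triangle on the left, below, on the right of and above all the holes
  let B : Set (ℝ × ℝ) := (((A ∩ {p | p.1 ≤ 0}) ∪ (A ∩ {p | p.2 ≤ 0})) ∪
    (A ∩ {p | 1 ≤ p.1})) ∪ (A ∩ {p | 3 * m ≤ p.2})
  have hB : IsPreconnected B := by
    have c1 := ((convex_outer (m := m)).inter hx1).isPreconnected
    have c2 := ((convex_outer (m := m)).inter hy1).isPreconnected
    have c3 := ((convex_outer (m := m)).inter hx2).isPreconnected
    have c4 := ((convex_outer (m := m)).inter hy2).isPreconnected
    have o1 : ((0 : ℝ), (-1 / 2 : ℝ)) ∈ A := mem_outer.2 ⟨by norm_num, by norm_num, by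
      simp only; nlinarith⟩
    have o2 : ((1 : ℝ), (-1 / 2 : ℝ)) ∈ A := mem_outer.2 ⟨by norm_num, by norm_num, by
      simp only; nlinarith⟩
    have o3 : ((0 : ℝ), (3 * m : ℝ)) ∈ A := mem_outer.2 ⟨by norm_num, by
      simp only; linarith, by simp only; linarith⟩
    have d1 : IsPreconnected (A ∩ {p | p.1 ≤ 0} ∪ A ∩ {p | p.2 ≤ 0}) :=
      IsPreconnected.union (0, -1 / 2) ⟨o1, le_refl (0 : ℝ)⟩
        ⟨o1, show (-1 / 2 : ℝ) ≤ 0 by norm_num⟩ c1 c2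
    have d2 : IsPreconnected (A ∩ {p | p.1 ≤ 0} ∪ A ∩ {p | p.2 ≤ 0} ∪ A ∩ {p | 1 ≤ p.1}) :=
      IsPreconnected.union (1, -1 / 2) (Or.inr ⟨o2, show (-1 / 2 : ℝ) ≤ 0 by norm_num⟩)
        ⟨o2, le_refl (1 : ℝ)⟩ d1 c3
    change IsPreconnected
      (A ∩ {p | p.1 ≤ 0} ∪ A ∩ {p | p.2 ≤ 0} ∪ A ∩ {p | 1 ≤ p.1} ∪ A ∩ {p | 3 * m ≤ p.2})
    exact d2.union ((0 : ℝ), (3 * m : ℝ)) (Or.inl (Or.inl (mem_inter o3 (le_refl (0 : ℝ)))))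
      (mem_inter o3 (le_refl (3 * m : ℝ))) c4
  have hBsub : B ⊆ (stacked m).carrier := by
    intro p hp
    rw [mem_carrier]
    rcases hp with ((⟨h1, h2⟩ | ⟨h1, h2⟩) | ⟨h1, h2⟩) | ⟨h1, h2⟩ <;> refine ⟨h1, ?_⟩ <;>
      rintro i ⟨h3, h4, h5⟩ <;> simp only [mem_ofPred_eq] at h2 <;> have hi := cast_index_le i <;>
      have hi0 : (0 : ℝ) ≤ (i : ℕ) := Nat.cast_nonneg _
    · linarith
    · linarith
    · linarith
    · linarith
  have ho : ((0 : ℝ), (3 * m : ℝ)) ∈ B :=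
    Or.inr ⟨mem_outer.2 ⟨by norm_num, by simp only; linarith, by simp only; linarith⟩,
      le_refl (3 * m : ℝ)⟩
  refine ⟨⟨_, hBsub ho⟩, isPreconnected_of_forall (0, 3 * m) fun p hp => ?_⟩
  by_cases hpB : p ∈ B
  · exact ⟨B, hBsub, ho, hpB, hB⟩
  · have hp' := mem_carrier.1 hp
    have hp1 : 0 < p.1 := by
      by_contra! h
      exact hpB (Or.inl (Or.inl (Or.inl ⟨hp'.1, h⟩)))
    have hp2 : 0 < p.2 := by
      by_contra! h
      exact hpB (Or.inl (Or.inl (Or.inr ⟨hp'.1, h⟩)))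
    have hp3 : p.1 < 1 := by
      by_contra! h
      exact hpB (Or.inl (Or.inr ⟨hp'.1, h⟩))
    have hp4 : p.2 < 3 * m := by
      by_contra! h
      exact hpB (Or.inr ⟨hp'.1, h⟩)
    -- the horizontal segment from `p` to the right does not meet the holes
    have hq : ((1 : ℝ), p.2) ∈ A := mem_outer.2 ⟨by norm_num, by simp only; linarith, by
      simp only; nlinarith⟩
    refine ⟨B ∪ segment ℝ p (1, p.2), union_subset hBsub fun r hr => ?_, Or.inl ho,
      Or.inr (left_mem_segment ℝ _ _),
      hB.union (1, p.2) (Or.inl (Or.inr ⟨hq, le_refl (1 : ℝ)⟩)) (right_mem_segment ℝ _ _)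
        (convex_segment _ _).isPreconnected⟩
    refine mem_carrier.2 ⟨convex_outer.segment_subset hp'.1 hq hr, ?_⟩
    obtain ⟨a, b, ha, hb, hab, rfl⟩ := hr
    rintro i ⟨h1, h2, h3⟩
    simp only [Prod.fst_add, Prod.snd_add, Prod.smul_fst, Prod.smul_snd, smul_eq_mul] at h1 h2 h3
    have e1 : a * p.2 + b * p.2 = p.2 := by rw [← add_mul, hab, one_mul]
    have e2 : p.1 ≤ a * p.1 + b * 1 := by
      have : a * p.1 + b * p.1 = p.1 := by rw [← add_mul, hab, one_mul]
      nlinarith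
    exact hp'.2 i ⟨hp1, by linarith, by linarith⟩

open Classical in
/-- The map to the circle that winds once around the hole `i`: it is constant except on the left
of the hole. -/
noncomputable def angle (i : ℕ) (p : ℝ × ℝ) : Circle :=
  if p.1 ≤ 0 then Circle.exp (2 * Real.pi * max 0 (min ((p.2 - 3 * i) / 2) 1)) else 1

lemma exp_clamp_eq_one {r : ℝ} (h : r ≤ 0 ∨ 1 ≤ r) :
    Circle.exp (2 * Real.pi * max 0 (min r 1)) = 1 := by
  rcases h with h | h
  · rw [min_eq_left (h.trans zero_le_one), max_eq_left h, mul_zero, Circle.exp_zero]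
  · rw [min_eq_right h, max_eq_right zero_le_one, mul_one, Circle.exp_two_pi]

lemma angle_eq_one {i : ℕ} {p : ℝ × ℝ} (h : p.1 ≤ 0 → p.2 ≤ 3 * i ∨ 3 * i + 2 ≤ p.2) :
    angle i p = 1 := by
  unfold angle
  split_ifs with h1
  · refine exp_clamp_eq_one ?_
    rcases h h1 with h | h
    · exact Or.inl (by linarith)
    · exact Or.inr (by linarith)
  · rfl

lemma continuous_angle (i : Fin m) :
    Continuous fun p : (stacked m).carrier => angle i p.1 := by
  rw [← continuousOn_univ]
  have hcover : (univ : Set (stacked m).carrier) =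
      {p : (stacked m).carrier | p.1.1 ≤ 0} ∪ {p : (stacked m).carrier | 0 ≤ p.1.1 ∧
        min (p.1.2 - 3 * (i : ℕ)) (3 * (i : ℕ) + 2 - p.1.2) ≤ p.1.1} := by
    refine (eq_univ_of_forall fun p => ?_).symm
    rcases le_or_gt p.1.1 0 with h | h
    · exact Or.inl h
    · refine Or.inr ⟨h.le, ?_⟩
      by_contra! h2
      rw [lt_min_iff] at h2
      exact (mem_carrier.1 p.2).2 i ⟨h, h2.1, h2.2⟩
  rw [hcover]
  have c1 : IsClosed {p : (stacked m).carrier | p.1.1 ≤ 0} :=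
    isClosed_le (by fun_prop) (by fun_prop)
  have c2 : IsClosed {p : (stacked m).carrier | 0 ≤ p.1.1} :=
    isClosed_le (by fun_prop) (by fun_prop)
  have c3 : IsClosed {p : (stacked m).carrier |
      min (p.1.2 - 3 * (i : ℕ)) (3 * (i : ℕ) + 2 - p.1.2) ≤ p.1.1} :=
    isClosed_le (by fun_prop) (by fun_prop)
  refine ContinuousOn.union_of_isClosed ?_ ?_ c1 (c2.inter c3)
  · have : Continuous fun p : (stacked m).carrier =>
        Circle.exp (2 * Real.pi * max 0 (min ((p.1.2 - 3 * (i : ℕ)) / 2) 1)) := by fun_prop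
    exact this.continuousOn.congr fun p hp => if_pos hp
  · refine (continuousOn_const (c := 1)).congr fun p hp => angle_eq_one fun h => ?_
    rcases min_le_iff.1 (hp.2.trans h) with h | h
    · exact Or.inl (by linarith)
    · exact Or.inr (by linarith)

lemma angle_eq_of_fiber (i : Fin m) {p q : (stacked m).polygon.carrier}
    (h : (stacked m).polygon.fiber p = (stacked m).polygon.fiber q) :
    angle i p.1 = angle i q.1 := by
  have key : ∀ p q : (stacked m).polygon.carrier, p.1.2 = q.1.2 →
      (∀ u ∈ uIcc p.1.1 q.1.1, (u, p.1.2) ∈ (stacked m).carrier) → p.1.1 ≤ 0 → 0 < q.1.1 →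
      angle i p.1 = angle i q.1 := by
    intro p q h1 h2 h3 h4
    rw [angle_eq_one (p := q.1) fun h => absurd h4 h.not_gt]
    refine angle_eq_one fun _ => ?_
    by_contra! h5
    set u := min q.1.1 (min (p.1.2 - 3 * (i : ℕ)) (3 * (i : ℕ) + 2 - p.1.2) / 2) with hu
    have hmin : 0 < min (p.1.2 - 3 * (i : ℕ)) (3 * (i : ℕ) + 2 - p.1.2) :=
      lt_min (by linarith) (by linarith)
    have hu0 : 0 < u := lt_min h4 (by linarith)
    have hu1 : u ≤ q.1.1 := min_le_left _ _
    have hu2 : u ≤ min (p.1.2 - 3 * (i : ℕ)) (3 * (i : ℕ) + 2 - p.1.2) / 2 := min_le_right _ _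
    have hu3 := min_le_left (p.1.2 - 3 * (i : ℕ)) (3 * (i : ℕ) + 2 - p.1.2)
    have hu4 := min_le_right (p.1.2 - 3 * (i : ℕ)) (3 * (i : ℕ) + 2 - p.1.2)
    have := h2 u (by rw [uIcc_of_le (by linarith)]; exact ⟨by linarith, hu1⟩)
    exact (mem_carrier.1 this).2 i ⟨hu0, by simp only; linarith, by simp only; linarith⟩
  obtain ⟨h1, h2⟩ := (PlanarPolygon.fiber_eq_iff p q).1 h
  rcases le_or_gt p.1.1 0 with hp | hp <;> rcases le_or_gt q.1.1 0 with hq | hq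
  · unfold angle
    rw [if_pos hp, if_pos hq, h1]
  · exact key p q h1 h2 hp hq
  · refine (key q p h1.symm (fun u hu => ?_) hq hp).symm
    rw [← h1]
    exact h2 u (uIcc_comm q.1.1 p.1.1 ▸ hu)
  · unfold angle
    rw [if_neg hp.not_ge, if_neg hq.not_ge]

/-- The map to the circle induced by `angle` on the Reeb graph. -/
noncomputable def reebAngle (i : Fin m) : C((stacked m).polygon.ReebGraph, Circle) where
  toFun := Quotient.lift (fun p => angle i p.1) fun _ _ h => angle_eq_of_fiber i h
  continuous_toFun := (continuous_angle i).quotient_lift _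

/-- The Reeb graph of the triangle with `m` stacked holes has at least `m` independent loops. -/
theorem le_of_homotopyEquiv_bouquet {b : ℕ}
    (h : ContinuousMap.HomotopyEquiv (stacked m).polygon.ReebGraph (Bouquet b)) : m ≤ b := by
  refine card_le_of_homotopyEquiv_bouquet h reebAngle fun c hc => ?_
  obtain ⟨θ, hθ⟩ := hc
  funext j
  -- The curves `γ` and `δ` run from the bottom to the top of the hole `j` along its two sides. The
  -- logarithm `θ` increases by `2 * π * c j` along `γ` and by `0` along `δ`.
  have hmem : ∀ (τ : unitInterval) (u : ℝ), u = 0 ∨ u = min (2 * (τ : ℝ)) (2 - 2 * τ) →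
      (u, 3 * (j : ℕ) + 2 * (τ : ℝ)) ∈ (stacked m).carrier := by
    intro τ u hu
    have h0 := τ.2.1
    have h1 := τ.2.2
    have l1 := min_le_left (2 * (τ : ℝ)) (2 - 2 * τ)
    have l2 := min_le_right (2 * (τ : ℝ)) (2 - 2 * τ)
    have l3 : 0 ≤ min (2 * (τ : ℝ)) (2 - 2 * τ) := le_min (by linarith) (by linarith)
    have hu0 : 0 ≤ u := by rcases hu with rfl | rfl <;> linarith
    refine mem_carrier.2 ⟨interior_subset (hull_subset j (mem_hole.2 ?_)), ?_⟩
    · rcases hu with rfl | rfl <;> simp only <;> refine ⟨?_, ?_, ?_⟩ <;> linarith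
    · rintro i ⟨h2, h3, h4⟩
      simp only at h2 h3 h4
      rcases lt_trichotomy (i : ℕ) (j : ℕ) with h5 | h5 | h5
      · have : ((i : ℕ) : ℝ) + 1 ≤ (j : ℕ) := by exact_mod_cast h5
        linarith
      · rw [h5] at h3 h4
        rcases hu with rfl | rfl
        · exact h2.ne rfl
        · exact absurd (lt_min (show _ < 2 * (τ : ℝ) by linarith)
            (show _ < 2 - 2 * (τ : ℝ) by linarith)) (lt_irrefl _)
      · have : ((j : ℕ) : ℝ) + 1 ≤ (i : ℕ) := by exact_mod_cast h5
        linarith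
  let γ : unitInterval → (stacked m).polygon.ReebGraph := fun τ =>
    Quotient.mk _ ⟨(0, 3 * (j : ℕ) + 2 * (τ : ℝ)), hmem τ _ (Or.inl rfl)⟩
  let δ : unitInterval → (stacked m).polygon.ReebGraph := fun τ =>
    Quotient.mk _ ⟨(min (2 * (τ : ℝ)) (2 - 2 * τ), 3 * (j : ℕ) + 2 * (τ : ℝ)),
      hmem τ _ (Or.inr rfl)⟩
  have hγ : Continuous γ :=
    continuous_quotient_mk'.comp (Continuous.subtype_mk (by fun_prop) _)
  have hδ : Continuous δ :=
    continuous_quotient_mk'.comp (Continuous.subtype_mk (by fun_prop) _)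
  have hother : ∀ (i : Fin m) (τ : unitInterval), i ≠ j →
      3 * (j : ℕ) + 2 * (τ : ℝ) ≤ 3 * (i : ℕ) ∨ 3 * (i : ℕ) + 2 ≤ 3 * (j : ℕ) + 2 * (τ : ℝ) := by
    intro i τ hij
    have h0 := τ.2.1
    have h1 := τ.2.2
    rcases lt_or_gt_of_ne (Fin.val_ne_of_ne hij) with h | h
    · have : ((i : ℕ) : ℝ) + 1 ≤ (j : ℕ) := by exact_mod_cast h
      exact Or.inr (by linarith)
    · have : ((j : ℕ) : ℝ) + 1 ≤ (i : ℕ) := by exact_mod_cast h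
      exact Or.inl (by linarith)
  have hγθ : ∀ τ, Circle.exp (θ (γ τ)) = Circle.exp (c j * (2 * Real.pi * (τ : ℝ))) := by
    intro τ
    rw [← hθ, Finset.prod_eq_single j, Circle.exp_intCast_mul]
    · congr 1
      have : (3 * ((j : ℕ) : ℝ) + 2 * (τ : ℝ) - 3 * (j : ℕ)) / 2 = τ := by ring
      change angle j (0, 3 * (j : ℕ) + 2 * (τ : ℝ)) = _
      unfold angle
      rw [if_pos le_rfl, this, min_eq_left τ.2.2, max_eq_right τ.2.1]
    · intro i _ hij
      have : reebAngle i (γ τ) = 1 := angle_eq_one fun _ => hother i τ hij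
      rw [this, one_zpow]
    · exact fun h => absurd (Finset.mem_univ _) h
  have hδθ : ∀ τ, Circle.exp (θ (δ τ)) = Circle.exp 0 := by
    intro τ
    rw [← hθ, Circle.exp_zero]
    refine Finset.prod_eq_one fun i _ => ?_
    have : reebAngle i (δ τ) = 1 := by
      refine angle_eq_one fun h => ?_
      by_cases hij : i = j
      · subst hij
        rcases min_le_iff.1 h with h | h
        · exact Or.inl (by simp only; linarith)
        · exact Or.inr (by simp only; linarith)
      · exact hother i τ hij
    rw [this, one_zpow]
  have e1 := sub_eq_sub_of_circleExp_eq (θ.continuous.comp hγ)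
    (show Continuous fun τ : unitInterval => (c j : ℝ) * (2 * Real.pi * (τ : ℝ)) by fun_prop)
    hγθ 0 1
  have e2 := sub_eq_sub_of_circleExp_eq (θ.continuous.comp hδ) continuous_const hδθ 0 1
  have g0 : γ 0 = δ 0 := by simp [γ, δ]
  have g1 : γ 1 = δ 1 := by simp [γ, δ]
  simp only [Function.comp_apply, g0, g1, Set.Icc.coe_zero, Set.Icc.coe_one] at e1 e2
  have hpi := Real.pi_pos
  have : (c j : ℝ) * (2 * Real.pi) = 0 := by linarith
  rcases mul_eq_zero.1 this with h | h
  · exact_mod_cast h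
  · linarith

end Stacked

/-! ### Optimal Reeb graphs -/

namespace PlanarPolygon

variable {P : PlanarPolygon}

lemma preconnectedSpace_reebGraph (h : IsPreconnected P.carrier) :
    PreconnectedSpace P.ReebGraph := by
  have := Subtype.preconnectedSpace h
  exact Quotient.mk_surjective.denseRange.preconnectedSpace continuous_quotient_mk'

end PlanarPolygon

/-- The Reeb graph of the triangle with `m` stacked holes is a bouquet of `m` circles up to
homotopy. -/
lemma nonempty_stacked_homotopyEquiv (m : ℕ) :
    Nonempty (ContinuousMap.HomotopyEquiv (stacked m).polygon.ReebGraph (Bouquet m)) := by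
  obtain ⟨b, hb, ⟨f⟩⟩ := PlanarPolygon.exists_homotopyEquiv_bouquet
    (stacked m).inGeneralPosition_polygon Stacked.isConnected_carrier.nonempty
    (PlanarPolygon.preconnectedSpace_reebGraph Stacked.isConnected_carrier.isPreconnected)
  rw [TriangleWithHoles.card_components_polygon] at hb
  obtain rfl : b = m := le_antisymm (by omega) (Stacked.le_of_homotopyEquiv_bouquet f)
  exact ⟨f⟩

/-- A polygon whose Reeb graph is homotopy equivalent to that of the triangle with `m` stacked
holes has at least `3 * (m + 1)` vertices. -/
lemma three_mul_le_of_homotopyEquiv_stacked {m : ℕ} {Q : PlanarPolygon} (hQ : Q.InGeneralPosition)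
    (f : ContinuousMap.HomotopyEquiv (stacked m).polygon.ReebGraph Q.ReebGraph) :
    3 * (m + 1) ≤ Q.reebVertices.ncard := by
  have := PlanarPolygon.preconnectedSpace_reebGraph (P := (stacked m).polygon)
    Stacked.isConnected_carrier.isPreconnected
  obtain ⟨p, hp⟩ := Stacked.isConnected_carrier (m := m).nonempty
  obtain ⟨x, -⟩ := Quotient.exists_rep (f.toFun (Quotient.mk _ ⟨p, hp⟩))
  obtain ⟨b, hb, ⟨g⟩⟩ := Q.exists_homotopyEquiv_bouquet hQ ⟨_, x.2⟩ f.preconnectedSpace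
  have hmb := Stacked.le_of_homotopyEquiv_bouquet (f.trans g)
  have := Q.three_mul_card_le
  rw [PlanarPolygon.ncard_reebVertices hQ]
  omega

theorem theorem1 (n : ℕ) (hn : 1 ≤ n) :
    (∀ P : PlanarPolygon, P.InGeneralPosition → P.IsNConnected n → P.HasOptimalReebGraph →
      P.reebVertices.ncard = 3 * n) ∧
    (∀ P : PlanarPolygon, P.InGeneralPosition → P.IsNConnected n →
      3 * n ≤ P.reebVertices.ncard) ∧
    (∃ P : PlanarPolygon, P.InGeneralPosition ∧ P.IsNConnected n ∧
      P.IsTriangleWithTriangularHoles (n - 1) ∧ P.reebVertices.ncard = 3 * n ∧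
      P.HasOptimalReebGraph) := by
  have hlow : ∀ P : PlanarPolygon, P.InGeneralPosition → P.IsNConnected n →
      3 * n ≤ P.reebVertices.ncard := fun P hP hn => by
    rw [PlanarPolygon.ncard_reebVertices hP, ← hn.2]
    exact P.three_mul_card_le
  refine ⟨fun P hP hPn hopt => le_antisymm ?_ (hlow P hP hPn), hlow, ?_⟩
  · obtain ⟨b, hb, ⟨f⟩⟩ := P.exists_homotopyEquiv_bouquet hP hPn.1.nonempty
      (PlanarPolygon.preconnectedSpace_reebGraph hPn.1.isPreconnected)
    rw [hPn.2] at hb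
    obtain ⟨g⟩ := nonempty_stacked_homotopyEquiv b
    by_contra! h
    refine hopt ⟨(stacked b).polygon, (stacked b).inGeneralPosition_polygon,
      ⟨f.trans g.symm⟩, ?_⟩
    rw [PlanarPolygon.ncard_reebVertices (stacked b).inGeneralPosition_polygon,
      TriangleWithHoles.card_vertices_polygon]
    omega
  · obtain ⟨m, rfl⟩ : ∃ m, n = m + 1 := ⟨n - 1, by omega⟩
    have hcard : (stacked m).polygon.reebVertices.ncard = 3 * (m + 1) := by
      rw [PlanarPolygon.ncard_reebVertices (stacked m).inGeneralPosition_polygon,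
        TriangleWithHoles.card_vertices_polygon]
    refine ⟨(stacked m).polygon, (stacked m).inGeneralPosition_polygon,
      ⟨Stacked.isConnected_carrier, (stacked m).card_components_polygon⟩,
      (stacked m).isTriangleWithTriangularHoles_polygon, hcard, ?_⟩
    rintro ⟨Q, hQ, ⟨f⟩, hlt⟩
    have := three_mul_le_of_homotopyEquiv_stacked hQ f
    omega
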